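/- Let $M$ be a connected smooth manifold of dimension $n\ge 2$, $\alpha=\sqrt{a_{ij}y^iy^j}$ a smooth Riemannian metric and $\beta=b_iy^i$ a smooth nowhere vanishing 1-form on $M$, and let $F=\alpha^2/\beta$ be the Kropina metric on the cone $\{\beta>0\}\subset TM$. Put $b^2=a^{ij}b_ib_j$, $\tilde\alpha=\alpha/b$ and $\tilde\beta=\beta/b^2$, so that $F=\tilde\alpha^2/\tilde\beta$ and $\|\tilde\beta\|_{\tilde\alpha}=1$. A smooth vector field $V$ with local flow $\varphi_t$ is conformal for $F$ with conformal factor $c$ if $F(\varphi_t(x),\varphi_{t*}y)=e^{2\sigma_t(x)}F(x,y)$ and $c=\frac{d}{dt}\big|_{t=0}\sigma_t$; it is homothetic if $c$ is constant. (1) Suppose that $F$ is a weak Einstein metric, that is, $\mathrm{Ric}=(n-1)\big(\frac{3\theta}{F}+\sigma\big)F^2$ for a 1-form $\theta$ and a scalar function $\sigma$ on $M$ (an Einstein metric if $\theta=0$). Then every conformal vector field of $F$ is homothetic. (2) Suppose that $F$ has constant flag curvature. Then $\tilde\alpha$ has constant sectional curvature $\mu$ for some $\mu\in\mathbb R$,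 $\tilde\beta$ is a Killing form of $\tilde\alpha$ (its covariant derivative is skew-symmetric), and conformal vector fields are locally determined as follows. For a vector $\gamma\in\mathbb R^n$ and a skew-symmetric matrix $Q$ write $$K_{\gamma,Q}(x)=\gamma+Qx+\mu\big(2\langle\gamma,x\rangle x-|x|^2\gamma\big).$$ Around every point there are local coordinates $x$, centred at that point, a vector $\delta\in\mathbb R^n$ with $|\delta|=\frac12$ and a skew-symmetric matrix $P$ with $P\delta=0$ and $P^2u=-\mu\,(u-4\langle\delta,u\rangle\delta)$ for all $u$, such that $1+\mu|x|^2>0$, $$\tilde\alpha=\frac{2|y|}{1+\mu|x|^2},\qquad \tilde\beta=\frac{4\langle K_{\delta,P}(x),y\rangle}{(1+\mu|x|^2)^2},$$ and every conformal vector field $V$ of $F$ has a constant conformal factor $c$ with $\mu c=0$ and is given in these coordinates by $$V=2c\,x+K_{\gamma,Q}(x)$$ for some $\gamma\in\mathbb R^n$ and some skew-symmetric matrix $Q$ with $Q\delta=P\gamma$ and $(PQ-QP)u=4\mu\big(\langle\gamma,u\rangle\delta-\langle\delta,u\rangle\gamma\big)$ for all $u$. -/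

import Mathlib

open Set Bundle
open scoped Manifold ContDiff Topology

noncomputable section

namespace KropinaGeometry

/-- Euclidean `n`-space, the model space of the manifolds below. -/
abbrev Model (n : ℕ) : Type := EuclideanSpace ℝ (Fin n)

/-! ### Finsler geometry in coordinates

`F x y` is a Finsler function on (a conic open part of) `ℝⁿ × ℝⁿ`, with position `x` and
direction `y`; all formulas are the classical ones in the coordinates `(x^i, y^i)`. -/

section Coordinates

variable {n : ℕ}

/-- The partial derivative `∂f/∂x^i`. -/
def dX (i : Fin n) (f : Model n → Model n → ℝ) (x y : Model n) : ℝ :=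
  fderiv ℝ (fun z => f z y) x (EuclideanSpace.single i 1)

/-- The partial derivative `∂f/∂y^i`. -/
def dY (i : Fin n) (f : Model n → Model n → ℝ) (x y : Model n) : ℝ :=
  fderiv ℝ (fun z => f x z) y (EuclideanSpace.single i 1)

/-- The function `F²`. -/
def energy (F : Model n → Model n → ℝ) (x y : Model n) : ℝ := F x y ^ 2

/-- The fundamental tensor `g_ij = (1/2) [F²]_{y^i y^j}`. -/
def fundTensor (F : Model n → Model n → ℝ) (x y : Model n) : Matrix (Fin n) (Fin n) ℝ :=
  Matrix.of fun i j => (1 / 2) * dY j (dY i (energy F)) x y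

/-- The inner product `g_y(v, w) = g_ij(x, y) v^i w^j`. -/
def fundForm (F : Model n → Model n → ℝ) (x y v w : Model n) : ℝ :=
  ∑ i, ∑ j, fundTensor F x y i j * v i * w j

/-- The spray coefficients `G^i = (1/4) g^{il} ([F²]_{x^k y^l} y^k - [F²]_{x^l})`. -/
def spray (F : Model n → Model n → ℝ) (i : Fin n) (x y : Model n) : ℝ :=
  (1 / 4) * ∑ l, (fundTensor F x y)⁻¹ i l *
    ((∑ k, dY l (dX k (energy F)) x y * y k) - dX l (energy F) x y)

/-- The Riemann curvature
`R^i_k = 2 ∂G^i/∂x^k - y^j ∂²G^i/∂x^j∂y^k + 2 G^j ∂²G^i/∂y^j∂y^k - ∂G^i/∂y^j ∂G^j/∂y^k`. -/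
def riemann (F : Model n → Model n → ℝ) (i k : Fin n) (x y : Model n) : ℝ :=
  2 * dX k (spray F i) x y
    - (∑ j, y j * dX j (dY k (spray F i)) x y)
    + 2 * (∑ j, spray F j x y * dY j (dY k (spray F i)) x y)
    - ∑ j, dY j (spray F i) x y * dY k (spray F j) x y

/-- The Ricci curvature `Ric = R^k_k`. -/
def ricci (F : Model n → Model n → ℝ) (x y : Model n) : ℝ :=
  ∑ k, riemann F k k x y

/-- The vector `R_y(w) = R^i_k w^k`. -/
def riemannVec (F : Model n → Model n → ℝ) (x y w : Model n) : Model n :=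
  WithLp.toLp 2 fun i => ∑ k, riemann F i k x y * w k

/-- The flag curvature of the flag with pole `y` and plane `span {y, w}`:
`K = g_y(R_y w, w) / (g_y(y, y) g_y(w, w) - g_y(y, w)²)`. -/
def flagCurvature (F : Model n → Model n → ℝ) (x y w : Model n) : ℝ :=
  fundForm F x y (riemannVec F x y w) w /
    (fundForm F x y y y * fundForm F x y w w - fundForm F x y y w ^ 2)

/-- `r_00 = b_{i|j} y^i y^j = y^j ∂(b_i y^i)/∂x^j - Γ^k_{ij} b_k y^i y^j` for a Riemannian metric
with norm function `A` and a 1-form `B x y = b_i(x) y^i`. The spray coefficients of `A` are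
`G^k = (1/2) Γ^k_{ij} y^i y^j`. -/
def symmCovDeriv (A B : Model n → Model n → ℝ) (x y : Model n) : ℝ :=
  (∑ j, y j * dX j B x y) - 2 * ∑ k, spray A k x y * dY k B x y

/-- The vector field `x ↦ γ + Q x + μ (2 ⟨γ, x⟩ x - |x|² γ)`. -/
def modelField (μ : ℝ) (γ : Model n) (Q : Model n →L[ℝ] Model n) (x : Model n) : Model n :=
  γ + Q x + μ • ((2 * inner ℝ γ x) • x - ‖x‖ ^ 2 • γ)

/-- Skew-symmetric linear maps of `ℝⁿ`. -/
def IsSkew (Q : Model n →L[ℝ] Model n) : Prop :=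
  ∀ x y : Model n, inner ℝ (Q x) y = -inner ℝ x (Q y)

end Coordinates

/-! ### Finsler geometry on a manifold

A (possibly singular) Finsler metric is given by a function `F x v` of tangent vectors together with
the set `D x` of those directions at `x` where it is defined. -/

section Manifold

variable {n : ℕ} {M : Type*} [TopologicalSpace M] [ChartedSpace (Model n) M]

/-- The tangent space of `M` at `x`. -/
abbrev TSpace (n : ℕ) {M : Type*} [TopologicalSpace M] [ChartedSpace (Model n) M] (x : M) : Type :=
  TangentSpace 𝓘(ℝ, Model n) x

/-- The smooth charts of `M`. -/
abbrev smoothCharts (n : ℕ) (M : Type*) [TopologicalSpace M] [ChartedSpace (Model n) M] :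
    Set (OpenPartialHomeomorph M (Model n)) :=
  IsManifold.maximalAtlas 𝓘(ℝ, Model n) ∞ M

/-- The coordinates `y` of the tangent vector `v = y^i ∂/∂x^i` at `x` in a chart `e`. -/
def coordVec (e : OpenPartialHomeomorph M (Model n)) (x : M) (v : TSpace n x) : Model n :=
  mfderiv 𝓘(ℝ, Model n) 𝓘(ℝ, Model n) e x v

/-- The coordinate expression, in a chart `e`, of a function of tangent vectors. -/
def inChart (e : OpenPartialHomeomorph M (Model n)) (F : ∀ x : M, TSpace n x → ℝ)
    (u y : Model n) : ℝ :=
  F (e.symm u) (mfderiv 𝓘(ℝ, Model n) 𝓘(ℝ, Model n) e.symm u y)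

/-- `F` is a weak Einstein metric: `Ric = (n - 1) (3 θ / F + σ) F²` for a 1-form `θ` and a
scalar function `σ`. (It is an Einstein metric if this holds with `θ = 0`.) -/
def IsWeakEinstein (D : ∀ x : M, Set (TSpace n x)) (F : ∀ x : M, TSpace n x → ℝ) : Prop :=
  ∃ (θ : ∀ x : M, TSpace n x →L[ℝ] ℝ) (σ : M → ℝ),
    ∀ e ∈ smoothCharts n M, ∀ x ∈ e.source, ∀ v ∈ D x,
      ricci (inChart e F) (e x) (coordVec e x v) =
        ((n : ℝ) - 1) * (3 * θ x v / F x v + σ x) * F x v ^ 2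

/-- `F` has constant flag curvature `κ`. For a Riemannian metric, the flag curvature is the
sectional curvature. -/
def HasConstFlagCurvature (D : ∀ x : M, Set (TSpace n x)) (F : ∀ x : M, TSpace n x → ℝ)
    (κ : ℝ) : Prop :=
  ∀ e ∈ smoothCharts n M, ∀ x ∈ e.source, ∀ v ∈ D x, ∀ w : TSpace n x,
    LinearIndependent ℝ ![v, w] →
      flagCurvature (inChart e F) (e x) (coordVec e x v) (coordVec e x w) = κ

/-- The 1-form `B` is a Killing form of the Riemannian metric with norm function `A`: its covariant
derivative is skew-symmetric, that is, `r_00 = 0`. -/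
def IsKillingForm (A B : ∀ x : M, TSpace n x → ℝ) : Prop :=
  ∀ e ∈ smoothCharts n M, ∀ x ∈ e.source, ∀ v : TSpace n x,
    symmCovDeriv (inChart e A) (inChart e B) (e x) (coordVec e x v) = 0

/-- `V` is a conformal vector field of `F` with conformal factor `c`: near each point, its local
flow `φ_t` satisfies `F(φ_t x, dφ_t v) = e^{2 σ_t(x)} F(x, v)`, and `c = dσ_t/dt` at `t = 0`. -/
def IsConformalField (D : ∀ x : M, Set (TSpace n x)) (F : ∀ x : M, TSpace n x → ℝ)
    (V : ∀ x : M, TSpace n x) (c : M → ℝ) : Prop :=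
  ∀ p : M, ∃ (ε : ℝ) (U : Set M) (φ : ℝ → M → M) (σ : ℝ → M → ℝ),
    0 < ε ∧ IsOpen U ∧ p ∈ U ∧
    ContMDiffOn (𝓘(ℝ, ℝ).prod 𝓘(ℝ, Model n)) 𝓘(ℝ, Model n) ∞
      (fun q : ℝ × M => φ q.1 q.2) (Ioo (-ε) ε ×ˢ U) ∧
    (∀ x ∈ U, φ 0 x = x) ∧
    (∀ x ∈ U, IsMIntegralCurveOn (I := 𝓘(ℝ, Model n)) (fun t => φ t x) V (Ioo (-ε) ε)) ∧
    (∀ t ∈ Ioo (-ε) ε, ∀ x ∈ U, ∀ v ∈ D x,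
      mfderiv 𝓘(ℝ, Model n) 𝓘(ℝ, Model n) (φ t) x v ∈ D (φ t x) ∧
      F (φ t x) (mfderiv 𝓘(ℝ, Model n) 𝓘(ℝ, Model n) (φ t) x v) =
        Real.exp (2 * σ t x) * F x v) ∧
    (∀ x ∈ U, HasDerivAt (fun t => σ t x) (c x) 0)

/-- Smooth vector fields. -/
def IsSmoothField (V : ∀ x : M, TSpace n x) [IsManifold 𝓘(ℝ, Model n) ∞ M] : Prop :=
  ContMDiff 𝓘(ℝ, Model n) (𝓘(ℝ, Model n).prod 𝓘(ℝ, Model n)) ∞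
    (fun x : M => TotalSpace.mk' (Model n) (E := fun x : M => TangentSpace 𝓘(ℝ, Model n) x) x (V x))

/-- Smooth 1-forms. -/
def IsSmoothForm [IsManifold 𝓘(ℝ, Model n) ∞ M] (β : ∀ x : M, TSpace n x →L[ℝ] ℝ) : Prop :=
  ContMDiff 𝓘(ℝ, Model n) (𝓘(ℝ, Model n).prod 𝓘(ℝ, Model n →L[ℝ] ℝ)) ∞
    (fun x : M => TotalSpace.mk' (Model n →L[ℝ] ℝ)
      (E := fun x : M => TangentSpace 𝓘(ℝ, Model n) x →L[ℝ] Bundle.Trivial M ℝ x) x (β x))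

end Manifold

/-! ### Riemannian metrics, 1-forms and Kropina metrics -/

section Kropina

variable {n : ℕ} {M : Type*} [TopologicalSpace M] [ChartedSpace (Model n) M]

/-- Smooth Riemannian metrics on `M`. -/
abbrev RMetric (n : ℕ) (M : Type*) [TopologicalSpace M] [ChartedSpace (Model n) M]
    [IsManifold 𝓘(ℝ, Model n) ∞ M] : Type _ :=
  ContMDiffRiemannianMetric 𝓘(ℝ, Model n) ∞ (Model n)
    (fun x : M => TangentSpace 𝓘(ℝ, Model n) x)

variable [IsManifold 𝓘(ℝ, Model n) ∞ M]

/-- The scalar product of `a` at `x` as a bilinear form. -/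
def bilin (a : RMetric n M) (x : M) : LinearMap.BilinForm ℝ (TSpace n x) :=
  LinearMap.mk₂ ℝ (fun v w => a.inner x v w) (by simp) (by simp) (by simp) (by simp)

theorem bilin_nondegenerate (a : RMetric n M) (x : M) : (bilin a x).Nondegenerate := by
  constructor
  · intro v hv
    by_contra h
    exact (a.pos x v h).ne' (hv v)
  · intro v hv
    by_contra h
    exact (a.pos x v h).ne' (hv v)

instance finiteDimensional_tSpace (x : M) : FiniteDimensional ℝ (TSpace n x) :=
  inferInstanceAs (FiniteDimensional ℝ (Model n))

/-- The vector `b^i = a^{ij} b_j` at `x` dual to the 1-form `β`. -/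
def sharp (a : RMetric n M) (β : ∀ x : M, TSpace n x →L[ℝ] ℝ) (x : M) : TSpace n x :=
  ((bilin a x).toDual (bilin_nondegenerate a x)).symm (β x).toLinearMap

theorem inner_sharp (a : RMetric n M) (β : ∀ x : M, TSpace n x →L[ℝ] ℝ) (x : M)
    (v : TSpace n x) : a.inner x (sharp a β x) v = β x v :=
  LinearMap.BilinForm.apply_toDual_symm_apply (hB := bilin_nondegenerate a x)
    (β x).toLinearMap v

/-- `b² = ‖β‖²_α = a^{ij} b_i b_j`. -/
def normSq (a : RMetric n M) (β : ∀ x : M, TSpace n x →L[ℝ] ℝ) (x : M) : ℝ :=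
  β x (sharp a β x)

/-- The Kropina metric `F = α² / β`. -/
def kropina (a : RMetric n M) (β : ∀ x : M, TSpace n x →L[ℝ] ℝ) (x : M) (v : TSpace n x) : ℝ :=
  a.inner x v v / β x v

/-- The directions in which the Kropina metric `F = α² / β > 0` is defined. -/
def kropinaDomain (β : ∀ x : M, TSpace n x →L[ℝ] ℝ) (x : M) : Set (TSpace n x) :=
  {v | 0 < β x v}

/-- The nonzero tangent vectors, where a Riemannian metric is a regular Finsler metric. -/
def slit (x : M) : Set (TSpace n x) := {v | v ≠ 0}

/-- The normalized Riemannian metric `α / b`. With `normForm` it defines the same Kropina metric,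
`(α / b)² / (β / b²) = α² / β`, and the normalized 1-form has length one. -/
def normMetric (a : RMetric n M) (β : ∀ x : M, TSpace n x →L[ℝ] ℝ) (x : M)
    (v : TSpace n x) : ℝ :=
  Real.sqrt (a.inner x v v / normSq a β x)

/-- The normalized 1-form `β / b²`. -/
def normForm (a : RMetric n M) (β : ∀ x : M, TSpace n x →L[ℝ] ℝ) (x : M) (v : TSpace n x) : ℝ :=
  β x v / normSq a β x

end Kropina

end KropinaGeometry

end

open Set Bundle
open scoped Manifold ContDiff Topology

noncomputable section

namespace KropinaGeometry

set_option synthInstance.maxHeartbeats 400000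

/-! ### Derivatives along lines and in coordinates. -/

section Calculus

variable {n : ℕ} {E E' : Type*} [NormedAddCommGroup E] [NormedSpace ℝ E]
  [NormedAddCommGroup E'] [NormedSpace ℝ E']

/-! Let h = α²/b² be the normalized metric, W the h-unit field dual to β/b², and S = ∇W. Then F(y) =
h(y,y)/h(W,y). Throughout, Γ is half of the Christoffel symbols, so that the spray of h is Γ(y,y).

Weak Einstein metrics have Killing W. Put r₀₀ = h(Sy,y). The spray of F is a part without pole along
h(y,y) = 0, plus y times -r₀₀ h(W,y)/h(y,y). Hence h(y,y)² Ric equals 3(n-1)(r₀₀ h(W,y))² plus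
h(y,y) times a function polynomial in y and 1/h(W,y) (`sq_mul_ricci_kropina`). The weak Einstein
condition makes the left side another such multiple of h(y,y). On a line W + tv, with v a unit
vector orthogonal to W, one has h(W,y) = 1 and h(y,y) = 1 + t², while r₀₀ = mt + st². So 1 + t²
divides (mt + st²)², and t = i gives m = s = 0. This yields r₀₀ = 0 (`killing_of_weakEinstein`).

Conformal fields are homothetic. Differentiate the flow condition and compare powers of t at y = z +
tW, with z orthogonal to W. The result is that V is conformal for h and that [V,W] = -2cW
(`kropina_conformal_algebra`). Differentiate the bracket relation covariantly along u and pair it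
with u: the curvature terms cancel because W is Killing, and dc(W) h(u,u) = dc(u) h(W,u) is left.
Since n ≥ 2, this forces dc = 0 (`fderiv_conformalFactor_eq_zero`).

Constant flag curvature κ. Taking a trace shows that F is Einstein, so W is Killing. The indicatrix
of F is the h-sphere of radius 1/2 centred at W/2, that is, y = (W + e)/2 with |e| = 1. For w
tangent to it, the identity S² = R(W,·)W and the Bianchi identity reduce the Finsler curvature R_y w
to R(w,e)e/4 (`sectional_of_flag_unit`). So h has constant curvature μ = 4κ.

Coordinates. On pairs of a vector u and a scalar f, the connection whose parallel sections satisfy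
∇_w u = -μfw and df(w) = h(u,w) is then flat. Its parallel sections exist locally
(`exists_parallel`), and the quotients f_i/(1 + f₀) of suitable ones are stereographic coordinates
(`exists_model_coordinates`). In them a Killing field is determined by its one-jet at the origin
(`eq_zero_of_killing_jet`), and the fields K realise every admissible jet. The condition |W| = 1
gives the relations between δ = W(0) and P = DW(0). Linearizing [V,W] = -2cW at the origin gives a
commutator formula for P and Q. Composed with P and traced, it gives μc = 0, because tr P² =
-μ(n-1). -/

/-- A Fréchet derivative is computed along a line. -/
theorem fderiv_eq_of_hasDerivAt_line {f : E → E'} {x v : E} {f' : E'}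
    (hf : DifferentiableAt ℝ f x) (h : HasDerivAt (fun t : ℝ => f (x + t • v)) f' 0) :
    fderiv ℝ f x v = f' :=
  (hf.hasFDerivAt.hasLineDerivAt v).unique h

theorem hasDerivAt_line {f : E → E'} {x : E} (hf : DifferentiableAt ℝ f x) (v : E) :
    HasDerivAt (fun t : ℝ => f (x + t • v)) (fderiv ℝ f x v) 0 :=
  hf.hasFDerivAt.hasLineDerivAt v

theorem hasDerivAt_line_id (x v : E) : HasDerivAt (fun t : ℝ => x + t • v) v 0 := by
  simpa using ((hasDerivAt_id (0 : ℝ)).smul_const v).const_add x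

theorem sum_smul_single (w : Model n) : ∑ k, w k • EuclideanSpace.single k (1 : ℝ) = w := by
  ext i
  simp [Finset.sum_apply, Pi.single_apply]

theorem map_eq_sum_single (L : Model n →L[ℝ] E) (w : Model n) :
    L w = ∑ k, w k • L (EuclideanSpace.single k 1) := by
  conv_lhs => rw [← sum_smul_single w]
  simp

theorem fderiv_coord {f : E → Model n} {x : E} (hf : DifferentiableAt ℝ f x) (i : Fin n) (v : E) :
    fderiv ℝ (fun z => f z i) x v = fderiv ℝ f x v i := by
  have := ((EuclideanSpace.proj (𝕜 := ℝ) i).hasFDerivAt.comp x hf.hasFDerivAt).fderiv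
  exact congrArg (fun L => L v) this

theorem fderiv_sum_smul {ι : Type*} [Fintype ι] {f : ι → E → E'} {x : E}
    (hf : ∀ k, DifferentiableAt ℝ (f k) x) (c : ι → ℝ) (v : E) :
    fderiv ℝ (fun z => ∑ k, c k • f k z) x v = ∑ k, c k • fderiv ℝ (f k) x v := by
  have h : HasFDerivAt (fun z => ∑ k, c k • f k z) (∑ k, c k • fderiv ℝ (f k) x) x :=
    HasFDerivAt.fun_sum fun k _ => (hf k).hasFDerivAt.const_smul (c k)
  rw [h.fderiv]
  simp

end Calculus

/-! ### Partial derivatives in position and direction; curvature of a spray. -/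

section Partials

variable {n : ℕ} {E : Type*} [NormedAddCommGroup E] [NormedSpace ℝ E]
variable {Ω : Set (Model n × Model n)} {G : Model n → Model n → E} {x y : Model n}

theorem slice_fst_mem_nhds (hΩ : IsOpen Ω) (hq : (x, y) ∈ Ω) : ∀ᶠ z in 𝓝 x, (z, y) ∈ Ω :=
  (Continuous.prodMk_left y).continuousAt.eventually (hΩ.mem_nhds hq)

theorem slice_snd_mem_nhds (hΩ : IsOpen Ω) (hq : (x, y) ∈ Ω) : ∀ᶠ z in 𝓝 y, (x, z) ∈ Ω :=
  (Continuous.prodMk_right x).continuousAt.eventually (hΩ.mem_nhds hq)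

/-- Joint smoothness of a function of position and direction. -/
abbrev JointSmooth (Ω : Set (Model n × Model n)) (G : Model n → Model n → E) : Prop :=
  ContDiffOn ℝ ∞ (fun q : Model n × Model n => G q.1 q.2) Ω

theorem JointSmooth.contDiffAt_fst (hG : JointSmooth Ω G) (hΩ : IsOpen Ω) (hq : (x, y) ∈ Ω) :
    ContDiffAt ℝ ∞ (fun z => G z y) x :=
  ContDiffAt.comp (g := fun q : Model n × Model n => G q.1 q.2) x
    (hG.contDiffAt (hΩ.mem_nhds hq))
    (contDiffAt_id.prodMk contDiffAt_const : ContDiffAt ℝ ∞ (fun z : Model n => (z, y)) x)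

theorem JointSmooth.contDiffAt_snd (hG : JointSmooth Ω G) (hΩ : IsOpen Ω) (hq : (x, y) ∈ Ω) :
    ContDiffAt ℝ ∞ (fun z => G x z) y :=
  ContDiffAt.comp (g := fun q : Model n × Model n => G q.1 q.2) y
    (hG.contDiffAt (hΩ.mem_nhds hq))
    (contDiffAt_const.prodMk contDiffAt_id : ContDiffAt ℝ ∞ (fun z : Model n => (x, z)) y)

theorem JointSmooth.differentiableAt_fst (hG : JointSmooth Ω G) (hΩ : IsOpen Ω)
    (hq : (x, y) ∈ Ω) : DifferentiableAt ℝ (fun z => G z y) x :=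
  (hG.contDiffAt_fst hΩ hq).differentiableAt (by simp)

theorem JointSmooth.differentiableAt_snd (hG : JointSmooth Ω G) (hΩ : IsOpen Ω)
    (hq : (x, y) ∈ Ω) : DifferentiableAt ℝ (fun z => G x z) y :=
  (hG.contDiffAt_snd hΩ hq).differentiableAt (by simp)

theorem JointSmooth.fderiv_fst_eq (hG : JointSmooth Ω G) (hΩ : IsOpen Ω) (hq : (x, y) ∈ Ω)
    (v : Model n) : fderiv ℝ (fun z => G z y) x v =
      fderiv ℝ (fun q : Model n × Model n => G q.1 q.2) (x, y) (v, 0) := by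
  have h1 : DifferentiableAt ℝ (fun q : Model n × Model n => G q.1 q.2) (x, y) :=
    (hG.contDiffAt (hΩ.mem_nhds hq)).differentiableAt (by simp)
  have h2 : HasFDerivAt (fun z : Model n => (z, y)) (ContinuousLinearMap.inl ℝ _ _) x :=
    hasFDerivAt_prodMk_left x y
  have := (HasFDerivAt.comp x h1.hasFDerivAt h2).fderiv
  exact congrArg (fun L => L v) this

theorem JointSmooth.fderiv_snd_eq (hG : JointSmooth Ω G) (hΩ : IsOpen Ω) (hq : (x, y) ∈ Ω)
    (v : Model n) : fderiv ℝ (fun z => G x z) y v =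
      fderiv ℝ (fun q : Model n × Model n => G q.1 q.2) (x, y) (0, v) := by
  have h1 : DifferentiableAt ℝ (fun q : Model n × Model n => G q.1 q.2) (x, y) :=
    (hG.contDiffAt (hΩ.mem_nhds hq)).differentiableAt (by simp)
  have h2 : HasFDerivAt (fun z : Model n => (x, z)) (ContinuousLinearMap.inr ℝ _ _) y :=
    hasFDerivAt_prodMk_right x y
  have := (HasFDerivAt.comp y h1.hasFDerivAt h2).fderiv
  exact congrArg (fun L => L v) this

theorem JointSmooth.partial_fst (hG : JointSmooth Ω G) (hΩ : IsOpen Ω) (v : Model n) :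
    JointSmooth Ω (fun x y => fderiv ℝ (fun z => G z y) x v) := by
  have h : ContDiffOn ℝ ∞ (fun q => fderiv ℝ (fun q : Model n × Model n => G q.1 q.2) q (v, 0)) Ω :=
    (hG.fderiv_of_isOpen hΩ (by simp)).clm_apply contDiffOn_const
  exact h.congr fun q hq => hG.fderiv_fst_eq hΩ hq v

theorem JointSmooth.partial_snd (hG : JointSmooth Ω G) (hΩ : IsOpen Ω) (v : Model n) :
    JointSmooth Ω (fun x y => fderiv ℝ (fun z => G x z) y v) := by
  have h : ContDiffOn ℝ ∞ (fun q => fderiv ℝ (fun q : Model n × Model n => G q.1 q.2) q (0, v)) Ω :=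
    (hG.fderiv_of_isOpen hΩ (by simp)).clm_apply contDiffOn_const
  exact h.congr fun q hq => hG.fderiv_snd_eq hΩ hq v

theorem fderiv_fst_congr {G' : Model n → Model n → E} (hΩ : IsOpen Ω) (hq : (x, y) ∈ Ω)
    (h : ∀ q ∈ Ω, G q.1 q.2 = G' q.1 q.2) :
    fderiv ℝ (fun z => G z y) x = fderiv ℝ (fun z => G' z y) x :=
  Filter.EventuallyEq.fderiv_eq ((slice_fst_mem_nhds hΩ hq).mono fun z hz => h (z, y) hz)

theorem fderiv_snd_congr {G' : Model n → Model n → E} (hΩ : IsOpen Ω) (hq : (x, y) ∈ Ω)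
    (h : ∀ q ∈ Ω, G q.1 q.2 = G' q.1 q.2) :
    fderiv ℝ (fun z => G x z) y = fderiv ℝ (fun z => G' x z) y :=
  Filter.EventuallyEq.fderiv_eq ((slice_snd_mem_nhds hΩ hq).mono fun z hz => h (x, z) hz)

theorem JointSmooth.coord {G : Model n → Model n → Model n} (hG : JointSmooth Ω G) (i : Fin n) :
    JointSmooth Ω (fun x y => G x y i) :=
  (EuclideanSpace.proj (𝕜 := ℝ) i).contDiff.comp_contDiffOn hG

/-- The Riemann curvature of a spray in terms of Fréchet derivatives. -/
theorem riemannVec_eq {F : Model n → Model n → ℝ} {G : Model n → Model n → Model n}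
    (hΩ : IsOpen Ω) (hG : JointSmooth Ω G) (hs : ∀ q ∈ Ω, ∀ i, spray F i q.1 q.2 = G q.1 q.2 i)
    (hq : (x, y) ∈ Ω) (w : Model n) :
    riemannVec F x y w = (2 : ℝ) • fderiv ℝ (fun z => G z y) x w
      - fderiv ℝ (fun z => fderiv ℝ (G z) y w) x y
      + (2 : ℝ) • fderiv ℝ (fun η => fderiv ℝ (G x) η w) y (G x y)
      - fderiv ℝ (G x) y (fderiv ℝ (G x) y w) := by
  set e : Fin n → Model n := fun k => EuclideanSpace.single k 1 with he
  have hY : ∀ i k, ∀ q ∈ Ω, dY k (spray F i) q.1 q.2 = fderiv ℝ (G q.1) q.2 (e k) i := by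
    intro i k q hq
    unfold dY
    rw [fderiv_snd_congr (G' := fun x y => G x y i) hΩ hq (fun q hq => hs q hq i),
      fderiv_coord (hG.differentiableAt_snd hΩ hq)]
  have hX : ∀ i k, dX k (spray F i) x y = fderiv ℝ (fun z => G z y) x (e k) i := by
    intro i k
    unfold dX
    rw [fderiv_fst_congr (G' := fun x y => G x y i) hΩ hq (fun q hq => hs q hq i),
      fderiv_coord (hG.differentiableAt_fst hΩ hq)]
  have hXY : ∀ i j k, dX j (dY k (spray F i)) x y =
      fderiv ℝ (fun z => fderiv ℝ (G z) y (e k)) x (e j) i := by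
    intro i j k
    unfold dX
    rw [fderiv_fst_congr (G' := fun x y => fderiv ℝ (G x) y (e k) i) hΩ hq
      (fun q hq => hY i k q hq), fderiv_coord ((hG.partial_snd hΩ (e k)).differentiableAt_fst hΩ hq)]
  have hYY : ∀ i j k, dY j (dY k (spray F i)) x y =
      fderiv ℝ (fun η => fderiv ℝ (G x) η (e k)) y (e j) i := by
    intro i j k
    change fderiv ℝ (fun z => dY k (spray F i) x z) y (e j) = _
    rw [fderiv_snd_congr (G' := fun x y => fderiv ℝ (G x) y (e k) i) hΩ hq
      (fun q hq => hY i k q hq), fderiv_coord ((hG.partial_snd hΩ (e k)).differentiableAt_snd hΩ hq)]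
  have expX : ∀ v, fderiv ℝ (fun z => fderiv ℝ (G z) y w) x v =
      ∑ k, w k • fderiv ℝ (fun z => fderiv ℝ (G z) y (e k)) x v := by
    intro v
    have : (fun z => fderiv ℝ (G z) y w) = fun z => ∑ k, w k • fderiv ℝ (G z) y (e k) :=
      funext fun z => map_eq_sum_single _ w
    rw [this]
    exact fderiv_sum_smul (fun k => (hG.partial_snd hΩ (e k)).differentiableAt_fst hΩ hq) _ _
  have expY : ∀ v, fderiv ℝ (fun η => fderiv ℝ (G x) η w) y v =
      ∑ k, w k • fderiv ℝ (fun η => fderiv ℝ (G x) η (e k)) y v := by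
    intro v
    have : (fun η => fderiv ℝ (G x) η w) = fun η => ∑ k, w k • fderiv ℝ (G x) η (e k) :=
      funext fun z => map_eq_sum_single _ w
    rw [this]
    exact fderiv_sum_smul (fun k => (hG.partial_snd hΩ (e k)).differentiableAt_snd hΩ hq) _ _
  ext i
  have key : ∀ k, riemann F i k x y = 2 * fderiv ℝ (fun z => G z y) x (e k) i
      - fderiv ℝ (fun z => fderiv ℝ (G z) y (e k)) x y i
      + 2 * fderiv ℝ (fun η => fderiv ℝ (G x) η (e k)) y (G x y) i
      - fderiv ℝ (G x) y (fderiv ℝ (G x) y (e k)) i := by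
    intro k
    unfold riemann
    rw [hX]
    congr 1
    · congr 1
      · congr 1
        rw [map_eq_sum_single _ y]
        simp [hXY, he]
      · congr 1
        rw [map_eq_sum_single _ (G x y)]
        simp only [hYY, he, WithLp.ofLp_sum, Finset.sum_apply, smul_eq_mul,
          WithLp.ofLp_smul, Pi.smul_apply]
        exact Finset.sum_congr rfl fun j _ => by rw [hs _ hq]
    · rw [map_eq_sum_single _ (fderiv ℝ (G x) y (e k))]
      simp only [he, WithLp.ofLp_sum, Finset.sum_apply, smul_eq_mul,
          WithLp.ofLp_smul, Pi.smul_apply]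
      exact Finset.sum_congr rfl fun j _ => by rw [hY _ _ _ hq, hY _ _ _ hq]; simp only [he]; ring
  unfold riemannVec
  rw [expX, expY, map_eq_sum_single _ w, map_eq_sum_single (fderiv ℝ (G x) y) w]
  simp only [key, map_sum, map_smul, WithLp.ofLp_sum, Finset.sum_apply, smul_eq_mul,
    WithLp.ofLp_smul, Pi.smul_apply, PiLp.sub_apply, PiLp.add_apply, PiLp.smul_apply,
    Finset.mul_sum, ← Finset.sum_add_distrib, ← Finset.sum_sub_distrib]
  exact Finset.sum_congr rfl fun k _ => by simp only [he]; ring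

end Partials

/-! ### Fundamental tensor and spray without indices. -/

section Sprays

variable {n : ℕ} {Ω : Set (Model n × Model n)} {F En : Model n → Model n → ℝ} {x y : Model n}

theorem fundTensor_eq (hΩ : IsOpen Ω)
    (hF : ∀ q ∈ Ω, energy F q.1 q.2 = En q.1 q.2) (hq : (x, y) ∈ Ω) (i j : Fin n) :
    fundTensor F x y i j = (1 / 2) * fderiv ℝ (fun η => fderiv ℝ (En x) η
      (EuclideanSpace.single i 1)) y (EuclideanSpace.single j 1) := by
  have hY : ∀ q ∈ Ω, dY i (energy F) q.1 q.2 =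
      fderiv ℝ (En q.1) q.2 (EuclideanSpace.single i 1) := by
    intro q hq
    unfold dY
    rw [fderiv_snd_congr (G' := En) hΩ hq hF]
  unfold fundTensor
  rw [Matrix.of_apply]
  change 1 / 2 * fderiv ℝ (fun z => dY i (energy F) x z) y _ = _
  rw [fderiv_snd_congr (G' := fun x y => fderiv ℝ (En x) y (EuclideanSpace.single i 1)) hΩ hq hY]

theorem fundForm_eq (hΩ : IsOpen Ω) (hEn : JointSmooth Ω En)
    (hF : ∀ q ∈ Ω, energy F q.1 q.2 = En q.1 q.2) (hq : (x, y) ∈ Ω) (v w : Model n) :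
    fundForm F x y v w = (1 / 2) * fderiv ℝ (fun η => fderiv ℝ (En x) η v) y w := by
  have : (fun η => fderiv ℝ (En x) η v) =
      fun η => ∑ k, v k • fderiv ℝ (En x) η (EuclideanSpace.single k 1) :=
    funext fun z => map_eq_sum_single _ v
  rw [this, fderiv_sum_smul fun k => (hEn.partial_snd hΩ _).differentiableAt_snd hΩ hq]
  unfold fundForm
  rw [Finset.mul_sum]
  refine Finset.sum_congr rfl fun i _ => ?_
  rw [map_eq_sum_single _ w]
  simp only [fundTensor_eq hΩ hF hq, smul_eq_mul, Finset.mul_sum]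
  exact Finset.sum_congr rfl fun j _ => by ring

theorem fundForm_eq_dotProduct (F : Model n → Model n → ℝ) (x y v w : Model n) :
    fundForm F x y v w = (fun i => v i) ⬝ᵥ (fundTensor F x y).mulVec (fun i => w i) := by
  simp only [fundForm, dotProduct, Matrix.mulVec, Finset.mul_sum]
  exact Finset.sum_congr rfl fun i _ => Finset.sum_congr rfl fun j _ => by ring

/-- A positive definite form has no kernel vector. This is what makes the inverse matrix in the
definition of the spray a genuine inverse. -/
theorem isUnit_det_fundTensor (hpos : ∀ w, w ≠ 0 → 0 < fundForm F x y w w) :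
    IsUnit (fundTensor F x y).det := by
  rw [isUnit_iff_ne_zero]
  intro h0
  obtain ⟨v, hv, hv0⟩ := Matrix.exists_mulVec_eq_zero_iff.2 h0
  have h1 := hpos (WithLp.toLp 2 v) (fun h => hv (by
    have := congrArg WithLp.ofLp h
    simpa using this))
  rw [fundForm_eq_dotProduct] at h1
  simp [hv0] at h1

/-- The spray is determined by the Euler-Lagrange expression. -/
theorem spray_eq (hΩ : IsOpen Ω) (hEn : JointSmooth Ω En)
    (hF : ∀ q ∈ Ω, energy F q.1 q.2 = En q.1 q.2) (hq : (x, y) ∈ Ω)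
    (hpos : ∀ w, w ≠ 0 → 0 < fundForm F x y w w) (g : Model n)
    (hg : ∀ w, fundForm F x y w g = (1 / 4) *
      (fderiv ℝ (fun η => fderiv ℝ (fun z => En z η) x y) y w
        - fderiv ℝ (fun z => En z y) x w)) (i : Fin n) :
    spray F i x y = g i := by
  have hX : ∀ k, ∀ q ∈ Ω, dX k (energy F) q.1 q.2 =
      fderiv ℝ (fun z => En z q.2) q.1 (EuclideanSpace.single k 1) := by
    intro k q hq
    unfold dX
    rw [fderiv_fst_congr (G' := En) hΩ hq hF]
  have hYX : ∀ l k, dY l (dX k (energy F)) x y =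
      fderiv ℝ (fun η => fderiv ℝ (fun z => En z η) x (EuclideanSpace.single k 1)) y
        (EuclideanSpace.single l 1) := by
    intro l k
    change fderiv ℝ (fun z => dX k (energy F) x z) y _ = _
    rw [fderiv_snd_congr
      (G' := fun x y => fderiv ℝ (fun z => En z y) x (EuclideanSpace.single k 1)) hΩ hq (hX k)]
  have hl : ∀ l, (fundTensor F x y).mulVec (fun i => g i) l = (1 / 4) *
      ((∑ k, dY l (dX k (energy F)) x y * y k) - dX l (energy F) x y) := by
    intro l
    have h1 := hg (EuclideanSpace.single l 1)
    rw [fundForm_eq_dotProduct] at h1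
    have h2 : (fun i => (EuclideanSpace.single l (1 : ℝ) : Model n) i) = Pi.single l 1 := by
      ext j; simp [Pi.single_apply]
    rw [h2, single_one_dotProduct] at h1
    rw [h1, hX l _ hq]
    congr 2
    have : (fun η => fderiv ℝ (fun z => En z η) x y) =
      fun η => ∑ k, y k • fderiv ℝ (fun z => En z η) x (EuclideanSpace.single k 1) :=
      funext fun z => map_eq_sum_single _ y
    rw [this, fderiv_sum_smul fun k => (hEn.partial_fst hΩ _).differentiableAt_snd hΩ hq]
    exact Finset.sum_congr rfl fun k _ => by rw [hYX]; simp [mul_comm]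
  have hu := isUnit_det_fundTensor hpos
  unfold spray
  have : (fun i => g i) = (fundTensor F x y)⁻¹.mulVec ((fundTensor F x y).mulVec fun i => g i) := by
    rw [Matrix.mulVec_mulVec, Matrix.nonsing_inv_mul _ hu, Matrix.one_mulVec]
  calc _ = (fundTensor F x y)⁻¹.mulVec ((fundTensor F x y).mulVec fun i => g i) i := by
        conv_rhs => unfold Matrix.mulVec
        simp only [dotProduct]
        rw [Finset.mul_sum]
        refine Finset.sum_congr rfl fun l _ => ?_
        have := hl l
        simp only [Matrix.mulVec, dotProduct] at this
        rw [this]; ring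
    _ = g i := by rw [← this]

end Sprays

section Instances

variable {E F : Type*} [NormedAddCommGroup E] [NormedSpace ℝ E] [NormedAddCommGroup F]
  [NormedSpace ℝ F]

instance normedAddCommGroupBilinear : NormedAddCommGroup (E →L[ℝ] E →L[ℝ] F) := inferInstance

instance normedSpaceBilinear : NormedSpace ℝ (E →L[ℝ] E →L[ℝ] F) := inferInstance

instance normedAddCommGroupTrilinear : NormedAddCommGroup (E →L[ℝ] E →L[ℝ] E →L[ℝ] F) :=
  inferInstance

instance normedSpaceTrilinear : NormedSpace ℝ (E →L[ℝ] E →L[ℝ] E →L[ℝ] F) := inferInstance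

end Instances

/-! ### Riemannian metrics and Christoffel symbols on an open set. -/

section Metric

variable {E : Type*} [NormedAddCommGroup E] [NormedSpace ℝ E]

/-- Two expressions of the same function on an open set have the same derivatives. -/
theorem hasDerivAt_line_unique {E' : Type*} [NormedAddCommGroup E'] [NormedSpace ℝ E']
    {U : Set E} (hU : IsOpen U) {x a : E} (hx : x ∈ U) {f g : E → E'} {f' g' : E'}
    (H : ∀ z ∈ U, f z = g z) (hf : HasDerivAt (fun t : ℝ => f (x + t • a)) f' 0)
    (hg : HasDerivAt (fun t : ℝ => g (x + t • a)) g' 0) : f' = g' := by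
  refine hf.unique (hg.congr_of_eventuallyEq ?_)
  have hc : ContinuousAt (fun t : ℝ => x + t • a) 0 := by fun_prop
  have : ∀ᶠ t in 𝓝 (0 : ℝ), x + t • a ∈ U :=
    hc.eventually (by simpa using hU.mem_nhds hx)
  exact this.mono fun t ht => H _ ht

theorem differentiableAt_of_contDiffOn {E' : Type*} [NormedAddCommGroup E'] [NormedSpace ℝ E']
    {U : Set E} (hU : IsOpen U) {f : E → E'} (hf : ContDiffOn ℝ ∞ f U) {x : E} (hx : x ∈ U) :
    DifferentiableAt ℝ f x :=
  (hf.contDiffAt (hU.mem_nhds hx)).differentiableAt (by simp)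

theorem contDiffOn_fderiv {E' : Type*} [NormedAddCommGroup E'] [NormedSpace ℝ E']
    {U : Set E} (hU : IsOpen U) {f : E → E'} (hf : ContDiffOn ℝ ∞ f U) :
    ContDiffOn ℝ ∞ (fderiv ℝ f) U :=
  hf.fderiv_of_isOpen hU (by simp)

theorem fderiv_fderiv_symm {E' : Type*} [NormedAddCommGroup E'] [NormedSpace ℝ E']
    {U : Set E} (hU : IsOpen U) {f : E → E'} (hf : ContDiffOn ℝ ∞ f U) {x : E} (hx : x ∈ U)
    (u v : E) : fderiv ℝ (fderiv ℝ f) x u v = fderiv ℝ (fderiv ℝ f) x v u :=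
  ((hf.contDiffAt (hU.mem_nhds hx)).isSymmSndFDerivAt (by simp; exact WithTop.coe_le_coe.2 le_top)).eq u v

/-- Smooth Riemannian metrics on an open set. -/
structure IsMetric (U : Set E) (h : E → E →L[ℝ] E →L[ℝ] ℝ) : Prop where
  isOpen : IsOpen U
  smooth : ContDiffOn ℝ ∞ h U
  symm : ∀ x ∈ U, ∀ v w, h x v w = h x w v
  pos : ∀ x ∈ U, ∀ v, v ≠ 0 → 0 < h x v v

/-- `2Γ` are the Christoffel symbols of the metric `h`. -/
structure IsChristoffel (U : Set E) (h : E → E →L[ℝ] E →L[ℝ] ℝ)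
    (Γ : E → E →L[ℝ] E →L[ℝ] E) : Prop where
  smooth : ContDiffOn ℝ ∞ Γ U
  symm : ∀ x ∈ U, ∀ v w, Γ x v w = Γ x w v
  compat : ∀ x ∈ U, ∀ u v w, fderiv ℝ h x u v w = 2 * h x (Γ x u v) w + 2 * h x v (Γ x u w)

/-- The covariant derivative `w ↦ ∇_w V` of a vector field. -/
def covDeriv (Γ : E → E →L[ℝ] E →L[ℝ] E) (V : E → E) (x : E) : E →L[ℝ] E :=
  fderiv ℝ V x + (2 : ℝ) • (Γ x).flip (V x)

theorem covDeriv_apply (Γ : E → E →L[ℝ] E →L[ℝ] E) (V : E → E) (x w : E) :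
    covDeriv Γ V x w = fderiv ℝ V x w + (2 : ℝ) • Γ x w (V x) := rfl

/-- The covariant derivative `(∇_u S) v` of a field of endomorphisms. -/
def covDerivEnd (Γ : E → E →L[ℝ] E →L[ℝ] E) (S : E → E →L[ℝ] E) (x u v : E) : E :=
  fderiv ℝ S x u v + (2 : ℝ) • Γ x u (S x v) - (2 : ℝ) • S x (Γ x u v)

/-- The curvature `R(u, v) z`. -/
def curv (Γ : E → E →L[ℝ] E →L[ℝ] E) (x u v z : E) : E :=
  (2 : ℝ) • fderiv ℝ Γ x u v z - (2 : ℝ) • fderiv ℝ Γ x v u z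
    + (4 : ℝ) • Γ x u (Γ x v z) - (4 : ℝ) • Γ x v (Γ x u z)

variable {U : Set E} {h : E → E →L[ℝ] E →L[ℝ] ℝ} {Γ : E → E →L[ℝ] E →L[ℝ] E} {x : E}

theorem IsMetric.differentiableAt (hh : IsMetric U h) (hx : x ∈ U) : DifferentiableAt ℝ h x :=
  differentiableAt_of_contDiffOn hh.isOpen hh.smooth hx

theorem IsMetric.fderiv_symm (hh : IsMetric U h) (hx : x ∈ U) (u v w : E) :
    fderiv ℝ h x u v w = fderiv ℝ h x u w v := by
  have h1 := hasDerivAt_line (hh.differentiableAt hx) u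
  have h2 : ∀ v w, HasDerivAt (fun t : ℝ => h (x + t • u) v w) (fderiv ℝ h x u v w) 0 := by
    intro v w
    simpa using (h1.clm_apply (hasDerivAt_const (0 : ℝ) v)).clm_apply (hasDerivAt_const (0 : ℝ) w)
  exact hasDerivAt_line_unique hh.isOpen hx (fun z hz => hh.symm z hz v w) (h2 v w) (h2 w v)

theorem IsMetric.ext (hh : IsMetric U h) (hx : x ∈ U) {v w : E}
    (H : ∀ u, h x u v = h x u w) : v = w := by
  by_contra hne
  have := hh.pos x hx (v - w) (sub_ne_zero.2 hne)
  rw [map_sub, H, sub_self] at this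
  exact lt_irrefl _ this

theorem IsMetric.exists_equiv [FiniteDimensional ℝ E] (hh : IsMetric U h) (hx : x ∈ U) :
    ∃ e : E ≃L[ℝ] (E →L[ℝ] ℝ), (e : E →L[ℝ] (E →L[ℝ] ℝ)) = h x := by
  have hinj : Function.Injective (h x) := by
    intro v w hvw
    exact hh.ext hx fun u => by rw [hh.symm x hx, hh.symm x hx u, hvw]
  have e : Module.finrank ℝ E = Module.finrank ℝ (E →L[ℝ] ℝ) := by
    rw [(LinearMap.toContinuousLinearMap (𝕜 := ℝ) (E := E) (F' := ℝ)).symm.finrank_eq]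
    exact (Subspace.dual_finrank_eq (K := ℝ) (V := E)).symm
  have hsurj := (LinearMap.injective_iff_surjective_of_finrank_eq_finrank e
    (f := (h x).toLinearMap)).1 hinj
  exact ⟨(LinearEquiv.ofBijective (h x).toLinearMap ⟨hinj, hsurj⟩).toContinuousLinearEquiv, by
    ext; rfl⟩

/-- The Koszul formula prescribes the covector h(Γ(u,v), ·). Its factor is 1/4 instead of 1/2
because the Christoffel symbols are 2Γ. Smoothness follows from the smoothness of inversion at
invertible maps. -/
theorem IsMetric.exists_christoffel [FiniteDimensional ℝ E] (hh : IsMetric U h) :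
    ∃ Γ, IsChristoffel U h Γ := by
  have hD : ContDiffOn ℝ ∞ (fderiv ℝ h) U := contDiffOn_fderiv hh.isOpen hh.smooth
  let K : E → E → E → (E →L[ℝ] ℝ) := fun x u v => (1 / 4 : ℝ) •
    (fderiv ℝ h x u v + fderiv ℝ h x v u - (((fderiv ℝ h x).flip u).flip v))
  have hK : ∀ x u v w, K x u v w = 1 / 4 *
    (fderiv ℝ h x u v w + fderiv ℝ h x v u w - fderiv ℝ h x w u v) := fun _ _ _ _ => rfl
  have hKs : ∀ u v, ContDiffOn ℝ ∞ (fun x => K x u v) U := by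
    intro u v
    rw [contDiffOn_clm_apply]
    intro w
    have h3 : ∀ a b c : E, ContDiffOn ℝ ∞ (fun x => fderiv ℝ h x a b c) U := fun a b c =>
      ((hD.clm_apply contDiffOn_const).clm_apply contDiffOn_const).clm_apply contDiffOn_const
    exact contDiffOn_const.mul (((h3 u v w).add (h3 v u w)).sub (h3 w u v))
  let Γ : E → E →L[ℝ] E →L[ℝ] E := fun x => LinearMap.toContinuousBilinearMap
    (LinearMap.mk₂ ℝ (fun u v => ContinuousLinearMap.inverse (h x) (K x u v))
      (fun u u' v => by rw [← map_add]; congr 1; ext w; simp [hK]; ring)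
      (fun c u v => by rw [← map_smul]; congr 1; ext w; simp [hK]; ring)
      (fun u v v' => by rw [← map_add]; congr 1; ext w; simp [hK]; ring)
      (fun c u v => by rw [← map_smul]; congr 1; ext w; simp [hK]; ring))
  have hΓ : ∀ x ∈ U, ∀ u v w, h x (Γ x u v) w = K x u v w := by
    intro x hx u v w
    obtain ⟨e, he⟩ := hh.exists_equiv hx
    have : Γ x u v = e.symm (K x u v) := by
      change ContinuousLinearMap.inverse (h x) (K x u v) = _
      rw [← he, ContinuousLinearMap.inverse_equiv]
      rfl
    rw [this, ← he]
    simp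
  refine ⟨Γ, ?_, ?_, ?_⟩
  · rw [contDiffOn_clm_apply]
    intro u
    rw [contDiffOn_clm_apply]
    intro v x hx
    change ContDiffWithinAt ℝ ∞ (fun x => ContinuousLinearMap.inverse (h x) (K x u v)) U x
    obtain ⟨e, he⟩ := hh.exists_equiv hx
    have h1 : ContDiffAt ℝ ∞ ContinuousLinearMap.inverse (h x) := he ▸ contDiffAt_map_inverse e
    exact (h1.comp_contDiffWithinAt x (hh.smooth x hx)).clm_apply (hKs u v x hx)
  · intro x hx v w
    refine hh.ext hx fun u => ?_
    rw [hh.symm x hx, hh.symm x hx u, hΓ x hx, hΓ x hx]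
    rw [hK, hK, hh.fderiv_symm hx u v w]
    ring
  · intro x hx u v w
    rw [hh.symm x hx v, hΓ x hx, hΓ x hx]
    rw [hK, hK, hh.fderiv_symm hx u w v, hh.fderiv_symm hx w u v, hh.fderiv_symm hx v u w]
    ring

end Metric

/-! ### Symmetries of the curvature tensor. -/

section Curvature

variable {E : Type*} [NormedAddCommGroup E] [NormedSpace ℝ E]
variable {U : Set E} {h : E → E →L[ℝ] E →L[ℝ] ℝ} {Γ : E → E →L[ℝ] E →L[ℝ] E} {x : E}

theorem curv_swap (Γ : E → E →L[ℝ] E →L[ℝ] E) (x u v z : E) :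
    curv Γ x u v z = -curv Γ x v u z := by
  unfold curv; module

theorem curv_add_fst (Γ : E → E →L[ℝ] E →L[ℝ] E) (x u u' v z : E) :
    curv Γ x (u + u') v z = curv Γ x u v z + curv Γ x u' v z := by
  simp only [curv, map_add, add_apply]; module

theorem curv_smul_fst (Γ : E → E →L[ℝ] E →L[ℝ] E) (x : E) (c : ℝ) (u v z : E) :
    curv Γ x (c • u) v z = c • curv Γ x u v z := by
  simp only [curv, map_smul, smul_apply]; module

theorem curv_add_snd (Γ : E → E →L[ℝ] E →L[ℝ] E) (x u v v' z : E) :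
    curv Γ x u (v + v') z = curv Γ x u v z + curv Γ x u v' z := by
  rw [curv_swap, curv_add_fst, curv_swap Γ x v, curv_swap Γ x v']; module

theorem curv_smul_snd (Γ : E → E →L[ℝ] E →L[ℝ] E) (x : E) (c : ℝ) (u v z : E) :
    curv Γ x u (c • v) z = c • curv Γ x u v z := by
  rw [curv_swap, curv_smul_fst, curv_swap Γ x v]; module

theorem curv_add_trd (Γ : E → E →L[ℝ] E →L[ℝ] E) (x u v z z' : E) :
    curv Γ x u v (z + z') = curv Γ x u v z + curv Γ x u v z' := by
  simp only [curv, map_add]; module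

theorem curv_smul_trd (Γ : E → E →L[ℝ] E →L[ℝ] E) (x : E) (c : ℝ) (u v z : E) :
    curv Γ x u v (c • z) = c • curv Γ x u v z := by
  simp only [curv, map_smul]; module

variable (hh : IsMetric U h) (hΓ : IsChristoffel U h Γ) (hx : x ∈ U)
include hh hΓ hx

theorem IsChristoffel.differentiableAt : DifferentiableAt ℝ Γ x :=
  differentiableAt_of_contDiffOn hh.isOpen hΓ.smooth hx

theorem IsChristoffel.fderiv_symm (u v w : E) : fderiv ℝ Γ x u v w = fderiv ℝ Γ x u w v := by
  have h1 := hasDerivAt_line (hΓ.differentiableAt hh hx) u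
  have h2 : ∀ v w, HasDerivAt (fun t : ℝ => Γ (x + t • u) v w) (fderiv ℝ Γ x u v w) 0 := by
    intro v w
    simpa using (h1.clm_apply (hasDerivAt_const (0 : ℝ) v)).clm_apply (hasDerivAt_const (0 : ℝ) w)
  exact hasDerivAt_line_unique hh.isOpen hx (fun z hz => hΓ.symm z hz v w) (h2 v w) (h2 w v)

/-- Metric compatibility differentiated once more. The symmetry of this second derivative is the
source of the skewness of the curvature. -/
theorem fderiv_fderiv_metric (a u v w : E) :
    fderiv ℝ (fderiv ℝ h) x a u v w =
      2 * (fderiv ℝ h x a (Γ x u v) w + h x (fderiv ℝ Γ x a u v) w)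
        + 2 * (fderiv ℝ h x a v (Γ x u w) + h x v (fderiv ℝ Γ x a u w)) := by
  have hD := hasDerivAt_line (differentiableAt_of_contDiffOn hh.isOpen
    (contDiffOn_fderiv hh.isOpen hh.smooth) hx) a
  have hc := fun z : E => hasDerivAt_const (0 : ℝ) z
  have h1 := ((hD.clm_apply (hc u)).clm_apply (hc v)).clm_apply (hc w)
  have hG := hasDerivAt_line (hΓ.differentiableAt hh hx) a
  have hH := hasDerivAt_line (hh.differentiableAt hx) a
  have hGuv := fun v => (hG.clm_apply (hc u)).clm_apply (hc v)
  have h2 := (((hH.clm_apply (hGuv v)).clm_apply (hc w)).const_mul 2).add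
    (((hH.clm_apply (hc v)).clm_apply (hGuv w)).const_mul 2)
  have := hasDerivAt_line_unique (f := fun z => fderiv ℝ h z u v w)
    (g := fun z => 2 * h z (Γ z u v) w + 2 * h z v (Γ z u w)) hh.isOpen hx
    (fun z hz => hΓ.compat z hz u v w) h1 h2
  simpa using this

theorem curv_bianchi (u v z : E) :
    curv Γ x u v z + curv Γ x v z u + curv Γ x z u v = 0 := by
  unfold curv
  rw [hΓ.fderiv_symm hh hx u z v, hΓ.fderiv_symm hh hx v u z, hΓ.fderiv_symm hh hx z v u,
    hΓ.symm x hx z v, hΓ.symm x hx u z, hΓ.symm x hx v u]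
  module

/-- Second derivatives of h commute, and the difference of the two expressions from
`fderiv_fderiv_metric` is exactly the part of the curvature symmetric in z and w. -/
theorem metric_curv_skew (u v z w : E) :
    h x (curv Γ x u v z) w = -h x (curv Γ x u v w) z := by
  have h1 := fderiv_fderiv_metric hh hΓ hx u v z w
  have h2 := fderiv_fderiv_metric hh hΓ hx v u z w
  rw [fderiv_fderiv_symm hh.isOpen hh.smooth hx v u] at h2
  have h3 := h1.symm.trans h2
  simp only [hΓ.compat x hx] at h3
  simp only [curv, map_sub, map_add, map_smul, sub_apply, add_apply, smul_apply, smul_eq_mul]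
  rw [hh.symm x hx z, hh.symm x hx z, hh.symm x hx (Γ x v z), hh.symm x hx (Γ x u z),
    hh.symm x hx z, hh.symm x hx z] at h3
  linarith

/-- The classical octahedron argument: the four Bianchi identities, one for each cyclic shift of u,
v, z, w, combine by the two skew symmetries. -/
theorem metric_curv_pair (u v z w : E) :
    h x (curv Γ x u v z) w = h x (curv Γ x z w u) v := by
  have B : ∀ a b c d, h x (curv Γ x a b c) d + h x (curv Γ x b c a) d
      + h x (curv Γ x c a b) d = 0 := by
    intro a b c d
    rw [← add_apply, ← map_add, ← add_apply, ← map_add, curv_bianchi hh hΓ hx]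
    simp
  have K := metric_curv_skew hh hΓ hx
  have S : ∀ a b c d, h x (curv Γ x a b c) d = -h x (curv Γ x b a c) d := by
    intro a b c d
    rw [curv_swap, map_neg, neg_apply]
  have b1 := B u v z w
  have b2 := B v z w u
  have b3 := B z w u v
  have b4 := B w u v z
  rw [K v z w u, S v z u w, K z w v u] at b2
  rw [K w u z v, S w u v z, K u z w v] at b3
  rw [K u v w z, K v w u z, S v w z u] at b4
  have k1 := S z u v w
  have k2 := S u w z v
  have k3 := K v w z u
  have k4 := K u w v z
  have k5 := K z u v w
  have k6 := K z v u w
  have k7 := S z v u w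
  have k8 := K z w v u
  have k9 := K v z u w
  have k10 := K w u v z
  have k11 := S w u v z
  have k12 := S w u z v
  have k13 := K w v z u
  have k14 := S w v z u
  have k15 := S w v u z
  have k16 := K w v u z
  linarith

/-- The second covariant derivatives of a vector field commute up to the curvature. -/
theorem covDerivEnd_covDeriv_sub {V : E → E} (hV : ContDiffOn ℝ ∞ V U) (u w : E) :
    covDerivEnd Γ (covDeriv Γ V) x u w - covDerivEnd Γ (covDeriv Γ V) x w u
      = curv Γ x u w (V x) := by
  have hG := hΓ.differentiableAt hh hx
  have hVd := differentiableAt_of_contDiffOn hh.isOpen hV hx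
  have hDV := differentiableAt_of_contDiffOn hh.isOpen (contDiffOn_fderiv hh.isOpen hV) hx
  have hdiff : DifferentiableAt ℝ (covDeriv Γ V) x := by
    unfold covDeriv
    exact hDV.add (((ContinuousLinearMap.flipₗᵢ ℝ E E E).toContinuousLinearEquiv.differentiableAt.comp
      x hG).clm_apply hVd |>.const_smul (2 : ℝ))
  have key : ∀ u w, fderiv ℝ (covDeriv Γ V) x u w = fderiv ℝ (fderiv ℝ V) x u w
      + (2 : ℝ) • (fderiv ℝ Γ x u w (V x) + Γ x w (fderiv ℝ V x u)) := by
    intro u w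
    have h1 := (hasDerivAt_line hdiff u).clm_apply (hasDerivAt_const (0 : ℝ) w)
    have h2 := ((hasDerivAt_line hDV u).clm_apply (hasDerivAt_const (0 : ℝ) w)).add
      ((((hasDerivAt_line hG u).clm_apply (hasDerivAt_const (0 : ℝ) w)).clm_apply
        (hasDerivAt_line hVd u)).const_smul (2 : ℝ))
    have := h1.unique h2
    simpa using this
  unfold covDerivEnd
  rw [key, key]
  simp only [covDeriv_apply, curv, map_add, map_smul]
  rw [fderiv_fderiv_symm hh.isOpen hV hx u w, hΓ.symm x hx w u,
    hΓ.symm x hx (Γ x u w) (V x)]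
  module

end Curvature

/-! ### Unit Killing fields and constant sectional curvature. -/

section UnitField

variable {E : Type*} [NormedAddCommGroup E] [NormedSpace ℝ E]
variable {U : Set E} {h : E → E →L[ℝ] E →L[ℝ] ℝ} {Γ : E → E →L[ℝ] E →L[ℝ] E} {x : E}
  {V W : E → E}

theorem contDiffOn_covDeriv (hh : IsMetric U h) (hΓ : IsChristoffel U h Γ)
    (hV : ContDiffOn ℝ ∞ V U) : ContDiffOn ℝ ∞ (covDeriv Γ V) U := by
  unfold covDeriv
  exact (contDiffOn_fderiv hh.isOpen hV).add
    ((((ContinuousLinearMap.flipₗᵢ ℝ E E E).toContinuousLinearEquiv.contDiff.comp_contDiffOn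
      hΓ.smooth).clm_apply hV).const_smul (2 : ℝ))

omit [NormedSpace ℝ E] in
/-- A trilinear form with the symmetries of the curvature tensor vanishes if its sectional
curvatures do. -/
theorem curvatureLike_eq_zero {T : E → E → E → E → ℝ}
    (h1 : ∀ u u' v z w, T (u + u') v z w = T u v z w + T u' v z w)
    (hs : ∀ u v z w, T u v z w = -T v u z w) (hp : ∀ u v z w, T u v z w = T z w u v)
    (hb : ∀ u v z w, T u v z w + T v z u w + T z u v w = 0)
    (h0 : ∀ y w, T w y y w = 0) (u v z w : E) : T u v z w = 0 := by
  have h2 : ∀ u v v' z w, T u (v + v') z w = T u v z w + T u v' z w := by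
    intro u v v' z w; rw [hs, h1, hs v, hs v']; ring
  have h3 : ∀ u v z z' w, T u v (z + z') w = T u v z w + T u v z' w := by
    intro u v z z' w; rw [hp, h1, hp z, hp z']
  have h4 : ∀ u v z w w', T u v z (w + w') = T u v z w + T u v z w' := by
    intro u v z w w'; rw [hp, h2, ← hp u, ← hp u]
  -- Polarization in w; the pair symmetry identifies the two mixed terms.
  have a1 : ∀ y w w', T w y y w' = 0 := by
    intro y w w'
    have := h0 y (w + w')
    rw [h1, h4, h4, h0, h0] at this
    have e : T w' y y w = T w y y w' := by
      rw [hp w' y y w, hs y w w' y, hp w y w' y, hs w' y w y, hp y w' w y, hs w y y w']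
      linarith [hs y w y w', hp w y y w', hs y w' w y]
    linarith
  -- Polarization in y. With skewness in all neighbouring slots, the three Bianchi terms become
  -- equal.
  have a2 : ∀ w y z w', T w y z w' = -T w z y w' := by
    intro w y z w'
    have := a1 (y + z) w w'
    rw [h2, h3, h3, a1, a1] at this
    linarith
  have b := hb u v z w
  rw [a2 v z u w, hs v u z w, hs z u v w, a2 u z v w] at b
  linarith

variable (hh : IsMetric U h) (hΓ : IsChristoffel U h Γ)
include hh hΓ

/-- The difference of R and the constant curvature tensor has all curvature symmetries and zero
sectional curvature, so `curvatureLike_eq_zero` applies. -/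
theorem curv_eq_of_const_sectional (hx : x ∈ U) {μ : ℝ}
    (H : ∀ y w, h x (curv Γ x w y y) w = μ * (h x y y * h x w w - h x y w ^ 2)) (u v z : E) :
    curv Γ x u v z = μ • (h x v z • u - h x u z • v) := by
  refine hh.ext hx fun w => ?_
  rw [hh.symm x hx w, hh.symm x hx w]
  have S := hh.symm x hx
  have := curvatureLike_eq_zero (T := fun u v z w => h x (curv Γ x u v z) w
    - μ * (h x v z * h x u w - h x u z * h x v w)) ?_ ?_ ?_ ?_ ?_ u v z w
  · simp only [map_smul, map_sub, sub_apply, smul_apply, smul_eq_mul]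
    linarith
  · intro u u' v z w
    simp only [curv_add_fst, map_add, add_apply]; ring
  · intro u v z w
    rw [curv_swap]; simp only [map_neg, neg_apply]; ring
  · intro u v z w
    simp only [metric_curv_pair hh hΓ hx u v z w, S w u, S v z, S u z, S w v]; ring
  · intro u v z w
    have := congrArg (fun q => h x q w) (curv_bianchi hh hΓ hx u v z)
    simp only [map_add, add_apply, map_zero, zero_apply] at this
    simp only [S z u, S v u, S z v]
    linarith
  · intro y w
    simp only [H, S w y]; ring

/-- The derivative of h(W,W) = 1. -/
theorem metric_covDeriv_unit (hW : ContDiffOn ℝ ∞ W U) (h1 : ∀ x ∈ U, h x (W x) (W x) = 1)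
    (hx : x ∈ U) (u : E) : h x (covDeriv Γ W x u) (W x) = 0 := by
  have hWd := hasDerivAt_line (differentiableAt_of_contDiffOn hh.isOpen hW hx) u
  have hH := hasDerivAt_line (hh.differentiableAt hx) u
  have := hasDerivAt_line_unique (f := fun z => h z (W z) (W z)) (g := fun _ => (1 : ℝ)) hh.isOpen
    hx h1 ((hH.clm_apply hWd).clm_apply hWd) (hasDerivAt_const (0 : ℝ) (1 : ℝ))
  simp only [zero_smul, add_zero, add_apply, hΓ.compat x hx] at this
  rw [covDeriv_apply, map_add, map_smul, add_apply, smul_apply, smul_eq_mul]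
  rw [hh.symm x hx (W x), hh.symm x hx (W x)] at this
  linarith

theorem covDerivEnd_skew {S : E → E →L[ℝ] E} (hS : ContDiffOn ℝ ∞ S U)
    (hK : ∀ x ∈ U, ∀ v w, h x (S x v) w = -h x v (S x w)) (hx : x ∈ U) (u v w : E) :
    h x (covDerivEnd Γ S x u v) w = -h x v (covDerivEnd Γ S x u w) := by
  have hSd := hasDerivAt_line (differentiableAt_of_contDiffOn hh.isOpen hS hx) u
  have hH := hasDerivAt_line (hh.differentiableAt hx) u
  have hc := fun z : E => hasDerivAt_const (0 : ℝ) z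
  have h1 := (hH.clm_apply (hSd.clm_apply (hc v))).clm_apply (hc w)
  have h2 := ((hH.clm_apply (hc v)).clm_apply (hSd.clm_apply (hc w))).neg
  have := hasDerivAt_line_unique (f := fun z => h z (S z v) w)
    (g := fun z => -h z v (S z w)) hh.isOpen hx (fun z hz => hK z hz v w) h1 h2
  simp only [zero_smul, add_zero, add_apply, hΓ.compat x hx, map_zero] at this
  simp only [covDerivEnd, map_add, map_sub, map_smul, add_apply, sub_apply, smul_apply, smul_eq_mul]
  have k1 := hK x hx (Γ x u v) w
  have k2 := hK x hx v (Γ x u w)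
  linarith

/-- The second covariant derivative of a Killing field. -/
theorem covDerivEnd_killing (hW : ContDiffOn ℝ ∞ W U)
    (hK : ∀ x ∈ U, ∀ v w, h x (covDeriv Γ W x v) w = -h x v (covDeriv Γ W x w)) (hx : x ∈ U)
    (u v : E) : covDerivEnd Γ (covDeriv Γ W) x u v = -curv Γ x (W x) u v := by
  refine hh.ext hx fun w => ?_
  rw [hh.symm x hx w, hh.symm x hx w, map_neg, neg_apply]
  have sk := covDerivEnd_skew hh hΓ (contDiffOn_covDeriv hh hΓ hW) hK hx
  have cm : ∀ a b c, h x (covDerivEnd Γ (covDeriv Γ W) x a b) c =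
      h x (covDerivEnd Γ (covDeriv Γ W) x b a) c + h x (curv Γ x a b (W x)) c := by
    intro a b c
    rw [← covDerivEnd_covDeriv_sub hh hΓ hx hW, map_sub, sub_apply]; ring
  have sk' : ∀ a b c, h x (covDerivEnd Γ (covDeriv Γ W) x a b) c =
      -h x (covDerivEnd Γ (covDeriv Γ W) x a c) b := by
    intro a b c
    rw [sk, hh.symm x hx b]
  have P := metric_curv_pair hh hΓ hx
  have K := metric_curv_skew hh hΓ hx
  have e1 := cm u v w
  have e2 := sk' v u w
  have e3 := cm v w u
  have e4 := sk' w v u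
  have e5 := cm w u v
  have e6 := sk' u w v
  have B := congrArg (fun q => h x q u) (curv_bianchi hh hΓ hx (W x) w v)
  simp only [map_add, add_apply, map_zero, zero_apply] at B
  have p1 := P u v (W x) w
  have p2 := P v w (W x) u
  have p3 := P w u (W x) v
  have k1 := K (W x) w u v
  have k2 := K (W x) u v w
  have p4 := P w v (W x) u
  have k3 := K (W x) v w u
  have s1 : h x (curv Γ x v (W x) w) u = -h x (curv Γ x (W x) v w) u := by
    rw [curv_swap, map_neg, neg_apply]
  linarith

/-- Skewness moves S onto the other argument, where |W| = 1 gives zero. In other words, the integral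
curves of a unit Killing field are geodesics. -/
theorem covDeriv_unit_self (hW : ContDiffOn ℝ ∞ W U) (h1 : ∀ x ∈ U, h x (W x) (W x) = 1)
    (hK : ∀ x ∈ U, ∀ v w, h x (covDeriv Γ W x v) w = -h x v (covDeriv Γ W x w)) (hx : x ∈ U) :
    covDeriv Γ W x (W x) = 0 := by
  refine hh.ext hx fun u => ?_
  rw [map_zero, ← neg_neg (h x u _), ← hK x hx, metric_covDeriv_unit hh hΓ hW h1 hx, neg_zero]

/-- Differentiating SW = 0 along u gives S²u = -(∇_u S)W, and the Killing identity
`covDerivEnd_killing` turns the right side into curvature. -/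
theorem covDeriv_covDeriv_unit (hW : ContDiffOn ℝ ∞ W U) (h1 : ∀ x ∈ U, h x (W x) (W x) = 1)
    (hK : ∀ x ∈ U, ∀ v w, h x (covDeriv Γ W x v) w = -h x v (covDeriv Γ W x w)) (hx : x ∈ U)
    (u : E) : covDeriv Γ W x (covDeriv Γ W x u) = curv Γ x (W x) u (W x) := by
  have hS := contDiffOn_covDeriv hh hΓ hW
  have h2 := (hasDerivAt_line (differentiableAt_of_contDiffOn hh.isOpen hS hx) u).clm_apply
    (hasDerivAt_line (differentiableAt_of_contDiffOn hh.isOpen hW hx) u)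
  have := hasDerivAt_line_unique (f := fun z => covDeriv Γ W z (W z)) (g := fun _ => (0 : E))
    hh.isOpen hx (fun z hz => covDeriv_unit_self hh hΓ hW h1 hK hz) h2
    (hasDerivAt_const (0 : ℝ) (0 : E))
  simp only [zero_smul, add_zero] at this
  have e := covDerivEnd_killing hh hΓ hW hK hx u (W x)
  rw [covDerivEnd, covDeriv_unit_self hh hΓ hW h1 hK hx, map_zero] at e
  conv_lhs => rw [covDeriv_apply Γ W x u]
  rw [map_add, map_smul, eq_neg_of_add_eq_zero_right this, ← neg_neg (curv _ _ _ _ _), ← e]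
  module

end UnitField

section Raise

variable {E : Type*} [NormedAddCommGroup E] [NormedSpace ℝ E] [FiniteDimensional ℝ E]
variable {U : Set E} {h : E → E →L[ℝ] E →L[ℝ] ℝ}

/-- Raising an index of a smooth field of bilinear forms. -/
theorem IsMetric.exists_raise (hh : IsMetric U h) {K : E → E →L[ℝ] E →L[ℝ] ℝ}
    (hK : ContDiffOn ℝ ∞ K U) :
    ∃ L : E → E →L[ℝ] E, ContDiffOn ℝ ∞ L U ∧ ∀ x ∈ U, ∀ u v, h x (L x u) v = K x u v := by
  refine ⟨fun x => (ContinuousLinearMap.inverse (h x)).comp (K x), ?_, ?_⟩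
  · intro x hx
    obtain ⟨e, he⟩ := hh.exists_equiv hx
    have h1 : ContDiffAt ℝ ∞ ContinuousLinearMap.inverse (h x) := he ▸ contDiffAt_map_inverse e
    exact (h1.comp_contDiffWithinAt x (hh.smooth x hx)).clm_comp (hK x hx)
  · intro x hx u v
    obtain ⟨e, he⟩ := hh.exists_equiv hx
    change h x (ContinuousLinearMap.inverse (h x) (K x u)) v = _
    rw [← he, ContinuousLinearMap.inverse_equiv]
    simp

end Raise

/-! ### Spray and Riemann curvature of a Riemannian metric. -/

section RiemannianSpray

variable {n : ℕ} {U : Set (Model n)} {h : Model n → Model n →L[ℝ] Model n →L[ℝ] ℝ}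
  {Γ : Model n → Model n →L[ℝ] Model n →L[ℝ] Model n} {x y : Model n}
  {F : Model n → Model n → ℝ}

theorem JointSmooth.of_fst {E : Type*} [NormedAddCommGroup E] [NormedSpace ℝ E]
    {Ω : Set (Model n × Model n)} {f : Model n → E} (hf : ContDiffOn ℝ ∞ f U)
    (hΩ : ∀ q ∈ Ω, q.1 ∈ U) : JointSmooth Ω (fun x _ => f x) :=
  hf.comp contDiffOn_fst hΩ

theorem jointSmooth_snd {Ω : Set (Model n × Model n)} : JointSmooth Ω (fun _ y => y) :=
  contDiffOn_snd

variable (hh : IsMetric U h)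
include hh

theorem IsMetric.jointSmooth_norm {Ω : Set (Model n × Model n)} (hΩ : ∀ q ∈ Ω, q.1 ∈ U) :
    JointSmooth Ω (fun x y => h x y y) :=
  ((JointSmooth.of_fst hh.smooth hΩ).clm_apply jointSmooth_snd).clm_apply jointSmooth_snd

omit hh in
theorem hasDerivAt_const_smooth {E : Type*} [NormedAddCommGroup E] [NormedSpace ℝ E] (c : E) :
    HasDerivAt (fun _ : ℝ => c) 0 0 := hasDerivAt_const 0 c

theorem isOpen_cylinder : IsOpen {q : Model n × Model n | q.1 ∈ U} :=
  hh.isOpen.preimage continuous_fst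

variable (hF : ∀ x ∈ U, ∀ y, energy F x y = h x y y)
include hF

theorem fundForm_riemannian (hx : x ∈ U) (y v w : Model n) : fundForm F x y v w = h x v w := by
  have hs := hh.jointSmooth_norm (Ω := {q | q.1 ∈ U}) fun q hq => hq
  have hq : (x, y) ∈ {q : Model n × Model n | q.1 ∈ U} := hx
  have key : ∀ z, fderiv ℝ (fun η => h x η η) z v = h x v z + h x z v := by
    intro z
    have hq : (x, z) ∈ {q : Model n × Model n | q.1 ∈ U} := hx
    refine fderiv_eq_of_hasDerivAt_line (hs.differentiableAt_snd (isOpen_cylinder hh) hq) ?_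
    have h1 := hasDerivAt_line_id z v
    have := ((hasDerivAt_const_smooth (h x)).clm_apply h1).clm_apply h1
    exact this.congr_deriv (by simp)
  rw [fundForm_eq (isOpen_cylinder hh) hs (fun q hq => hF q.1 hq q.2) hq, funext key]
  have : fderiv ℝ (fun η => h x v η + h x η v) y w = h x v w + h x w v := by
    refine fderiv_eq_of_hasDerivAt_line (by fun_prop) ?_
    have h1 := hasDerivAt_line_id y w
    have := ((hasDerivAt_const_smooth (h x v)).clm_apply h1).add
      (((hasDerivAt_const_smooth (h x)).clm_apply h1).clm_apply (hasDerivAt_const_smooth v))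
    exact this.congr_deriv (by simp)
  rw [this, hh.symm x hx w v]; ring

variable (hΓ : IsChristoffel U h Γ)
include hΓ

/-- Metric compatibility converts the Euler-Lagrange expression of h(y,y) into h(w, Γ(y,y)). The
halved normalization of Γ makes the constant one. -/
theorem spray_riemannian (hx : x ∈ U) (y : Model n) (i : Fin n) :
    spray F i x y = Γ x y y i := by
  have hs := hh.jointSmooth_norm (Ω := {q | q.1 ∈ U}) fun q hq => hq
  have hq : ∀ y, (x, y) ∈ {q : Model n × Model n | q.1 ∈ U} := fun y => hx
  have hU := isOpen_cylinder hh
  have hHd := hh.differentiableAt hx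
  refine spray_eq hU hs (fun q hq => hF q.1 hq q.2) (hq y) ?_ _ ?_ i
  · intro w hw
    rw [fundForm_riemannian hh hF hx]; exact hh.pos x hx w hw
  · intro w
    rw [fundForm_riemannian hh hF hx]
    have key : ∀ z v, fderiv ℝ (fun ξ => h ξ z z) x v = fderiv ℝ h x v z z := by
      intro z v
      refine fderiv_eq_of_hasDerivAt_line (hs.differentiableAt_fst hU (hq z)) ?_
      have := ((hasDerivAt_line hHd v).clm_apply (hasDerivAt_const_smooth z)).clm_apply
        (hasDerivAt_const_smooth z)
      exact this.congr_deriv (by simp)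
    have k2 : fderiv ℝ (fun η => fderiv ℝ h x y η η) y w
        = fderiv ℝ h x y w y + fderiv ℝ h x y y w := by
      refine fderiv_eq_of_hasDerivAt_line (by fun_prop) ?_
      have h1 := hasDerivAt_line_id y w
      have := ((hasDerivAt_const_smooth (fderiv ℝ h x y)).clm_apply h1).clm_apply h1
      exact this.congr_deriv (by simp)
    simp only [key, k2]
    simp only [hΓ.compat x hx]
    rw [hh.symm x hx w, hΓ.symm x hx w y]
    ring

theorem riemannVec_riemannian (hx : x ∈ U) (y w : Model n) :
    riemannVec F x y w = curv Γ x w y y := by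
  have hU := isOpen_cylinder hh
  have hG : JointSmooth {q : Model n × Model n | q.1 ∈ U} (fun x y => Γ x y y) :=
    ((JointSmooth.of_fst hΓ.smooth fun q hq => hq).clm_apply jointSmooth_snd).clm_apply
      jointSmooth_snd
  have hq : ∀ y, (x, y) ∈ {q : Model n × Model n | q.1 ∈ U} := fun y => hx
  have hGd := hΓ.differentiableAt hh hx
  have k1 : fderiv ℝ (fun ξ => Γ ξ y y) x w = fderiv ℝ Γ x w y y := by
    refine fderiv_eq_of_hasDerivAt_line (hG.differentiableAt_fst hU (hq y)) ?_
    have := ((hasDerivAt_line hGd w).clm_apply (hasDerivAt_const_smooth y)).clm_apply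
      (hasDerivAt_const_smooth y)
    exact this.congr_deriv (by simp)
  have k2 : ∀ z η w, fderiv ℝ (fun η => Γ z η η) η w = Γ z w η + Γ z η w := by
    intro z η w
    refine fderiv_eq_of_hasDerivAt_line (by fun_prop) ?_
    have h1 := hasDerivAt_line_id η w
    have := ((hasDerivAt_const_smooth (Γ z)).clm_apply h1).clm_apply h1
    exact this.congr_deriv (by simp)
  have k3 : fderiv ℝ (fun z => Γ z w y + Γ z y w) x y = fderiv ℝ Γ x y w y + fderiv ℝ Γ x y y w := by
    refine fderiv_eq_of_hasDerivAt_line (by fun_prop) ?_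
    have hc := fun z : Model n => hasDerivAt_const_smooth z
    have := (((hasDerivAt_line hGd y).clm_apply (hc w)).clm_apply (hc y)).add
      (((hasDerivAt_line hGd y).clm_apply (hc y)).clm_apply (hc w))
    exact this.congr_deriv (by simp)
  have k4 : ∀ v, fderiv ℝ (fun η => Γ x w η + Γ x η w) y v = Γ x w v + Γ x v w := by
    intro v
    refine fderiv_eq_of_hasDerivAt_line (by fun_prop) ?_
    have h1 := hasDerivAt_line_id y v
    have := ((hasDerivAt_const_smooth (Γ x w)).clm_apply h1).add
      (((hasDerivAt_const_smooth (Γ x)).clm_apply h1).clm_apply (hasDerivAt_const_smooth w))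
    exact this.congr_deriv (by simp)
  rw [riemannVec_eq hU hG (fun q hq i => spray_riemannian hh hF hΓ hq q.2 i) (hq y)]
  simp only [k1, k2, k3, k4, curv, map_add, add_apply]
  rw [hΓ.fderiv_symm hh hx y y w, hΓ.symm x hx w y, hΓ.symm x hx (Γ x y y) w,
    hΓ.symm x hx (Γ x y w) y]
  module

end RiemannianSpray

/-! ### Fundamental tensor and spray of a Kropina metric. -/

section KropinaSpray

variable {n : ℕ} {U : Set (Model n)} {h : Model n → Model n →L[ℝ] Model n →L[ℝ] ℝ}
  {Γ : Model n → Model n →L[ℝ] Model n →L[ℝ] Model n} {W : Model n → Model n} {x y : Model n}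
  {F : Model n → Model n → ℝ}

/-- The directions in which the Kropina metric is defined. -/
def coneBundle (U : Set (Model n)) (h : Model n → Model n →L[ℝ] Model n →L[ℝ] ℝ)
    (W : Model n → Model n) : Set (Model n × Model n) :=
  {q | q.1 ∈ U ∧ 0 < h q.1 (W q.1) q.2}

/-- A unit vector field of a Riemannian metric on an open set. -/
structure IsUnitField (U : Set (Model n)) (h : Model n → Model n →L[ℝ] Model n →L[ℝ] ℝ)
    (W : Model n → Model n) : Prop where
  smooth : ContDiffOn ℝ ∞ W U
  unit : ∀ x ∈ U, h x (W x) (W x) = 1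

variable (hh : IsMetric U h) (hW : IsUnitField U h W)
include hh hW

theorem jointSmooth_form {Ω : Set (Model n × Model n)} (hΩ : ∀ q ∈ Ω, q.1 ∈ U) :
    JointSmooth Ω (fun x y => h x (W x) y) :=
  ((JointSmooth.of_fst hh.smooth hΩ).clm_apply (JointSmooth.of_fst hW.smooth hΩ)).clm_apply
    jointSmooth_snd

theorem isOpen_coneBundle : IsOpen (coneBundle U h W) := by
  have h1 : ContinuousOn (fun q : Model n × Model n => h q.1 (W q.1) q.2) {q | q.1 ∈ U} :=
    (jointSmooth_form hh hW fun q hq => hq).continuousOn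
  exact h1.isOpen_inter_preimage (isOpen_cylinder hh) isOpen_Ioi

omit hW in
theorem pos_of_mem_cone (hq : (x, y) ∈ coneBundle U h W) : 0 < h x y y := by
  refine hh.pos x hq.1 y ?_
  rintro rfl
  have := hq.2
  simp at this

theorem jointSmooth_kropina :
    JointSmooth (coneBundle U h W) (fun x y => (h x y y) ^ 2 / (h x (W x) y) ^ 2) :=
  ((hh.jointSmooth_norm fun _ hq => hq.1).pow 2).div
    ((jointSmooth_form hh hW fun _ hq => hq.1).pow 2) fun _ hq => (pow_pos hq.2 2).ne'

omit hh hW in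
/-- The derivatives in the direction variable of the building blocks of the Kropina metric. -/
theorem hasDerivAt_norm_snd (H : Model n →L[ℝ] Model n →L[ℝ] ℝ) (y w : Model n) :
    HasDerivAt (fun t : ℝ => H (y + t • w) (y + t • w)) (H w y + H y w) 0 := by
  have h1 := hasDerivAt_line_id y w
  have := ((hasDerivAt_const_smooth H).clm_apply h1).clm_apply h1
  exact this.congr_deriv (by simp)

omit hh hW in
theorem hasDerivAt_clm_snd {E : Type*} [NormedAddCommGroup E] [NormedSpace ℝ E]
    (L : Model n →L[ℝ] E) (y w : Model n) :
    HasDerivAt (fun t : ℝ => L (y + t • w)) (L w) 0 :=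
  (L.hasFDerivAt.comp_hasDerivAt 0 (hasDerivAt_line_id y w))

variable (hF : ∀ q ∈ coneBundle U h W, energy F q.1 q.2 = (h q.1 q.2 q.2) ^ 2 / (h q.1 (W q.1) q.2) ^ 2)

theorem fderiv_kropina_snd (hq : (x, y) ∈ coneBundle U h W) (v : Model n) :
    fderiv ℝ (fun η => (h x η η) ^ 2 / (h x (W x) η) ^ 2) y v =
      4 * h x y y * h x v y / (h x (W x) y) ^ 2
        - 2 * (h x y y) ^ 2 * h x (W x) v / (h x (W x) y) ^ 3 := by
  refine fderiv_eq_of_hasDerivAt_line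
    ((jointSmooth_kropina hh hW).differentiableAt_snd (isOpen_coneBundle hh hW) hq) ?_
  have hB : h x (W x) y ≠ 0 := hq.2.ne'
  refine (((hasDerivAt_norm_snd (h x) y v).fun_pow 2).fun_div
    ((hasDerivAt_clm_snd (h x (W x)) y v).fun_pow 2) (by simpa using hB)).congr_deriv ?_
  simp only [zero_smul, add_zero]
  rw [hh.symm x hq.1 y v]
  push_cast
  field_simp
  ring

/-- The fundamental tensor of a Kropina metric. -/
def kropinaTensor (A B yv yw bv bw vw : ℝ) : ℝ :=
  4 * yv * yw / B ^ 2 + 2 * A * vw / B ^ 2 - 4 * A * yw * bv / B ^ 3 - 4 * A * yv * bw / B ^ 3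
    + 3 * A ^ 2 * bv * bw / B ^ 4

include hF in
theorem fundForm_kropina (hq : (x, y) ∈ coneBundle U h W) (v w : Model n) :
    fundForm F x y v w = kropinaTensor (h x y y) (h x (W x) y) (h x v y) (h x w y)
      (h x (W x) v) (h x (W x) w) (h x v w) := by
  have hΩ := isOpen_coneBundle hh hW
  have hs := jointSmooth_kropina hh hW
  rw [fundForm_eq hΩ hs hF hq, fderiv_snd_congr (G := fun x y => fderiv ℝ (fun η =>
    (h x η η) ^ 2 / (h x (W x) η) ^ 2) y v) (G' := fun x y => 4 * h x y y * h x v y / (h x (W x) y) ^ 2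
        - 2 * (h x y y) ^ 2 * h x (W x) v / (h x (W x) y) ^ 3) hΩ hq (fun q hq => fderiv_kropina_snd hh hW hq v)]
  have hB : h x (W x) y ≠ 0 := hq.2.ne'
  have hd := (hs.partial_snd hΩ v).differentiableAt_snd hΩ hq
  have hd' := hd.congr_of_eventuallyEq ((slice_snd_mem_nhds hΩ hq).mono fun z hz =>
    (fderiv_kropina_snd hh hW hz v).symm)
  rw [fderiv_eq_of_hasDerivAt_line hd' (((((hasDerivAt_norm_snd (h x) y w).const_mul 4).fun_mul
    (hasDerivAt_clm_snd (h x v) y w)).fun_div ((hasDerivAt_clm_snd (h x (W x)) y w).fun_pow 2)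
      (by simpa using hB)).fun_sub (((((hasDerivAt_norm_snd (h x) y w).fun_pow 2).const_mul
        2).mul_const (h x (W x) v)).fun_div ((hasDerivAt_clm_snd (h x (W x)) y w).fun_pow 3)
      (by simpa using hB)))]
  simp only [zero_smul, add_zero, kropinaTensor]
  rw [hh.symm x hq.1 y w]
  push_cast
  field_simp
  ring

include hF in
-- With A = h(y,y) and B = h(W,y), completing the square writes g_y(w,w) as a square plus 2A/B⁴
-- times the squared length of Bw - h(W,w)y. If that vector vanishes, w is a multiple of y and the
-- square is positive.
theorem fundForm_kropina_pos (hq : (x, y) ∈ coneBundle U h W) {w : Model n} (hw : w ≠ 0) :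
    0 < fundForm F x y w w := by
  rw [fundForm_kropina hh hW hF hq]
  have hB := hq.2
  have hA := pos_of_mem_cone hh hq
  simp only at hB
  set A := h x y y
  set B := h x (W x) y
  have e : h x (B • w - h x (W x) w • y) (B • w - h x (W x) w • y) =
      B ^ 2 * h x w w - 2 * B * h x (W x) w * h x w y + (h x (W x) w) ^ 2 * A := by
    simp only [map_sub, map_smul, sub_apply, smul_apply, smul_eq_mul]
    rw [hh.symm x hq.1 y w]; ring
  have e2 : kropinaTensor A B (h x w y) (h x w y) (h x (W x) w) (h x (W x) w) (h x w w) =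
      (2 * h x w y / B - A * h x (W x) w / B ^ 2) ^ 2 + 2 * A / B ^ 4 *
        h x (B • w - h x (W x) w • y) (B • w - h x (W x) w • y) := by
    rw [e, kropinaTensor]; field_simp; ring
  rw [e2]
  by_cases h0 : B • w - h x (W x) w • y = 0
  · have hw' : w = (h x (W x) w / B) • y := by
      rw [sub_eq_zero] at h0
      rw [div_eq_inv_mul, mul_smul, ← h0, smul_smul, inv_mul_cancel₀ hB.ne', one_smul]
    have hne : h x (W x) w ≠ 0 := by
      intro h1
      rw [h1] at hw'
      simp at hw'
      exact hw hw'
    have e3 : h x w y = h x (W x) w / B * A := by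
      conv_lhs => rw [hw']
      simp [A]
    rw [h0, e3]
    have : 2 * (h x (W x) w / B * A) / B - A * h x (W x) w / B ^ 2 = A * h x (W x) w / B ^ 2 := by
      field_simp; ring
    rw [this]
    have : A * h x (W x) w / B ^ 2 ≠ 0 := by positivity
    simp
    positivity
  · have := hh.pos x hq.1 _ h0
    positivity

omit hh hW in
theorem hasDerivAt_norm_fst (hd : DifferentiableAt ℝ h x) (v η : Model n) :
    HasDerivAt (fun t : ℝ => h (x + t • v) η η) (fderiv ℝ h x v η η) 0 :=
  (((hasDerivAt_line hd v).clm_apply (hasDerivAt_const_smooth η)).clm_apply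
    (hasDerivAt_const_smooth η)).congr_deriv (by simp)

theorem hasDerivAt_form_fst (hΓ : IsChristoffel U h Γ) (hx : x ∈ U) (v η : Model n) :
    HasDerivAt (fun t : ℝ => h (x + t • v) (W (x + t • v)) η)
      (h x (covDeriv Γ W x v) η + 2 * h x (W x) (Γ x v η)) 0 := by
  have hWd := hasDerivAt_line (differentiableAt_of_contDiffOn hh.isOpen hW.smooth hx) v
  refine (((hasDerivAt_line (hh.differentiableAt hx) v).clm_apply hWd).clm_apply
    (hasDerivAt_const_smooth η)).congr_deriv ?_
  simp only [zero_smul, add_zero, map_zero, add_apply, hΓ.compat x hx, covDeriv_apply, map_add,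
    map_smul, smul_apply, smul_eq_mul]
  ring

theorem fderiv_kropina_fst (hΓ : IsChristoffel U h Γ) (hq : (x, y) ∈ coneBundle U h W)
    (v : Model n) :
    fderiv ℝ (fun ξ => (h ξ y y) ^ 2 / (h ξ (W ξ) y) ^ 2) x v =
      8 * h x y y * h x y (Γ x v y) / (h x (W x) y) ^ 2
        - 2 * (h x y y) ^ 2 * (h x (covDeriv Γ W x v) y + 2 * h x (W x) (Γ x v y))
          / (h x (W x) y) ^ 3 := by
  refine fderiv_eq_of_hasDerivAt_line
    ((jointSmooth_kropina hh hW).differentiableAt_fst (isOpen_coneBundle hh hW) hq) ?_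
  have hB : h x (W x) y ≠ 0 := hq.2.ne'
  refine (((hasDerivAt_norm_fst (hh.differentiableAt hq.1) v y).fun_pow 2).fun_div
    ((hasDerivAt_form_fst hh hW hΓ hq.1 v y).fun_pow 2) (by simpa using hB)).congr_deriv ?_
  simp only [zero_smul, add_zero, hΓ.compat x hq.1]
  rw [hh.symm x hq.1 (Γ x v y) y]
  push_cast
  field_simp
  ring

/-- The spray of a Kropina metric; `Z` is the skew-symmetric part of `∇W`. -/
def kropinaSpray (h : Model n → Model n →L[ℝ] Model n →L[ℝ] ℝ)
    (Γ : Model n → Model n →L[ℝ] Model n →L[ℝ] Model n) (W : Model n → Model n)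
    (Z : Model n → Model n →L[ℝ] Model n) (x y : Model n) : Model n :=
  Γ x y y - (h x y y / (2 * h x (W x) y)) • Z x y
    + ((1 / 2) * (h x y y / h x (W x) y * h x (Z x y) (W x) + h x (covDeriv Γ W x y) y)) • W x
    - (h x (Z x y) (W x) + h x (W x) y / h x y y * h x (covDeriv Γ W x y) y) • y

theorem fderiv_snd_fderiv_fst_kropina (hΓ : IsChristoffel U h Γ)
    (hq : (x, y) ∈ coneBundle U h W) (v w : Model n) :
    fderiv ℝ (fun η => fderiv ℝ (fun ξ => (h ξ η η) ^ 2 / (h ξ (W ξ) η) ^ 2) x v) y w =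
      (16 * h x y w * h x y (Γ x v y) + 8 * h x y y * (h x w (Γ x v y) + h x y (Γ x v w)))
          / (h x (W x) y) ^ 2
        - 16 * h x y y * h x y (Γ x v y) * h x (W x) w / (h x (W x) y) ^ 3
        - (8 * h x y y * h x y w * (h x (covDeriv Γ W x v) y + 2 * h x (W x) (Γ x v y))
            + 2 * (h x y y) ^ 2 * (h x (covDeriv Γ W x v) w + 2 * h x (W x) (Γ x v w)))
          / (h x (W x) y) ^ 3
        + 6 * (h x y y) ^ 2 * (h x (covDeriv Γ W x v) y + 2 * h x (W x) (Γ x v y)) * h x (W x) w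
          / (h x (W x) y) ^ 4 := by
  have hΩ := isOpen_coneBundle hh hW
  have hs := jointSmooth_kropina hh hW
  have hB : h x (W x) y ≠ 0 := hq.2.ne'
  have hB0 : h x (W x) (y + (0 : ℝ) • w) ≠ 0 := by simpa using hB
  have hd := (hs.partial_fst hΩ v).differentiableAt_snd hΩ hq
  have hd' := hd.congr_of_eventuallyEq ((slice_snd_mem_nhds hΩ hq).mono fun z hz =>
    (fderiv_kropina_fst hh hW hΓ hz v).symm)
  rw [fderiv_snd_congr (G := fun x η => fderiv ℝ (fun ξ =>
    (h ξ η η) ^ 2 / (h ξ (W ξ) η) ^ 2) x v)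
    (G' := fun x y => 8 * h x y y * h x y (Γ x v y) / (h x (W x) y) ^ 2
        - 2 * (h x y y) ^ 2 * (h x (covDeriv Γ W x v) y + 2 * h x (W x) (Γ x v y))
          / (h x (W x) y) ^ 3) hΩ hq
    (fun q hq => fderiv_kropina_fst hh hW hΓ hq v)]
  have dA := hasDerivAt_norm_snd (h x) y w
  have dB := hasDerivAt_clm_snd (h x (W x)) y w
  have dΓ := hasDerivAt_clm_snd (Γ x v) y w
  have dy := hasDerivAt_line_id y w
  have d1 := ((hasDerivAt_const_smooth (h x)).clm_apply dy).clm_apply dΓ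
  have d2 := hasDerivAt_clm_snd (h x (covDeriv Γ W x v)) y w
  have d3 := (hasDerivAt_const_smooth (h x (W x))).clm_apply dΓ
  refine fderiv_eq_of_hasDerivAt_line hd' ((((((dA.const_mul 8).fun_mul d1).fun_div (dB.fun_pow 2)
    (by simpa using hB)).fun_sub ((((dA.fun_pow 2).const_mul 2).fun_mul
      (d2.fun_add (d3.const_mul 2))).fun_div (dB.fun_pow 3) (by simpa using hB)))).congr_deriv ?_)
  simp only [zero_smul, add_zero, zero_apply, zero_add]
  rw [hh.symm x hq.1 w y]
  push_cast
  field_simp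
  ring

include hF in
-- The candidate is checked against the Euler-Lagrange relation, which determines the spray because
-- g_y is positive definite. Splitting ∇W into the skew part Z and r₀₀ isolates the only term with a
-- pole along h(y,y) = 0.
theorem spray_kropina (hΓ : IsChristoffel U h Γ) {Z : Model n → Model n →L[ℝ] Model n}
    (hZ : ∀ x ∈ U, ∀ u v, h x (Z x u) v =
      (1 / 2) * (h x (covDeriv Γ W x u) v - h x (covDeriv Γ W x v) u))
    (hq : (x, y) ∈ coneBundle U h W) (i : Fin n) :
    spray F i x y = kropinaSpray h Γ W Z x y i := by
  have hx := hq.1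
  have hB : h x (W x) y ≠ 0 := hq.2.ne'
  have hA : h x y y ≠ 0 := (pos_of_mem_cone hh hq).ne'
  refine spray_eq (isOpen_coneBundle hh hW) (jointSmooth_kropina hh hW) hF hq
    (fun w hw => fundForm_kropina_pos hh hW hF hq hw) _ ?_ i
  intro w
  rw [fderiv_snd_fderiv_fst_kropina hh hW hΓ hq, fderiv_kropina_fst hh hW hΓ hq,
    fundForm_kropina hh hW hF hq]
  have hu := hW.unit x hx
  have z1 := hZ x hx y w
  have z2 : h x (Z x y) y = 0 := by rw [hZ x hx]; ring
  have sy := hh.symm x hx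
  have s1 : h x w (Z x y) = 1 / 2 * (h x (covDeriv Γ W x y) w - h x (covDeriv Γ W x w) y) := by
    rw [sy, z1]
  simp only [kropinaSpray, map_add, map_sub, map_smul, add_apply, sub_apply, smul_apply,
    smul_eq_mul, hu, z2, s1, hΓ.symm x hx w y, kropinaTensor, sy (W x) (Z x y), sy w (W x),
    sy w y, sy (Γ x y y) y]
  field_simp
  ring

end KropinaSpray

/-! ### Ricci curvature of a spray with a pole in its multiple of y. -/

section RicciProjective

variable {n : ℕ}

/-- This is the trace of the square of the y-derivative of a spray H + Py, where D is the derivative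
of H and p that of P. Euler's relations, with H of degree two and P of degree one, evaluate the
cross terms. -/
theorem sum_sum_mul_transpose (D : Fin n → Fin n → ℝ) (p y H : Fin n → ℝ) (P : ℝ)
    (hH : ∀ k, ∑ j, y j * D j k = 2 * H k) (hP : ∑ j, y j * p j = P) :
    ∑ k, ∑ j, (D j k + p j * y k + if k = j then P else 0)
        * (D k j + p k * y j + if j = k then P else 0) =
      ∑ k, ∑ j, D j k * D k j + 4 * ∑ j, H j * p j + 2 * P * ∑ k, D k k + (n + 3) * P ^ 2 := by
  have e : ∀ k j, (D j k + p j * y k + if k = j then P else 0)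
        * (D k j + p k * y j + if j = k then P else 0) = D j k * D k j
        + (p k * (y j * D j k) + p j * (y k * D k j)) + (p j * y j) * (p k * y k)
        + (if k = j then 2 * P * D k k + 2 * P * (y k * p k) + P ^ 2 else 0) := by
    intro k j
    by_cases h : k = j
    · subst h; simp; ring
    · simp [h, Ne.symm h]; ring
  have hP' : ∑ j, p j * y j = P := by rw [← hP]; exact Finset.sum_congr rfl fun j _ => mul_comm _ _
  simp only [e, Finset.sum_add_distrib, Finset.sum_ite_eq, Finset.mem_univ, if_true]
  have a1 : ∑ k, ∑ j, p k * (y j * D j k) = 2 * ∑ j, H j * p j := by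
    rw [Finset.mul_sum]
    refine Finset.sum_congr rfl fun k _ => ?_
    rw [← Finset.mul_sum, hH]; ring
  have a2 : ∑ k, ∑ j, p j * (y k * D k j) = 2 * ∑ j, H j * p j := by
    rw [Finset.sum_comm, a1]
  have a3 : ∑ k, ∑ j, (p j * y j) * (p k * y k) = P ^ 2 := by
    simp only [← Finset.sum_mul, ← Finset.mul_sum, hP']; ring
  rw [a1, a2, a3, ← Finset.mul_sum, ← Finset.mul_sum, hP]
  simp
  ring

variable {Ω : Set (Model n × Model n)} {F q A : Model n → Model n → ℝ}
  {H : Fin n → Model n → Model n → ℝ} {x y : Model n}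

theorem dX_congr {f g : Model n → Model n → ℝ} (hΩ : IsOpen Ω)
    (h : ∀ p ∈ Ω, f p.1 p.2 = g p.1 p.2) (i : Fin n) {p : Model n × Model n} (hp : p ∈ Ω) :
    dX i f p.1 p.2 = dX i g p.1 p.2 := by
  unfold dX; rw [fderiv_fst_congr hΩ hp h]

theorem dY_congr {f g : Model n → Model n → ℝ} (hΩ : IsOpen Ω)
    (h : ∀ p ∈ Ω, f p.1 p.2 = g p.1 p.2) (i : Fin n) {p : Model n × Model n} (hp : p ∈ Ω) :
    dY i f p.1 p.2 = dY i g p.1 p.2 := by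
  unfold dY; exact congrArg (fun L => L (EuclideanSpace.single i 1)) (fderiv_snd_congr (G := f) (G' := g) hΩ hp h)

theorem JointSmooth.dY {f : Model n → Model n → ℝ} (hf : JointSmooth Ω f) (hΩ : IsOpen Ω)
    (i : Fin n) : JointSmooth Ω (dY i f) := hf.partial_snd hΩ _

theorem dX_sum {ι : Type*} [Fintype ι] {f : ι → Model n → Model n → ℝ} (hΩ : IsOpen Ω)
    (hf : ∀ k, JointSmooth Ω (f k)) (i : Fin n) (hp : (x, y) ∈ Ω) :
    dX i (fun x y => ∑ k, f k x y) x y = ∑ k, dX i (f k) x y := by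
  unfold dX
  have := fderiv_sum_smul (f := fun k z => f k z y)
    (fun k => (hf k).differentiableAt_fst hΩ hp) (fun _ => 1) (EuclideanSpace.single i 1)
  simpa using this

theorem dY_sum {ι : Type*} [Fintype ι] {f : ι → Model n → Model n → ℝ} (hΩ : IsOpen Ω)
    (hf : ∀ k, JointSmooth Ω (f k)) (i : Fin n) (hp : (x, y) ∈ Ω) :
    dY i (fun x y => ∑ k, f k x y) x y = ∑ k, dY i (f k) x y := by
  unfold dY
  have := fderiv_sum_smul (f := fun k z => f k x z)
    (fun k => (hf k).differentiableAt_snd hΩ hp) (fun _ => 1) (EuclideanSpace.single i 1)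
  simpa using this

theorem dX_add_mul_div (hΩ : IsOpen Ω) {f : Model n → Model n → ℝ} {g : Model n → ℝ}
    (hf : JointSmooth Ω f) (hq : JointSmooth Ω q) (hA : JointSmooth Ω A)
    (hA0 : ∀ p ∈ Ω, A p.1 p.2 ≠ 0) (i : Fin n) (hp : (x, y) ∈ Ω) :
    dX i (fun x y => f x y + q x y / A x y * g y) x y = dX i f x y
      + (dX i q x y / A x y - q x y * dX i A x y / A x y ^ 2) * g y := by
  have df := hasDerivAt_line (hf.differentiableAt_fst hΩ hp) (EuclideanSpace.single i 1)
  have dq := hasDerivAt_line (hq.differentiableAt_fst hΩ hp) (EuclideanSpace.single i 1)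
  have dA := hasDerivAt_line (hA.differentiableAt_fst hΩ hp) (EuclideanSpace.single i 1)
  have h0 : A x y ≠ 0 := hA0 _ hp
  refine fderiv_eq_of_hasDerivAt_line ?_ ((df.fun_add ((dq.fun_div dA (by simpa using h0)).mul_const
    (g y))).congr_deriv ?_)
  · have hqA : JointSmooth Ω (fun x y => q x y / A x y) := hq.div hA hA0
    exact (hf.differentiableAt_fst hΩ hp).add ((hqA.differentiableAt_fst hΩ hp).mul_const _)
  · simp only [zero_smul, add_zero, dX]
    field_simp

theorem dY_add_mul_div (hΩ : IsOpen Ω) {f : Model n → Model n → ℝ} {g : Model n → ℝ}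
    (hf : JointSmooth Ω f) (hq : JointSmooth Ω q) (hA : JointSmooth Ω A)
    (hg : DifferentiableAt ℝ g y)
    (hA0 : ∀ p ∈ Ω, A p.1 p.2 ≠ 0) (i : Fin n) (hp : (x, y) ∈ Ω) :
    dY i (fun x y => f x y + q x y / A x y * g y) x y = dY i f x y
      + (dY i q x y / A x y - q x y * dY i A x y / A x y ^ 2) * g y
      + q x y / A x y * fderiv ℝ g y (EuclideanSpace.single i 1) := by
  have df := hasDerivAt_line (hf.differentiableAt_snd hΩ hp) (EuclideanSpace.single i 1)
  have dq := hasDerivAt_line (hq.differentiableAt_snd hΩ hp) (EuclideanSpace.single i 1)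
  have dA := hasDerivAt_line (hA.differentiableAt_snd hΩ hp) (EuclideanSpace.single i 1)
  have dg := hasDerivAt_line hg (EuclideanSpace.single i 1)
  have h0 : A x y ≠ 0 := hA0 _ hp
  refine fderiv_eq_of_hasDerivAt_line ?_ ((df.fun_add ((dq.fun_div dA (by simpa using h0)).fun_mul
    dg)).congr_deriv ?_)
  · have hqA : JointSmooth Ω (fun x y => q x y / A x y) := hq.div hA hA0
    exact (hf.differentiableAt_snd hΩ hp).add ((hqA.differentiableAt_snd hΩ hp).mul hg)
  · simp only [zero_smul, add_zero, dY]
    field_simp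
    ring

/-- The Ricci curvature sorted by powers of 1/A. In the application t1 is the trace of (∂H/∂y)² and
t2 the x-divergence of H; t3, t4 are the derivatives of q, A in x along y, and t5, t6 their
derivatives in y along H. The remaining letters come from the y-divergence of H: t10 is its value,
t7 and t8 its y-derivatives along H and y, and t9 its x-derivative along y. -/
theorem sq_mul_ricci_algebra {A : ℝ} (h0 : A ≠ 0) (n q t1 t2 t3 t4 t5 t6 t7 t8 t9 t10 : ℝ) :
    A ^ 2 * (2 * (t2 + (t3 / A - q / A ^ 2 * t4)) - (t9 + (n + 1) * (t3 / A - q / A ^ 2 * t4))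
      + 2 * (t7 + q / A * t8 + (n + 1) * (t5 / A - q / A ^ 2 * t6) + (n + 1) * (q / A) * (q / A))
      - (t1 + 4 * (t5 / A - q / A ^ 2 * t6) + 2 * (q / A) * t10 + (n + 3) * (q / A) ^ 2)) =
    (n - 1) * (q * t4 - 2 * q * t6 + q ^ 2) + A * (A * (2 * t2 - t9 + 2 * t7 - t1) + 2 * q * t8
      - 2 * q * t10 + (1 - n) * t3 + (2 * n - 2) * t5) := by
  field_simp
  ring

/-- The divergence `∂H^k/∂y^k`. -/
def dirDiv (H : Fin n → Model n → Model n → ℝ) (x y : Model n) : ℝ := ∑ k, dY k (H k) x y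

/-- The part of lower pole order in the Ricci curvature of a spray `H + (q / A) y`. -/
def ricciRest (A q : Model n → Model n → ℝ) (H : Fin n → Model n → Model n → ℝ)
    (x y : Model n) : ℝ :=
  A x y * (2 * ∑ k, dX k (H k) x y - ∑ j, y j * dX j (dirDiv H) x y
      + 2 * ∑ j, H j x y * dY j (dirDiv H) x y - ∑ k, ∑ j, dY j (H k) x y * dY k (H j) x y)
    + 2 * q x y * ∑ j, y j * dY j (dirDiv H) x y - 2 * q x y * dirDiv H x y
    + (1 - n) * ∑ j, y j * dX j q x y + (2 * n - 2) * ∑ j, H j x y * dY j q x y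

/-- The Ricci curvature of a spray `H + (q / A) y`, by order of the pole along `A = 0`. -/
theorem sq_mul_ricci (hΩ : IsOpen Ω) (hH : ∀ i, JointSmooth Ω (H i)) (hq : JointSmooth Ω q)
    (hA : JointSmooth Ω A) (hA0 : ∀ p ∈ Ω, A p.1 p.2 ≠ 0)
    (hs : ∀ p ∈ Ω, ∀ i, spray F i p.1 p.2 = H i p.1 p.2 + q p.1 p.2 / A p.1 p.2 * p.2 i)
    (eH : ∀ p ∈ Ω, ∀ k, ∑ j, p.2 j * dY j (H k) p.1 p.2 = 2 * H k p.1 p.2)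
    (eq : ∀ p ∈ Ω, ∑ j, p.2 j * dY j q p.1 p.2 = 3 * q p.1 p.2)
    (eA : ∀ p ∈ Ω, ∑ j, p.2 j * dY j A p.1 p.2 = 2 * A p.1 p.2)
    (hp : (x, y) ∈ Ω) :
    A x y ^ 2 * ricci F x y = (n - 1) * (q x y * ∑ j, y j * dX j A x y
      - 2 * q x y * ∑ j, H j x y * dY j A x y + q x y ^ 2) + A x y * ricciRest A q H x y := by
  have h0 : A x y ≠ 0 := hA0 _ hp
  have hc : ∀ (i : Fin n) y, DifferentiableAt ℝ (fun y : Model n => y i) y := fun i y => by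
    fun_prop
  have hci : ∀ (i k : Fin n) (y : Model n), fderiv ℝ (fun y : Model n => y i) y
      (EuclideanSpace.single k 1) = if i = k then 1 else 0 := by
    intro i k y
    rw [fderiv_coord (f := fun y : Model n => y) differentiableAt_id]
    simp
  have hDY : ∀ k i, ∀ p ∈ Ω, dY k (spray F i) p.1 p.2 = dY k (H i) p.1 p.2
      + (dY k q p.1 p.2 / A p.1 p.2 - q p.1 p.2 * dY k A p.1 p.2 / A p.1 p.2 ^ 2) * p.2 i
      + if i = k then q p.1 p.2 / A p.1 p.2 else 0 := by
    intro k i p hp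
    rw [dY_congr hΩ (g := fun x y => H i x y + q x y / A x y * y i) (fun p hp => hs p hp i) k hp,
      dY_add_mul_div hΩ (hH i) hq hA (hc i _) hA0 k hp, hci]
    simp
  have hsS : ∀ i, JointSmooth Ω (spray F i) := fun i =>
    ContDiffOn.congr ((hH i).add ((hq.div hA hA0).mul (jointSmooth_snd.coord i)))
      fun p hp => hs p hp i
  -- The factor q/A has degree 3 - 2 = 1, so this is again Euler's relation.
  have eP : ∀ p ∈ Ω, ∑ j, p.2 j * (dY j q p.1 p.2 / A p.1 p.2
      - q p.1 p.2 * dY j A p.1 p.2 / A p.1 p.2 ^ 2) = q p.1 p.2 / A p.1 p.2 := by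
    intro p hp
    have h0 := hA0 p hp
    have : ∀ j, p.2 j * (dY j q p.1 p.2 / A p.1 p.2 - q p.1 p.2 * dY j A p.1 p.2 / A p.1 p.2 ^ 2)
        = (p.2 j * dY j q p.1 p.2) / A p.1 p.2
          - q p.1 p.2 / A p.1 p.2 ^ 2 * (p.2 j * dY j A p.1 p.2) := by
      intro j; field_simp
    simp only [this, Finset.sum_sub_distrib, ← Finset.mul_sum, ← Finset.sum_div, eq p hp, eA p hp]
    field_simp; ring
  -- The y-divergence of Py is (n + 1)P for P of degree one.
  have hN : ∀ p ∈ Ω, ∑ k, dY k (spray F k) p.1 p.2 =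
      dirDiv H p.1 p.2 + q p.1 p.2 / A p.1 p.2 * (n + 1) := by
    intro p hp
    simp only [fun k => hDY k k p hp, Finset.sum_add_distrib, if_true]
    have := eP p hp
    simp only [mul_comm (p.2 _)] at this
    rw [this, dirDiv]
    simp; ring
  have hdiv : JointSmooth Ω (dirDiv H) :=
    ContDiffOn.sum fun k _ => (hH k).dY hΩ k
  have hXN : ∀ j, ∑ k, dX j (dY k (spray F k)) x y = dX j (dirDiv H) x y
      + (dX j q x y / A x y - q x y * dX j A x y / A x y ^ 2) * (n + 1) := by
    intro j
    rw [← dX_sum hΩ (fun k => (hsS k).dY hΩ k) j hp, dX_congr hΩ (g := fun x y => dirDiv H x y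
      + q x y / A x y * ((fun _ : Model n => (n + 1 : ℝ)) y)) hN j hp,
      dX_add_mul_div hΩ hdiv hq hA hA0 j hp]
  have hYN : ∀ j, ∑ k, dY j (dY k (spray F k)) x y = dY j (dirDiv H) x y
      + (dY j q x y / A x y - q x y * dY j A x y / A x y ^ 2) * (n + 1) := by
    intro j
    rw [← dY_sum hΩ (fun k => (hsS k).dY hΩ k) j hp, dY_congr hΩ (g := fun x y => dirDiv H x y
      + q x y / A x y * ((fun _ : Model n => (n + 1 : ℝ)) y)) hN j hp,
      dY_add_mul_div hΩ hdiv hq hA (differentiableAt_const _) hA0 j hp]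
    simp
  have hX : ∀ k, dX k (spray F k) x y = dX k (H k) x y
      + (dX k q x y / A x y - q x y * dX k A x y / A x y ^ 2) * y k := by
    intro k
    rw [dX_congr hΩ (g := fun x y => H k x y + q x y / A x y * ((fun y : Model n => y k) y))
      (fun p hp => hs p hp k) k hp, dX_add_mul_div hΩ (hH k) hq hA hA0 k hp]
  have hric : ricci F x y = 2 * ∑ k, dX k (spray F k) x y
      - ∑ j, y j * ∑ k, dX j (dY k (spray F k)) x y
      + 2 * ∑ j, spray F j x y * ∑ k, dY j (dY k (spray F k)) x y
      - ∑ k, ∑ j, dY j (spray F k) x y * dY k (spray F j) x y := by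
    simp only [ricci, riemann, Finset.sum_add_distrib, Finset.sum_sub_distrib, ← Finset.mul_sum]
    simp only [Finset.mul_sum]
    rw [Finset.sum_comm (f := fun k j => y j * dX j (dY k (spray F k)) x y),
      Finset.sum_comm (f := fun k j => 2 * (spray F j x y * dY j (dY k (spray F k)) x y))]
  have s4 := sum_sum_mul_transpose (fun j k => dY j (H k) x y)
    (fun j => dY j q x y / A x y - q x y * dY j A x y / A x y ^ 2) (fun j => y j)
    (fun j => H j x y) (q x y / A x y) (fun k => eH _ hp k) (eP _ hp)
  have s4' : ∑ k, ∑ j, dY j (spray F k) x y * dY k (spray F j) x y =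
      ∑ k, ∑ j, dY j (H k) x y * dY k (H j) x y +
          4 * ∑ j, H j x y * (dY j q x y / A x y - q x y * dY j A x y / A x y ^ 2) +
        2 * (q x y / A x y) * ∑ k, dY k (H k) x y + (n + 3) * (q x y / A x y) ^ 2 := by
    refine Eq.trans (Finset.sum_congr rfl fun k _ => Finset.sum_congr rfl fun j _ => ?_) s4
    rw [hDY j k _ hp, hDY k j _ hp]
  have expand : ∀ (c a b : Fin n → ℝ), ∑ j, c j * (a j / A x y - q x y * b j / A x y ^ 2) =
      (∑ j, c j * a j) / A x y - q x y / A x y ^ 2 * ∑ j, c j * b j := by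
    intro c a b
    rw [Finset.sum_div, Finset.mul_sum, ← Finset.sum_sub_distrib]
    exact Finset.sum_congr rfl fun j _ => by field_simp
  have s1 : ∑ k, dX k (spray F k) x y = ∑ k, dX k (H k) x y
      + ∑ k, y k * (dX k q x y / A x y - q x y * dX k A x y / A x y ^ 2) := by
    simp only [hX, Finset.sum_add_distrib, mul_comm]
  have s2 : ∑ j, y j * ∑ k, dX j (dY k (spray F k)) x y = ∑ j, y j * dX j (dirDiv H) x y
      + (n + 1) * ∑ k, y k * (dX k q x y / A x y - q x y * dX k A x y / A x y ^ 2) := by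
    simp only [hXN, Finset.mul_sum, ← Finset.sum_add_distrib]
    exact Finset.sum_congr rfl fun j _ => by ring
  have s3 : ∑ j, spray F j x y * ∑ k, dY j (dY k (spray F k)) x y =
      ∑ j, H j x y * dY j (dirDiv H) x y + q x y / A x y * ∑ j, y j * dY j (dirDiv H) x y
      + (n + 1) * ∑ j, H j x y * (dY j q x y / A x y - q x y * dY j A x y / A x y ^ 2)
      + (n + 1) * (q x y / A x y) *
        ∑ j, y j * (dY j q x y / A x y - q x y * dY j A x y / A x y ^ 2) := by
    simp only [hYN, fun j => hs _ hp j, Finset.mul_sum, ← Finset.sum_add_distrib]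
    exact Finset.sum_congr rfl fun j _ => by ring
  rw [hric, s1, s2, s3, s4', eP _ hp, expand, expand, ricciRest]
  change _ = (n - 1) * _ + A x y * (_ + 2 * q x y * _ - 2 * q x y * ∑ k, dY k (H k) x y + _ + _)
  exact sq_mul_ricci_algebra h0 _ _ _ _ _ _ _ _ _ _ _ _

end RicciProjective

/-! ### Functions polynomial in the direction and in 1/β. -/

section RationalFunctions

variable {n : ℕ} {U : Set (Model n)} {h : Model n → Model n →L[ℝ] Model n →L[ℝ] ℝ}
  {W : Model n → Model n} {x y : Model n}

/-- The functions on the cone bundle that are polynomial in `y` and in `1 / β`, with coefficients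
smooth in `x`. -/
inductive IsConePolynomial (U : Set (Model n)) (h : Model n → Model n →L[ℝ] Model n →L[ℝ] ℝ)
    (W : Model n → Model n) : (Model n → Model n → ℝ) → Prop
  | coef (f : Model n → ℝ) (hf : ContDiffOn ℝ ∞ f U) : IsConePolynomial U h W fun x _ => f x
  | lin (L : Model n → Model n →L[ℝ] ℝ) (hL : ContDiffOn ℝ ∞ L U) :
      IsConePolynomial U h W fun x y => L x y
  | inv : IsConePolynomial U h W fun x y => (h x (W x) y)⁻¹
  | add {f g} (hf : IsConePolynomial U h W f) (hg : IsConePolynomial U h W g) :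
      IsConePolynomial U h W fun x y => f x y + g x y
  | mul {f g} (hf : IsConePolynomial U h W f) (hg : IsConePolynomial U h W g) :
      IsConePolynomial U h W fun x y => f x y * g x y
  | congr {f g} (hf : IsConePolynomial U h W f)
      (hfg : ∀ q ∈ coneBundle U h W, g q.1 q.2 = f q.1 q.2) : IsConePolynomial U h W g

namespace IsConePolynomial

variable {f g : Model n → Model n → ℝ}

theorem const (c : ℝ) : IsConePolynomial U h W fun _ _ => c := coef _ contDiffOn_const

theorem neg (hf : IsConePolynomial U h W f) : IsConePolynomial U h W fun x y => -f x y :=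
  ((const (-1)).mul hf).congr fun q _ => by ring

theorem sub (hf : IsConePolynomial U h W f) (hg : IsConePolynomial U h W g) :
    IsConePolynomial U h W fun x y => f x y - g x y :=
  (hf.add hg.neg).congr fun q _ => by ring

theorem sum {ι : Type*} (s : Finset ι) {f : ι → Model n → Model n → ℝ}
    (hf : ∀ i ∈ s, IsConePolynomial U h W (f i)) :
    IsConePolynomial U h W fun x y => ∑ i ∈ s, f i x y := by
  classical
  induction s using Finset.induction_on with
  | empty => exact (const 0).congr fun q _ => by simp
  | insert a s ha ih =>
    refine ((hf a (by simp)).add (ih fun i hi => hf i (by simp [hi]))).congr fun q _ => ?_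
    rw [Finset.sum_insert ha]

theorem coordinate (i : Fin n) : IsConePolynomial U h W fun _ y => y i :=
  lin (fun _ => EuclideanSpace.proj (𝕜 := ℝ) i) contDiffOn_const

theorem quadratic {K : Model n → Model n →L[ℝ] Model n →L[ℝ] ℝ} (hK : ContDiffOn ℝ ∞ K U) :
    IsConePolynomial U h W fun x y => K x y y := by
  refine (sum Finset.univ fun i _ => (coordinate i).mul
    (lin (fun x => K x (EuclideanSpace.single i 1)) (hK.clm_apply contDiffOn_const))).congr
    fun q _ => ?_
  rw [map_eq_sum_single (K q.1) q.2]
  simp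

theorem quadraticCoord {K : Model n → Model n →L[ℝ] Model n →L[ℝ] Model n}
    (hK : ContDiffOn ℝ ∞ K U) (i : Fin n) :
    IsConePolynomial U h W fun x y => K x y y i := by
  have hs : ∀ j : Fin n, ContDiffOn ℝ ∞ (fun x => (EuclideanSpace.proj (𝕜 := ℝ) i).comp
    (K x (EuclideanSpace.single j 1))) U := fun j =>
    contDiffOn_const.clm_comp (hK.clm_apply contDiffOn_const)
  refine (sum Finset.univ fun j _ => (coordinate j).mul (lin _ (hs j))).congr fun q _ => ?_
  rw [map_eq_sum_single (K q.1) q.2]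
  simp

variable (hh : IsMetric U h) (hW : IsUnitField U h W)
include hh hW

theorem jointSmooth (hf : IsConePolynomial U h W f) : JointSmooth (coneBundle U h W) f := by
  induction hf with
  | coef f hf => exact JointSmooth.of_fst hf fun _ hq => hq.1
  | lin L hL => exact (JointSmooth.of_fst hL fun _ hq => hq.1).clm_apply jointSmooth_snd
  | inv => exact (jointSmooth_form hh hW fun _ hq => hq.1).inv fun _ hq => hq.2.ne'
  | add _ _ h1 h2 => exact ContDiffOn.add h1 h2
  | mul _ _ h1 h2 => exact ContDiffOn.mul h1 h2
  | congr _ hfg h1 => exact ContDiffOn.congr h1 hfg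

/-- The class is stable because differentiating 1/β produces only -(1/β)² times the derivative of β.
-/
theorem partial_fst (hf : IsConePolynomial U h W f) (v : Model n) :
    IsConePolynomial U h W fun x y => fderiv ℝ (fun z => f z y) x v := by
  have hΩ := isOpen_coneBundle hh hW
  induction hf with
  | coef f hf => exact coef _ ((contDiffOn_fderiv hh.isOpen hf).clm_apply contDiffOn_const)
  | lin L hL =>
    refine (lin _ ((contDiffOn_fderiv hh.isOpen hL).clm_apply
      (contDiffOn_const (c := v)))).congr fun q hq => ?_
    have hd := differentiableAt_of_contDiffOn hh.isOpen hL hq.1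
    exact fderiv_eq_of_hasDerivAt_line (hd.clm_apply (differentiableAt_const _))
      (((hasDerivAt_line hd v).clm_apply (hasDerivAt_const_smooth q.2)).congr_deriv (by simp))
  | inv =>
    have hb : ContDiffOn ℝ ∞ (fun x => h x (W x)) U := hh.smooth.clm_apply hW.smooth
    refine ((const (-1)).mul ((inv.mul inv).mul (lin _
      ((contDiffOn_fderiv hh.isOpen hb).clm_apply (contDiffOn_const (c := v)))))).congr
      fun q hq => ?_
    have hd := differentiableAt_of_contDiffOn hh.isOpen hb hq.1
    have hd' : DifferentiableAt ℝ (fun z => h z (W z) q.2) q.1 :=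
      hd.clm_apply (differentiableAt_const _)
    have h0 : h q.1 (W q.1) q.2 ≠ 0 := hq.2.ne'
    refine fderiv_eq_of_hasDerivAt_line (hd'.fun_inv h0) ((((hasDerivAt_line hd v).clm_apply
      (hasDerivAt_const_smooth q.2)).fun_inv (by simpa using h0)).congr_deriv ?_)
    simp only [zero_smul, add_zero, map_zero]
    field_simp
  | @add f g hf hg h1 h2 =>
    refine (h1.add h2).congr fun q hq => ?_
    have d1 := (hf.jointSmooth hh hW).differentiableAt_fst hΩ hq
    have d2 := (hg.jointSmooth hh hW).differentiableAt_fst hΩ hq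
    rw [fderiv_fun_add d1 d2]; rfl
  | @mul f g hf hg h1 h2 =>
    refine ((hf.mul h2).add (hg.mul h1)).congr fun q hq => ?_
    have d1 := (hf.jointSmooth hh hW).differentiableAt_fst hΩ hq
    have d2 := (hg.jointSmooth hh hW).differentiableAt_fst hΩ hq
    rw [fderiv_fun_mul d1 d2]; rfl
  | congr _ hfg h1 => exact h1.congr fun q hq => by rw [fderiv_fst_congr hΩ hq hfg]

theorem partial_snd (hf : IsConePolynomial U h W f) (v : Model n) :
    IsConePolynomial U h W fun x y => fderiv ℝ (fun z => f x z) y v := by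
  have hΩ := isOpen_coneBundle hh hW
  induction hf with
  | coef f hf => exact (const 0).congr fun q _ => by simp
  | lin L hL => exact (coef _ (hL.clm_apply (contDiffOn_const (c := v)))).congr fun q hq => by simp
  | inv =>
    refine ((const (-1)).mul ((inv.mul inv).mul (coef _
      ((hh.smooth.clm_apply hW.smooth).clm_apply (contDiffOn_const (c := v)))))).congr
      fun q hq => ?_
    have h0 : h q.1 (W q.1) q.2 ≠ 0 := hq.2.ne'
    refine fderiv_eq_of_hasDerivAt_line ((h q.1 (W q.1)).differentiableAt.fun_inv h0)
      (((hasDerivAt_clm_snd (h q.1 (W q.1)) q.2 v).fun_inv (by simpa using h0)).congr_deriv ?_)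
    simp only [zero_smul, add_zero]
    field_simp
  | @add f g hf hg h1 h2 =>
    refine (h1.add h2).congr fun q hq => ?_
    have d1 := (hf.jointSmooth hh hW).differentiableAt_snd hΩ hq
    have d2 := (hg.jointSmooth hh hW).differentiableAt_snd hΩ hq
    rw [fderiv_fun_add d1 d2]; rfl
  | @mul f g hf hg h1 h2 =>
    refine ((hf.mul h2).add (hg.mul h1)).congr fun q hq => ?_
    have d1 := (hf.jointSmooth hh hW).differentiableAt_snd hΩ hq
    have d2 := (hg.jointSmooth hh hW).differentiableAt_snd hΩ hq
    rw [fderiv_fun_mul d1 d2]; rfl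
  | @congr f g _ hfg h1 =>
    exact h1.congr fun q hq => by rw [fderiv_snd_congr (G := g) (G' := f) hΩ hq hfg]

omit hh in
-- On the line W + tv with v orthogonal to W the form equals 1, so 1/β disappears and only a
-- polynomial in t remains. In particular h(y,y) cannot occur in a denominator, which is what the
-- divisibility argument needs.
theorem eval_line (hf : IsConePolynomial U h W f) (hx : x ∈ U) {v : Model n}
    (hv : h x (W x) v = 0) :
    ∃ p : Polynomial ℝ, ∀ t : ℝ, f x (W x + t • v) = p.eval t := by
  have hB : ∀ t : ℝ, h x (W x) (W x + t • v) = 1 := by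
    intro t; rw [map_add, map_smul, hv, hW.unit x hx]; simp
  induction hf with
  | coef f hf => exact ⟨Polynomial.C (f x), fun t => by simp⟩
  | lin L hL =>
    exact ⟨Polynomial.C (L x (W x)) + Polynomial.C (L x v) * Polynomial.X, fun t => by
      simp only [map_add, map_smul, smul_eq_mul, Polynomial.eval_add, Polynomial.eval_mul,
        Polynomial.eval_C, Polynomial.eval_X]
      ring⟩
  | inv => exact ⟨1, fun t => by simp [hB]⟩
  | add _ _ h1 h2 =>
    obtain ⟨p, hp⟩ := h1
    obtain ⟨q, hq⟩ := h2
    exact ⟨p + q, fun t => by simp only [hp, hq, Polynomial.eval_add]⟩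
  | mul _ _ h1 h2 =>
    obtain ⟨p, hp⟩ := h1
    obtain ⟨q, hq⟩ := h2
    exact ⟨p * q, fun t => by simp only [hp, hq, Polynomial.eval_mul]⟩
  | congr _ hfg h1 =>
    obtain ⟨p, hp⟩ := h1
    refine ⟨p, fun t => ?_⟩
    rw [← hp, hfg (x, W x + t • v) ⟨hx, by simp only [hB]; norm_num⟩]

end IsConePolynomial

end RationalFunctions

/-- A real quadratic polynomial without constant term whose square is divisible by `1 + t²`
vanishes. -/
theorem eq_zero_of_sq_eq_mul {c m s : ℝ} (hc : c ≠ 0) {p : Polynomial ℝ}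
    (H : ∀ t : ℝ, c * (m * t + s * t ^ 2) ^ 2 = (1 + t ^ 2) * p.eval t) : m = 0 ∧ s = 0 := by
  have : Polynomial.C c * (Polynomial.C m * Polynomial.X + Polynomial.C s * Polynomial.X ^ 2) ^ 2
      = (1 + Polynomial.X ^ 2) * p := by
    refine Polynomial.funext fun t => ?_
    simpa using H t
  -- At t = i the factor 1 + t² vanishes, so (mi - s)² = 0; real and imaginary parts give the claim.
  have h2 := congrArg (Polynomial.aeval Complex.I) this
  simp only [map_mul, map_pow, map_add, Polynomial.aeval_C, Polynomial.aeval_X, map_one,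
    Complex.I_sq, add_neg_cancel, zero_mul] at h2
  have hc' : algebraMap ℝ ℂ c ≠ 0 := by simpa using hc
  have h3 := pow_eq_zero_iff (two_ne_zero) |>.1 ((mul_eq_zero.1 h2).resolve_left hc')
  have re := congrArg Complex.re h3
  have im := congrArg Complex.im h3
  simp at re im
  exact ⟨im, re⟩

/-! ### Weak Einstein Kropina metrics have a Killing unit form. -/

section WeakEinstein

variable {n : ℕ} {U : Set (Model n)} {h : Model n → Model n →L[ℝ] Model n →L[ℝ] ℝ}
  {Γ : Model n → Model n →L[ℝ] Model n →L[ℝ] Model n} {W : Model n → Model n} {x y : Model n}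
  {F : Model n → Model n → ℝ} {Z : Model n → Model n →L[ℝ] Model n}

/-- The part of the spray of a Kropina metric that has no pole along `α = 0`. -/
def regularSpray (h : Model n → Model n →L[ℝ] Model n →L[ℝ] ℝ)
    (Γ : Model n → Model n →L[ℝ] Model n →L[ℝ] Model n) (W : Model n → Model n)
    (Z : Model n → Model n →L[ℝ] Model n) (x y : Model n) : Model n :=
  Γ x y y - (h x y y / (2 * h x (W x) y)) • Z x y
    + ((1 / 2) * (h x y y / h x (W x) y * h x (Z x y) (W x) + h x (covDeriv Γ W x y) y)) • W x
    - h x (Z x y) (W x) • y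

/-- The numerator `-r_00 β` of the pole of the spray of a Kropina metric along `α = 0`. -/
def poleCoeff (h : Model n → Model n →L[ℝ] Model n →L[ℝ] ℝ)
    (Γ : Model n → Model n →L[ℝ] Model n →L[ℝ] Model n) (W : Model n → Model n)
    (x y : Model n) : ℝ := -(h x (covDeriv Γ W x y) y * h x (W x) y)

theorem kropinaSpray_eq (x y : Model n) (i : Fin n) : kropinaSpray h Γ W Z x y i =
    regularSpray h Γ W Z x y i + poleCoeff h Γ W x y / h x y y * y i := by
  simp only [kropinaSpray, regularSpray, poleCoeff, PiLp.add_apply, PiLp.sub_apply,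
    PiLp.smul_apply, smul_eq_mul]
  ring

theorem sum_mul_dY (f : Model n → Model n → ℝ) (x y z : Model n) :
    ∑ j, z j * dY j f x y = fderiv ℝ (f x) y z := by
  rw [map_eq_sum_single _ z]; rfl

theorem sum_mul_dX (f : Model n → Model n → ℝ) (x y z : Model n) :
    ∑ j, z j * dX j f x y = fderiv ℝ (fun ξ => f ξ y) x z := by
  rw [map_eq_sum_single _ z]; rfl

/-- Euler's relation for positively homogeneous functions. -/
theorem euler_of_homogeneous {f : Model n → ℝ} {k : ℕ} (hd : DifferentiableAt ℝ f y)
    (hf : ∀ c : ℝ, 0 < c → f (c • y) = c ^ k * f y) : fderiv ℝ f y y = k * f y := by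
  refine fderiv_eq_of_hasDerivAt_line hd ?_
  have h1 : HasDerivAt (fun t : ℝ => (1 + t) ^ k * f y) (k * f y) 0 := by
    have := (((hasDerivAt_id (0 : ℝ)).const_add 1).fun_pow k).mul_const (f y)
    simpa using this
  refine h1.congr_of_eventuallyEq ?_
  filter_upwards [Ioi_mem_nhds (show (-1 : ℝ) < 0 by norm_num)] with t ht
  rw [← hf _ (by linarith [mem_Ioi.1 ht]), add_smul, one_smul]

variable (hh : IsMetric U h) (hW : IsUnitField U h W) (hΓ : IsChristoffel U h Γ)
include hh hW hΓ

theorem isConePolynomial_poleCoeff : IsConePolynomial U h W (poleCoeff h Γ W) :=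
  ((IsConePolynomial.quadratic (K := fun x => (h x).comp (covDeriv Γ W x))
    (hh.smooth.clm_comp (contDiffOn_covDeriv hh hΓ hW.smooth))).mul
    (.lin _ (hh.smooth.clm_apply hW.smooth))).neg

omit hΓ in
theorem isConePolynomial_skewForm (hZs : ContDiffOn ℝ ∞ Z U) :
    IsConePolynomial U h W fun x y => h x (Z x y) (W x) :=
  (IsConePolynomial.lin (fun x => (h x (W x)).comp (Z x))
    ((hh.smooth.clm_apply hW.smooth).clm_comp hZs)).congr
    fun q hq => hh.symm q.1 hq.1 _ _

theorem isConePolynomial_regularSpray (hZs : ContDiffOn ℝ ∞ Z U) (i : Fin n) :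
    IsConePolynomial U h W fun x y => regularSpray h Γ W Z x y i := by
  have hA : IsConePolynomial U h W fun x y => h x y y := .quadratic hh.smooth
  have hs := isConePolynomial_skewForm hh hW hZs
  have hr : IsConePolynomial U h W fun x y => h x (covDeriv Γ W x y) y :=
    .quadratic (K := fun x => (h x).comp (covDeriv Γ W x))
      (hh.smooth.clm_comp (contDiffOn_covDeriv hh hΓ hW.smooth))
  have hZi : IsConePolynomial U h W fun x y => Z x y i :=
    .lin (fun x => (EuclideanSpace.proj (𝕜 := ℝ) i).comp (Z x)) (contDiffOn_const.clm_comp hZs)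
  have hWi : IsConePolynomial U h W fun x _ => W x i :=
    .coef _ ((EuclideanSpace.proj (𝕜 := ℝ) i).contDiff.comp_contDiffOn hW.smooth)
  have hAB := hA.mul .inv
  refine ((((IsConePolynomial.quadraticCoord hΓ.smooth i).sub
    (((IsConePolynomial.const (1 / 2)).mul hAB).mul hZi)).add
    (((IsConePolynomial.const (1 / 2)).mul ((hAB.mul hs).add hr)).mul hWi)).sub
    (hs.mul (.coordinate i))).congr fun q hq => ?_
  have hB : h q.1 (W q.1) q.2 ≠ 0 := hq.2.ne'
  simp only [regularSpray, PiLp.add_apply, PiLp.sub_apply, PiLp.smul_apply, smul_eq_mul]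
  field_simp

/-- The remainder is assembled from the metric, the pole coefficient and the regular spray by sums,
products and partial derivatives, none of which introduces 1/h(y,y). -/
theorem isConePolynomial_ricciRest (hZs : ContDiffOn ℝ ∞ Z U) :
    IsConePolynomial U h W (ricciRest (fun x y => h x y y) (poleCoeff h Γ W)
      (fun i x y => regularSpray h Γ W Z x y i)) := by
  have hA : IsConePolynomial U h W fun x y => h x y y := .quadratic hh.smooth
  have hq := isConePolynomial_poleCoeff hh hW hΓ
  have hH := isConePolynomial_regularSpray hh hW hΓ hZs
  have hX : ∀ {f} (i : Fin n), IsConePolynomial U h W f → IsConePolynomial U h W (dX i f) :=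
    fun i hf => hf.partial_fst hh hW _
  have hY : ∀ {f} (i : Fin n), IsConePolynomial U h W f → IsConePolynomial U h W (dY i f) :=
    fun i hf => hf.partial_snd hh hW _
  have hD : IsConePolynomial U h W (dirDiv fun i x y => regularSpray h Γ W Z x y i) :=
    .sum _ fun k _ => hY k (hH k)
  have hc : ∀ i : Fin n, IsConePolynomial U h W fun _ y => y i := fun i => .coordinate i
  have t1 := IsConePolynomial.sum Finset.univ fun k _ => hX k (hH k)
  have t2 := IsConePolynomial.sum Finset.univ fun j _ => (hc j).mul (hX j hD)
  have t3 := IsConePolynomial.sum Finset.univ fun j _ => (hH j).mul (hY j hD)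
  have t4 := IsConePolynomial.sum Finset.univ fun k _ => IsConePolynomial.sum Finset.univ
    fun j _ => (hY j (hH k)).mul (hY k (hH j))
  have t5 := IsConePolynomial.sum Finset.univ fun j _ => (hc j).mul (hY j hD)
  have t6 := IsConePolynomial.sum Finset.univ fun j _ => (hc j).mul (hX j hq)
  have t7 := IsConePolynomial.sum Finset.univ fun j _ => (hH j).mul (hY j hq)
  have c := fun r : ℝ => IsConePolynomial.const (U := U) (h := h) (W := W) r
  exact (((((hA.mul (((((c 2).mul t1).sub t2).add ((c 2).mul t3)).sub t4)).add
    (((c 2).mul hq).mul t5)).sub (((c 2).mul hq).mul hD)).add ((c (1 - n)).mul t6)).add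
    ((c (2 * n - 2)).mul t7))

/-- The Ricci curvature of a Kropina metric, up to terms of lower pole order along `α = 0`. -/
theorem sq_mul_ricci_kropina
    (hF : ∀ q ∈ coneBundle U h W,
      energy F q.1 q.2 = (h q.1 q.2 q.2) ^ 2 / (h q.1 (W q.1) q.2) ^ 2)
    (hZs : ContDiffOn ℝ ∞ Z U) (hZ : ∀ x ∈ U, ∀ u v, h x (Z x u) v =
      (1 / 2) * (h x (covDeriv Γ W x u) v - h x (covDeriv Γ W x v) u))
    (hq : (x, y) ∈ coneBundle U h W) :
    (h x y y) ^ 2 * ricci F x y =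
      3 * (n - 1) * (h x (covDeriv Γ W x y) y * h x (W x) y) ^ 2
      + h x y y * (ricciRest (fun x y => h x y y) (poleCoeff h Γ W)
          (fun i x y => regularSpray h Γ W Z x y i) x y
        - 2 * (n - 1) * (h x (covDeriv Γ W x y) y * h x (W x) y) * h x (Z x y) (W x)) := by
  have hΩ := isOpen_coneBundle hh hW
  have hH := fun i => (isConePolynomial_regularSpray hh hW hΓ hZs i).jointSmooth hh hW
  have hP := (isConePolynomial_poleCoeff hh hW hΓ).jointSmooth hh hW
  have hA : JointSmooth (coneBundle U h W) fun x y => h x y y :=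
    hh.jointSmooth_norm fun _ hq => hq.1
  have key := sq_mul_ricci (F := F) hΩ hH hP hA (fun p hp => (pos_of_mem_cone hh hp).ne')
    (fun p hp i => by rw [spray_kropina hh hW hF hΓ hZ hp, kropinaSpray_eq])
    (fun p hp k => by
      rw [sum_mul_dY, euler_of_homogeneous (k := 2) ((hH k).differentiableAt_snd hΩ hp)]
      · norm_num
      · intro c hc
        have hB : h p.1 (W p.1) p.2 ≠ 0 := hp.2.ne'
        simp only [regularSpray, map_smul, smul_apply, PiLp.add_apply, PiLp.sub_apply,
          PiLp.smul_apply, smul_eq_mul]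
        field_simp)
    (fun p hp => by
      rw [sum_mul_dY, euler_of_homogeneous (k := 3) (hP.differentiableAt_snd hΩ hp)]
      · norm_num
      · intro c hc
        simp only [poleCoeff, map_smul, smul_apply, smul_eq_mul]
        ring)
    (fun p hp => by
      rw [sum_mul_dY, euler_of_homogeneous (k := 2) (hA.differentiableAt_snd hΩ hp)]
      · norm_num
      · intro c hc
        simp only [map_smul, smul_apply, smul_eq_mul]
        ring) hq
  have hx := hq.1
  have hB : h x (W x) y ≠ 0 := hq.2.ne'
  have e1 : ∑ j, y j * dX j (fun x y => h x y y) x y = 4 * h x (Γ x y y) y := by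
    rw [sum_mul_dX, fderiv_eq_of_hasDerivAt_line (hA.differentiableAt_fst hΩ hq)
      (hasDerivAt_norm_fst (hh.differentiableAt hx) y y), hΓ.compat x hx, hh.symm x hx y]
    ring
  -- In the coefficient of the double pole the terms with Γ from `e1` and `e2` cancel. With q =
  -- -r₀₀β, the term r₀₀β contributes 2q², which together with the q² already present makes the
  -- factor 3.
  have e2 : ∑ j, regularSpray h Γ W Z x y j * dY j (fun x y => h x y y) x y =
      2 * h x (Γ x y y) y - h x y y * h x (Z x y) (W x)
        + h x (covDeriv Γ W x y) y * h x (W x) y := by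
    have z2 : h x (Z x y) y = 0 := by rw [hZ x hx]; ring
    rw [sum_mul_dY, fderiv_eq_of_hasDerivAt_line (hA.differentiableAt_snd hΩ hq)
      (hasDerivAt_norm_snd (h x) y _), hh.symm x hx y]
    simp only [regularSpray, map_add, map_sub, map_smul, add_apply, sub_apply, smul_apply,
      smul_eq_mul, z2]
    field_simp
    ring
  rw [key, e1, e2, poleCoeff]
  ring

/-- The unit form of a weak Einstein Kropina metric is a Killing form. -/
theorem killing_of_weakEinstein (hn : 2 ≤ n)
    (hF : ∀ q ∈ coneBundle U h W, F q.1 q.2 = h q.1 q.2 q.2 / h q.1 (W q.1) q.2)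
    (hx : x ∈ U) (θ : Model n →L[ℝ] ℝ) (σ : ℝ)
    (hE : ∀ y, 0 < h x (W x) y →
      ricci F x y = (n - 1) * (3 * θ y / F x y + σ) * F x y ^ 2) (y : Model n) :
    h x (covDeriv Γ W x y) y = 0 := by
  -- The skew part of the bilinear form of ∇W; raising an index produces Z.
  have hK : ContDiffOn ℝ ∞ (fun x => (1 / 2 : ℝ) • ((h x).comp (covDeriv Γ W x)
      - (ContinuousLinearMap.flipₗᵢ ℝ (Model n) (Model n) ℝ).toContinuousLinearEquiv
        ((h x).comp (covDeriv Γ W x)))) U := by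
    have h1 := hh.smooth.clm_comp (contDiffOn_covDeriv hh hΓ hW.smooth)
    exact (h1.sub ((ContinuousLinearMap.flipₗᵢ ℝ (Model n) (Model n)
      ℝ).toContinuousLinearEquiv.contDiff.comp_contDiffOn h1)).const_smul (1 / 2 : ℝ)
  obtain ⟨Z, hZs, hZ⟩ := hh.exists_raise hK
  have hZ' : ∀ x ∈ U, ∀ u v, h x (Z x u) v =
      (1 / 2) * (h x (covDeriv Γ W x u) v - h x (covDeriv Γ W x v) u) := by
    intro x hx u v; rw [hZ x hx]; rfl
  have hF2 : ∀ q ∈ coneBundle U h W,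
      energy F q.1 q.2 = (h q.1 q.2 q.2) ^ 2 / (h q.1 (W q.1) q.2) ^ 2 := by
    intro q hq; rw [energy, hF q hq, div_pow]
  set S := covDeriv Γ W x with hS
  have hSW : ∀ u, h x (S u) (W x) = 0 := metric_covDeriv_unit hh hΓ hW.smooth hW.unit hx
  have hn1 : (3 * (n - 1) : ℝ) ≠ 0 := by
    have : (2 : ℝ) ≤ n := by exact_mod_cast hn
    intro h0; linarith
  -- On W + tv the quadratic form r₀₀ has no constant term, and its remaining coefficients are
  -- h(SW,v) and h(Sv,v), because S takes values orthogonal to W.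
  have main : ∀ v, h x (W x) v = 0 → h x v v = 1 → h x (S (W x)) v = 0 ∧ h x (S v) v = 0 := by
    intro v hv hv1
    have hB : ∀ t : ℝ, h x (W x) (W x + t • v) = 1 := by
      intro t; rw [map_add, map_smul, hv, hW.unit x hx]; simp
    have hA : ∀ t : ℝ, h x (W x + t • v) (W x + t • v) = 1 + t ^ 2 := by
      intro t
      simp only [map_add, map_smul, add_apply, smul_apply, smul_eq_mul, hv, hv1,
        hh.symm x hx v (W x), hW.unit x hx]
      ring
    obtain ⟨p, hp⟩ := (isConePolynomial_ricciRest hh hW hΓ hZs).eval_line hW hx hv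
    obtain ⟨s, hs⟩ := (isConePolynomial_skewForm hh hW hZs).eval_line hW hx hv
    have hr : ∀ t : ℝ, h x (S (W x + t • v)) (W x + t • v) =
        h x (S (W x)) v * t + h x (S v) v * t ^ 2 := by
      intro t
      simp only [map_add, map_smul, add_apply, smul_apply, smul_eq_mul, hSW]
      ring
    -- On this line F = 1 + t², so F² times the prescribed Ricci curvature is (n-1)(3θF³ + σF⁴). The
    -- quotient polynomial is this divided by 1 + t², minus the remainder from
    -- `sq_mul_ricci_kropina`.
    refine eq_zero_of_sq_eq_mul hn1 (p := (n - 1 : ℝ) • ((3 : ℝ) • (Polynomial.C (θ (W x))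
      + Polynomial.C (θ v) * Polynomial.X) * (1 + Polynomial.X ^ 2) ^ 2
      + Polynomial.C σ * (1 + Polynomial.X ^ 2) ^ 3)
      - (p - (2 * (n - 1) : ℝ) • ((Polynomial.C (h x (S (W x)) v) * Polynomial.X
        + Polynomial.C (h x (S v) v) * Polynomial.X ^ 2) * s))) fun t => ?_
    have hq : (x, W x + t • v) ∈ coneBundle U h W := ⟨hx, by simp only [hB]; norm_num⟩
    have h1 := sq_mul_ricci_kropina hh hW hΓ hF2 hZs hZ' hq
    have hFt := hF _ hq
    simp only [hA, hB] at hFt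
    rw [hE _ (by rw [hB]; norm_num), hFt, hB, ← hS, hr, hA, hp, hs] at h1
    have h0 : (1 + t ^ 2 : ℝ) ≠ 0 := by positivity
    simp only [Polynomial.eval_sub, Polynomial.eval_smul, Polynomial.eval_add, Polynomial.eval_mul,
      Polynomial.eval_pow, Polynomial.eval_C, Polynomial.eval_X, Polynomial.eval_one, smul_eq_mul]
    simp only [map_add, map_smul, smul_eq_mul] at h1
    field_simp at h1
    linear_combination -h1
  have main' : ∀ v, h x (W x) v = 0 → h x (S (W x)) v = 0 ∧ h x (S v) v = 0 := by
    intro v hv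
    by_cases hv0 : v = 0
    · simp [hv0]
    have hp := hh.pos x hx v hv0
    set c := Real.sqrt (h x v v) with hc
    have hc0 : c ≠ 0 := (Real.sqrt_pos.2 hp).ne'
    have hc2 : c ^ 2 = h x v v := Real.sq_sqrt hp.le
    have h1 := main (c⁻¹ • v) (by simp [hv]) (by
      simp only [map_smul, smul_apply, smul_eq_mul]
      rw [← hc2]; field_simp)
    simp only [map_smul, smul_apply, smul_eq_mul, mul_eq_zero, inv_eq_zero, hc0, false_or] at h1
    exact h1
  -- Splitting off the component along W reduces r₀₀ to the two coefficients just shown to vanish.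
  have hy : y = h x (W x) y • W x + (y - h x (W x) y • W x) := by abel
  have hperp : h x (W x) (y - h x (W x) y • W x) = 0 := by
    rw [map_sub, map_smul, hW.unit x hx]; simp
  obtain ⟨m1, m2⟩ := main' _ hperp
  rw [hy]
  generalize y - h x (W x) y • W x = z at *
  simp only [map_add, map_smul, add_apply, smul_apply, smul_eq_mul, hSW, m1, m2]
  ring

end WeakEinstein

/-! ### From constant flag curvature to Ricci curvature. -/

section FlagCurvature

open scoped Matrix

variable {n : ℕ} (F : Model n → Model n → ℝ) (x y : Model n)

theorem fundForm_add_left (v v' w : Model n) :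
    fundForm F x y (v + v') w = fundForm F x y v w + fundForm F x y v' w := by
  simp only [fundForm, ← Finset.sum_add_distrib, PiLp.add_apply]
  exact Finset.sum_congr rfl fun i _ => Finset.sum_congr rfl fun j _ => by ring

theorem fundForm_smul_left (c : ℝ) (v w : Model n) :
    fundForm F x y (c • v) w = c * fundForm F x y v w := by
  simp only [fundForm, Finset.mul_sum, PiLp.smul_apply, smul_eq_mul]
  exact Finset.sum_congr rfl fun i _ => Finset.sum_congr rfl fun j _ => by ring

theorem fundForm_add_right (v w w' : Model n) :
    fundForm F x y v (w + w') = fundForm F x y v w + fundForm F x y v w' := by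
  simp only [fundForm, ← Finset.sum_add_distrib, PiLp.add_apply]
  exact Finset.sum_congr rfl fun i _ => Finset.sum_congr rfl fun j _ => by ring

theorem fundForm_smul_right (c : ℝ) (v w : Model n) :
    fundForm F x y v (c • w) = c * fundForm F x y v w := by
  simp only [fundForm, Finset.mul_sum, PiLp.smul_apply, smul_eq_mul]
  exact Finset.sum_congr rfl fun i _ => Finset.sum_congr rfl fun j _ => by ring

theorem riemannVec_add (v w : Model n) :
    riemannVec F x y (v + w) = riemannVec F x y v + riemannVec F x y w := by
  ext i
  simp only [riemannVec, PiLp.add_apply, ← Finset.sum_add_distrib]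
  exact Finset.sum_congr rfl fun i _ => by ring

theorem riemannVec_smul (c : ℝ) (v : Model n) :
    riemannVec F x y (c • v) = c • riemannVec F x y v := by
  ext i
  simp only [riemannVec, PiLp.smul_apply, Finset.mul_sum, smul_eq_mul]
  exact Finset.sum_congr rfl fun i _ => by ring

variable {F x y}

theorem exists_linearIndependent_pair (hn : 2 ≤ n) (hy : y ≠ 0) :
    ∃ z : Model n, LinearIndependent ℝ ![y, z] := by
  by_contra! hcon
  have h1 : ∀ z, ∃ c : ℝ, c • y = z := by
    intro z
    have := hcon z
    rw [LinearIndependent.pair_iff' hy] at this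
    push Not at this
    exact this
  have h2 : Module.finrank ℝ (Model n) ≤ 1 := finrank_le_one y h1
  rw [finrank_euclideanSpace_fin] at h2
  omega

variable (hsymm : ∀ v w, fundForm F x y v w = fundForm F x y w v)
  (hpos : ∀ w, w ≠ 0 → 0 < fundForm F x y w w)
include hsymm hpos

/-- Strict Cauchy-Schwarz: the denominator is g_y(y,y) times the squared length of the component of
w orthogonal to y. -/
theorem flag_denominator_pos (hy : y ≠ 0) {w : Model n} (hw : LinearIndependent ℝ ![y, w]) :
    0 < fundForm F x y y y * fundForm F x y w w - fundForm F x y y w ^ 2 := by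
  have hyy := hpos y hy
  have hne : w + (-(fundForm F x y y w / fundForm F x y y y)) • y ≠ 0 := by
    intro h0
    rw [LinearIndependent.pair_iff' hy] at hw
    refine hw (fundForm F x y y w / fundForm F x y y y) ?_
    rw [neg_smul, ← sub_eq_add_neg, sub_eq_zero] at h0
    exact h0.symm
  have := mul_pos hyy (hpos _ hne)
  rw [fundForm_add_left, fundForm_add_right, fundForm_add_right, fundForm_smul_left,
    fundForm_smul_left, fundForm_smul_right, fundForm_smul_right, hsymm w y] at this
  have e : fundForm F x y y y * fundForm F x y w w - fundForm F x y y w ^ 2 =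
    fundForm F x y y y * (fundForm F x y w w
      + -(fundForm F x y y w / fundForm F x y y y) * fundForm F x y y w
      + (-(fundForm F x y y w / fundForm F x y y y) * fundForm F x y y w
        + -(fundForm F x y y w / fundForm F x y y y) *
          (-(fundForm F x y y w / fundForm F x y y y) * fundForm F x y y y))) := by
    field_simp; ring
  rw [e]; exact this

/-- Both sides are quadratic in w, so an identity valid for all w independent of y extends to w =
cy: its value there is half the sum of the values at cy + z and cy - z, minus the value at z. -/
theorem fundForm_riemannVec_of_flag (hn : 2 ≤ n) (hy : y ≠ 0) {κ : ℝ}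
    (hflag : ∀ w, LinearIndependent ℝ ![y, w] → flagCurvature F x y w = κ) (w : Model n) :
    fundForm F x y (riemannVec F x y w) w =
      κ * (fundForm F x y y y * fundForm F x y w w - fundForm F x y y w ^ 2) := by
  have gen : ∀ w, LinearIndependent ℝ ![y, w] → fundForm F x y (riemannVec F x y w) w =
      κ * (fundForm F x y y y * fundForm F x y w w - fundForm F x y y w ^ 2) := by
    intro w hw
    have h0 := flag_denominator_pos hsymm hpos hy hw
    have := hflag w hw
    rw [flagCurvature, div_eq_iff h0.ne'] at this
    exact this
  by_cases hw : LinearIndependent ℝ ![y, w]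
  · exact gen w hw
  · obtain ⟨z, hz⟩ := exists_linearIndependent_pair hn hy
    rw [LinearIndependent.pair_iff' hy] at hw
    push Not at hw
    obtain ⟨c, rfl⟩ := hw
    have hind : ∀ t : ℝ, t ≠ 0 → LinearIndependent ℝ ![y, c • y + t • z] := by
      intro t ht
      rw [LinearIndependent.pair_iff' hy] at hz ⊢
      intro d hd
      refine hz ((d - c) / t) ?_
      rw [div_eq_inv_mul, mul_smul, sub_smul, hd, add_sub_cancel_left, smul_smul,
        inv_mul_cancel₀ ht, one_smul]
    have g1 := gen _ (hind 1 one_ne_zero)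
    have g2 := gen _ (hind (-1) (by norm_num))
    have g3 := gen _ hz
    simp only [riemannVec_add, riemannVec_smul, fundForm_add_left, fundForm_add_right,
      fundForm_smul_left, fundForm_smul_right] at g1 g2 g3 ⊢
    linear_combination (1 / 2) * g1 + (1 / 2) * g2 - g3

/-- A Finsler metric of constant flag curvature is Einstein. -/
theorem ricci_of_const_flag (hn : 2 ≤ n) (hy : y ≠ 0) {κ : ℝ}
    (hflag : ∀ w, LinearIndependent ℝ ![y, w] → flagCurvature F x y w = κ) :
    ricci F x y = (n - 1) * κ * fundForm F x y y y := by
  classical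
  have key := fundForm_riemannVec_of_flag hsymm hpos hn hy hflag
  have pol : ∀ v w, fundForm F x y (riemannVec F x y v) w + fundForm F x y (riemannVec F x y w) v =
      2 * κ * (fundForm F x y y y * fundForm F x y v w
        - fundForm F x y y v * fundForm F x y y w) := by
    intro v w
    have k1 := key (v + w)
    simp only [riemannVec_add, fundForm_add_left, fundForm_add_right, hsymm w v] at k1
    linear_combination k1 - key v - key w
  set M := fundTensor F x y with hM
  let R : Matrix (Fin n) (Fin n) ℝ := Matrix.of fun i k => riemann F i k x y
  let l : Fin n → ℝ := M.mulVec fun i => y i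
  have hs : ∀ i, (fun j => (EuclideanSpace.single i (1 : ℝ) : Model n) j) = Pi.single i 1 := by
    intro i; ext j; simp [Pi.single_apply]
  have hMe : ∀ i j, fundForm F x y (EuclideanSpace.single i 1) (EuclideanSpace.single j 1)
      = M i j := by
    intro i j
    rw [fundForm_eq_dotProduct, hs, hs, single_one_dotProduct, Matrix.mulVec_single_one]
    rfl
  have hMs : Mᵀ = M := by
    ext i j
    rw [Matrix.transpose_apply, ← hMe, ← hMe, hsymm]
  have hle : ∀ i, fundForm F x y y (EuclideanSpace.single i 1) = l i := by
    intro i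
    rw [hsymm, fundForm_eq_dotProduct, hs, single_one_dotProduct]
  have hRe : ∀ k, (fun i => riemannVec F x y (EuclideanSpace.single k 1) i) = fun i => R i k := by
    intro k
    ext i
    simp [riemannVec, R]
  have hMR : ∀ k j, fundForm F x y (riemannVec F x y (EuclideanSpace.single k 1))
      (EuclideanSpace.single j 1) = (M * R) j k := by
    intro k j
    rw [hsymm, fundForm_eq_dotProduct, hs, single_one_dotProduct, hRe]
    rfl
  -- Only the symmetric part of g_y(R_y ·, ·) is known. That suffices, because MR and its transpose
  -- have the same trace tr R against the symmetric inverse of M.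
  have hmat : M * R + (M * R)ᵀ = (2 * κ) • (fundForm F x y y y • M - Matrix.vecMulVec l l) := by
    ext j k
    have := pol (EuclideanSpace.single k 1) (EuclideanSpace.single j 1)
    rw [hMR, hMR, hMe, hle, hle] at this
    simp only [Matrix.add_apply, Matrix.transpose_apply, Matrix.smul_apply, Matrix.sub_apply,
      Matrix.vecMulVec_apply, smul_eq_mul]
    rw [this, ← hMs, Matrix.transpose_apply, hMs]
    ring
  have hu := isUnit_det_fundTensor hpos
  rw [← hM] at hu
  have hinvs : (M⁻¹)ᵀ = M⁻¹ := by rw [Matrix.transpose_nonsing_inv, hMs]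
  have t1 : (M⁻¹ * (M * R)).trace = R.trace := by
    rw [← Matrix.mul_assoc, Matrix.nonsing_inv_mul _ hu, Matrix.one_mul]
  have t2 : (M⁻¹ * (M * R)ᵀ).trace = R.trace := by
    rw [← Matrix.trace_transpose, Matrix.transpose_mul, Matrix.transpose_transpose, hinvs,
      Matrix.trace_mul_comm, t1]
  have t3 : (M⁻¹ * Matrix.vecMulVec l l).trace = fundForm F x y y y := by
    rw [Matrix.mul_vecMulVec, Matrix.trace_vecMulVec, Matrix.mulVec_mulVec,
      Matrix.nonsing_inv_mul _ hu, Matrix.one_mulVec, fundForm_eq_dotProduct]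
  have tr := congrArg (fun T => (M⁻¹ * T).trace) hmat
  simp only [Matrix.mul_add, Matrix.trace_add, Matrix.mul_smul, Matrix.trace_smul, Matrix.mul_sub,
    Matrix.trace_sub, t1, t2, t3, Matrix.nonsing_inv_mul _ hu, Matrix.trace_one, smul_eq_mul,
    Fintype.card_fin] at tr
  have : ricci F x y = R.trace := rfl
  rw [this]
  linear_combination (1 / 2) * tr

end FlagCurvature

/-! ### Riemann curvature of a Kropina metric with Killing unit form. -/

section KillingKropina

variable {n : ℕ} {U : Set (Model n)} {h : Model n → Model n →L[ℝ] Model n →L[ℝ] ℝ}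
  {Γ : Model n → Model n →L[ℝ] Model n →L[ℝ] Model n} {W : Model n → Model n} {x y : Model n}
  {F : Model n → Model n → ℝ}

/-- The spray of a Kropina metric whose unit form is Killing. -/
def killingSpray (h : Model n → Model n →L[ℝ] Model n →L[ℝ] ℝ)
    (Γ : Model n → Model n →L[ℝ] Model n →L[ℝ] Model n) (W : Model n → Model n)
    (x y : Model n) : Model n :=
  Γ x y y - (h x y y / (2 * h x (W x) y)) • covDeriv Γ W x y

/-- The derivative of `killingSpray` in the direction variable. -/
def killingConnection (h : Model n → Model n →L[ℝ] Model n →L[ℝ] ℝ)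
    (Γ : Model n → Model n →L[ℝ] Model n →L[ℝ] Model n) (W : Model n → Model n)
    (x y w : Model n) : Model n :=
  Γ x w y + Γ x y w
    - ((2 * h x y w * h x (W x) y - h x y y * h x (W x) w) / (2 * h x (W x) y ^ 2)) •
      covDeriv Γ W x y
    - (h x y y / (2 * h x (W x) y)) • covDeriv Γ W x w

variable (hh : IsMetric U h) (hW : IsUnitField U h W) (hΓ : IsChristoffel U h Γ)
include hh hW hΓ

theorem jointSmooth_killingSpray : JointSmooth (coneBundle U h W) (killingSpray h Γ W) := by
  have hU : ∀ q ∈ coneBundle U h W, q.1 ∈ U := fun _ hq => hq.1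
  have h1 : JointSmooth (coneBundle U h W) (fun x y => Γ x y y) :=
    ((JointSmooth.of_fst hΓ.smooth hU).clm_apply jointSmooth_snd).clm_apply jointSmooth_snd
  have h2 : JointSmooth (coneBundle U h W) (fun x y => covDeriv Γ W x y) :=
    (JointSmooth.of_fst (contDiffOn_covDeriv hh hΓ hW.smooth) hU).clm_apply jointSmooth_snd
  have h3 : JointSmooth (coneBundle U h W) (fun x y => h x y y / (2 * h x (W x) y)) :=
    (hh.jointSmooth_norm hU).div (contDiffOn_const.mul (jointSmooth_form hh hW hU))
      fun q hq => (mul_pos two_pos hq.2).ne'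
  exact h1.sub (h3.smul h2)

theorem fderiv_killingSpray_snd (hq : (x, y) ∈ coneBundle U h W) (w : Model n) :
    fderiv ℝ (killingSpray h Γ W x) y w = killingConnection h Γ W x y w := by
  have hB : h x (W x) y ≠ 0 := hq.2.ne'
  refine fderiv_eq_of_hasDerivAt_line ((jointSmooth_killingSpray hh hW hΓ).differentiableAt_snd
    (isOpen_coneBundle hh hW) hq) ?_
  have dy := hasDerivAt_line_id y w
  refine ((((hasDerivAt_const_smooth (Γ x)).clm_apply dy).clm_apply dy).fun_sub
    (((hasDerivAt_norm_snd (h x) y w).fun_div ((hasDerivAt_clm_snd (h x (W x)) y w).const_mul 2)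
      (by simpa using hB)).fun_smul (hasDerivAt_clm_snd (covDeriv Γ W x) y w))).congr_deriv ?_
  simp only [zero_smul, add_zero, zero_apply, zero_add, killingConnection]
  rw [hh.symm x hq.1 w y]
  have e : ((h x y w + h x y w) * (2 * h x (W x) y) - h x y y * (2 * h x (W x) w))
      / (2 * h x (W x) y) ^ 2 = (2 * h x y w * h x (W x) y - h x y y * h x (W x) w)
      / (2 * h x (W x) y ^ 2) := by field_simp; ring
  rw [e]
  module

theorem fderiv_killingSpray_fst (hq : (x, y) ∈ coneBundle U h W) (w : Model n) :
    fderiv ℝ (fun z => killingSpray h Γ W z y) x w = fderiv ℝ Γ x w y y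
      - ((4 * h x y (Γ x w y) * h x (W x) y - h x y y *
          (h x (covDeriv Γ W x w) y + 2 * h x (W x) (Γ x w y))) / (2 * h x (W x) y ^ 2)) •
        covDeriv Γ W x y
      - (h x y y / (2 * h x (W x) y)) • fderiv ℝ (covDeriv Γ W) x w y := by
  have hx := hq.1
  have hB : h x (W x) y ≠ 0 := hq.2.ne'
  have hS := differentiableAt_of_contDiffOn hh.isOpen (contDiffOn_covDeriv hh hΓ hW.smooth) hx
  refine fderiv_eq_of_hasDerivAt_line ((jointSmooth_killingSpray hh hW hΓ).differentiableAt_fst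
    (isOpen_coneBundle hh hW) hq) ?_
  have cy := hasDerivAt_const_smooth y
  refine ((((hasDerivAt_line (hΓ.differentiableAt hh hx) w).clm_apply cy).clm_apply cy).fun_sub
    (((hasDerivAt_norm_fst (hh.differentiableAt hx) w y).fun_div
      ((hasDerivAt_form_fst hh hW hΓ hx w y).const_mul 2)
      (by simpa using hB)).fun_smul ((hasDerivAt_line hS w).clm_apply cy))).congr_deriv ?_
  simp only [zero_smul, add_zero, map_zero, hΓ.compat x hx]
  rw [hh.symm x hx (Γ x w y) y]
  have e : ((2 * h x y (Γ x w y) + 2 * h x y (Γ x w y)) * (2 * h x (W x) y) - h x y y *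
      (2 * (h x (covDeriv Γ W x w) y + 2 * h x (W x) (Γ x w y)))) / (2 * h x (W x) y) ^ 2 =
      (4 * h x y (Γ x w y) * h x (W x) y - h x y y *
          (h x (covDeriv Γ W x w) y + 2 * h x (W x) (Γ x w y))) / (2 * h x (W x) y ^ 2) := by
    field_simp; ring
  rw [e]
  module

/-- The derivative of `killingConnection` in the direction variable, at unit vectors `y` and for
vectors `w` tangent to the indicatrix. -/
theorem fderiv_killingConnection_snd (hq : (x, y) ∈ coneBundle U h W) (hy : h x y y = h x (W x) y)
    {w : Model n} (hw : h x (W x) w = 2 * h x y w) (u : Model n) :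
    fderiv ℝ (fun η => fderiv ℝ (killingSpray h Γ W x) η w) y u = Γ x w u + Γ x u w
      - ((2 * h x u w * h x (W x) y + 2 * h x y w * h x (W x) u - 2 * h x y u * h x (W x) w)
          / (2 * h x (W x) y ^ 2)) • covDeriv Γ W x y
      - ((2 * h x y u - h x (W x) u) / (2 * h x (W x) y)) • covDeriv Γ W x w := by
  have hB : h x (W x) y ≠ 0 := hq.2.ne'
  have hΩ := isOpen_coneBundle hh hW
  have hs := jointSmooth_killingSpray hh hW hΓ
  have hd := (hs.partial_snd hΩ w).differentiableAt_snd hΩ hq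
  have hd' := hd.congr_of_eventuallyEq ((slice_snd_mem_nhds hΩ hq).mono fun z hz =>
    (fderiv_killingSpray_snd hh hW hΓ hz w).symm)
  rw [fderiv_snd_congr (G := fun x η => fderiv ℝ (killingSpray h Γ W x) η w)
    (G' := fun x y => killingConnection h Γ W x y w) hΩ hq
    (fun q hq => fderiv_killingSpray_snd hh hW hΓ hq w)]
  have dy := hasDerivAt_line_id y u
  have dA := hasDerivAt_norm_snd (h x) y u
  have dB := hasDerivAt_clm_snd (h x (W x)) y u
  have dyw := ((hasDerivAt_const_smooth (h x)).clm_apply dy).clm_apply (hasDerivAt_const_smooth w)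
  have d1 := (hasDerivAt_clm_snd (Γ x w) y u).fun_add
    (((hasDerivAt_const_smooth (Γ x)).clm_apply dy).clm_apply (hasDerivAt_const_smooth w))
  have d2 := ((((dyw.const_mul 2).fun_mul dB).fun_sub (dA.mul_const (h x (W x) w))).fun_div
    ((dB.fun_pow 2).const_mul 2) (by simpa using hB)).fun_smul
      (hasDerivAt_clm_snd (covDeriv Γ W x) y u)
  have d3 := (dA.fun_div (dB.const_mul 2) (by simpa using hB)).smul_const (covDeriv Γ W x w)
  refine fderiv_eq_of_hasDerivAt_line hd' (((d1.fun_sub d2).fun_sub d3).congr_deriv ?_)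
  simp only [zero_smul, add_zero, map_zero, zero_apply, zero_add]
  rw [hh.symm x hq.1 u y, hy, hw]
  -- The coefficient of Sy vanishes at a point of the indicatrix for tangent w, so only the
  -- derivative of its numerator contributes and the quotient rule stays short.
  have e1 : (2 * h x y w * h x (W x) y - h x (W x) y * (2 * h x y w)) / (2 * h x (W x) y ^ 2)
      = 0 := by rw [div_eq_zero_iff]; left; ring
  have e2 : (((2 * h x u w) * h x (W x) y + 2 * h x y w * h x (W x) u
      - (h x y u + h x y u) * (2 * h x y w)) * (2 * h x (W x) y ^ 2)
      - (2 * h x y w * h x (W x) y - h x (W x) y * (2 * h x y w)) *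
        (2 * ((2 : ℕ) * h x (W x) y ^ (2 - 1) * h x (W x) u))) / (2 * h x (W x) y ^ 2) ^ 2 =
      (2 * h x u w * h x (W x) y + 2 * h x y w * h x (W x) u - 2 * h x y u * (2 * h x y w))
          / (2 * h x (W x) y ^ 2) := by
    push_cast; field_simp; ring
  have e3 : ((h x y u + h x y u) * (2 * h x (W x) y) - h x (W x) y * (2 * h x (W x) u))
      / (2 * h x (W x) y) ^ 2 = (2 * h x y u - h x (W x) u) / (2 * h x (W x) y) := by
    field_simp; ring
  rw [e1, e2, e3]
  module

/-- The derivative of `killingConnection` in the position variable, at unit vectors `y` and for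
vectors `w` tangent to the indicatrix. -/
theorem fderiv_killingConnection_fst (hq : (x, y) ∈ coneBundle U h W) (hy : h x y y = h x (W x) y)
    {w : Model n} (hw : h x (W x) w = 2 * h x y w) (u : Model n) :
    fderiv ℝ (fun z => fderiv ℝ (killingSpray h Γ W z) y w) x u =
      fderiv ℝ Γ x u w y + fderiv ℝ Γ x u y w
      - ((4 * (h x (Γ x u y) w + h x y (Γ x u w)) * h x (W x) y
          + 2 * h x y w * (h x (covDeriv Γ W x u) y + 2 * h x (W x) (Γ x u y))
          - 4 * h x y (Γ x u y) * h x (W x) w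
          - h x (W x) y * (h x (covDeriv Γ W x u) w + 2 * h x (W x) (Γ x u w)))
          / (2 * h x (W x) y ^ 2)) • covDeriv Γ W x y
      - ((4 * h x y (Γ x u y) - (h x (covDeriv Γ W x u) y + 2 * h x (W x) (Γ x u y)))
          / (2 * h x (W x) y)) • covDeriv Γ W x w
      - (1 / 2 : ℝ) • fderiv ℝ (covDeriv Γ W) x u w := by
  have hx := hq.1
  have hB : h x (W x) y ≠ 0 := hq.2.ne'
  have hΩ := isOpen_coneBundle hh hW
  have hs := jointSmooth_killingSpray hh hW hΓ
  have hS := differentiableAt_of_contDiffOn hh.isOpen (contDiffOn_covDeriv hh hΓ hW.smooth) hx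
  have hd := (hs.partial_snd hΩ w).differentiableAt_fst hΩ hq
  have hd' := hd.congr_of_eventuallyEq ((slice_fst_mem_nhds hΩ hq).mono fun z hz =>
    (fderiv_killingSpray_snd hh hW hΓ hz w).symm)
  rw [fderiv_fst_congr (G := fun x η => fderiv ℝ (killingSpray h Γ W x) η w)
    (G' := fun x y => killingConnection h Γ W x y w) hΩ hq
    (fun q hq => fderiv_killingSpray_snd hh hW hΓ hq w)]
  have cy := hasDerivAt_const_smooth y
  have cw := hasDerivAt_const_smooth w
  have dΓ := hasDerivAt_line (hΓ.differentiableAt hh hx) u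
  have dS := hasDerivAt_line hS u
  have dA := hasDerivAt_norm_fst (hh.differentiableAt hx) u y
  have dB := hasDerivAt_form_fst hh hW hΓ hx u y
  have dBw := hasDerivAt_form_fst hh hW hΓ hx u w
  have dyw := ((hasDerivAt_line (hh.differentiableAt hx) u).clm_apply cy).clm_apply cw
  refine fderiv_eq_of_hasDerivAt_line hd' ((((((dΓ.clm_apply cw).clm_apply cy).fun_add
    ((dΓ.clm_apply cy).clm_apply cw)).fun_sub
    (((((dyw.const_mul 2).fun_mul dB).fun_sub (dA.fun_mul dBw)).fun_div
      ((dB.fun_pow 2).const_mul 2) (by simpa using hB)).fun_smul (dS.clm_apply cy))).fun_sub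
    ((dA.fun_div (dB.const_mul 2) (by simpa using hB)).fun_smul (dS.clm_apply cw))).congr_deriv ?_)
  simp only [zero_smul, add_zero, map_zero, hΓ.compat x hx]
  rw [hh.symm x hx (Γ x u y) y, hy, hw]
  set Q := h x (covDeriv Γ W x u) y + 2 * h x (W x) (Γ x u y)
  set Q' := h x (covDeriv Γ W x u) w + 2 * h x (W x) (Γ x u w)
  have e1 : (2 * h x y w * h x (W x) y - h x (W x) y * (2 * h x y w)) / (2 * h x (W x) y ^ 2)
      = 0 := by rw [div_eq_zero_iff]; left; ring
  have e2 : ((2 * (2 * h x (Γ x u y) w + 2 * h x y (Γ x u w)) * h x (W x) y + 2 * h x y w * Q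
      - ((2 * h x y (Γ x u y) + 2 * h x y (Γ x u y)) * (2 * h x y w) + h x (W x) y * Q')) *
        (2 * h x (W x) y ^ 2)
      - (2 * h x y w * h x (W x) y - h x (W x) y * (2 * h x y w)) *
        (2 * ((2 : ℕ) * h x (W x) y ^ (2 - 1) * Q))) / (2 * h x (W x) y ^ 2) ^ 2 =
      (4 * (h x (Γ x u y) w + h x y (Γ x u w)) * h x (W x) y
          + 2 * h x y w * Q - 4 * h x y (Γ x u y) * (2 * h x y w) - h x (W x) y * Q')
          / (2 * h x (W x) y ^ 2) := by
    push_cast; field_simp; ring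
  have e3 : ((2 * h x y (Γ x u y) + 2 * h x y (Γ x u y)) * (2 * h x (W x) y)
      - h x (W x) y * (2 * Q)) / (2 * h x (W x) y) ^ 2 =
      (4 * h x y (Γ x u y) - Q) / (2 * h x (W x) y) := by
    field_simp; ring
  have e4 : h x (W x) y / (2 * h x (W x) y) = 1 / 2 := by field_simp
  rw [e1, e2, e3, e4]
  module

variable (hK : ∀ x ∈ U, ∀ v w, h x (covDeriv Γ W x v) w = -h x v (covDeriv Γ W x w))
  (hF : ∀ q ∈ coneBundle U h W,
    energy F q.1 q.2 = (h q.1 q.2 q.2) ^ 2 / (h q.1 (W q.1) q.2) ^ 2)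
include hK hF

/-- For Killing W the skew part of ∇W is ∇W itself and r₀₀ = 0; also h(Sy,W) = 0 since |W| = 1. Of
the general spray only the term with Sy survives besides Γ(y,y). -/
theorem spray_kropina_killing (hq : (x, y) ∈ coneBundle U h W) (i : Fin n) :
    spray F i x y = killingSpray h Γ W x y i := by
  have hx := hq.1
  have hZ : ∀ x ∈ U, ∀ u v, h x (covDeriv Γ W x u) v =
      (1 / 2) * (h x (covDeriv Γ W x u) v - h x (covDeriv Γ W x v) u) := by
    intro x hx u v
    have := hK x hx v u
    rw [hh.symm x hx v] at this
    linarith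
  have h0 : h x (covDeriv Γ W x y) y = 0 := by
    have := hK x hx y y
    rw [hh.symm x hx y] at this
    linarith
  rw [spray_kropina hh hW hF hΓ hZ hq, kropinaSpray, killingSpray,
    metric_covDeriv_unit hh hΓ hW.smooth hW.unit hx, h0]
  simp

/-- The Riemann curvature of a Kropina metric whose unit form is Killing. -/
theorem riemannVec_kropina_killing (hq : (x, y) ∈ coneBundle U h W)
    (hy : h x y y = h x (W x) y) {w : Model n} (hw : h x (W x) w = 2 * h x y w) :
    riemannVec F x y w = curv Γ x w y y + curv Γ x (W x) w y
      - (1 / 2 : ℝ) • curv Γ x (W x) y w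
      - (1 / 4 : ℝ) • covDeriv Γ W x (covDeriv Γ W x w) := by
  have hx := hq.1
  have hB : h x (W x) y ≠ 0 := hq.2.ne'
  have hsy := hh.symm x hx
  rw [riemannVec_eq (isOpen_coneBundle hh hW) (jointSmooth_killingSpray hh hW hΓ)
    (fun q hq i => spray_kropina_killing hh hW hΓ hK hF hq i) hq,
    fderiv_killingSpray_fst hh hW hΓ hq, fderiv_killingConnection_fst hh hW hΓ hq hy hw,
    fderiv_killingConnection_snd hh hW hΓ hq hy hw, fderiv_killingSpray_snd hh hW hΓ hq,
    fderiv_killingSpray_snd hh hW hΓ hq]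
  -- The Killing identity replaces second derivatives of W by curvature.
  have d1 : ∀ u v, fderiv ℝ (covDeriv Γ W) x u v = -curv Γ x (W x) u v
      - (2 : ℝ) • Γ x u (covDeriv Γ W x v) + (2 : ℝ) • covDeriv Γ W x (Γ x u v) := by
    intro u v
    rw [← covDerivEnd_killing hh hΓ hW.smooth hK hx, covDerivEnd]; module
  have hSy : h x (covDeriv Γ W x y) y = 0 := by
    have := hK x hx y y
    rw [hsy y] at this
    linarith
  have hSu : ∀ u, h x (W x) (covDeriv Γ W x u) = 0 := fun u => by
    rw [hsy]; exact metric_covDeriv_unit hh hΓ hW.smooth hW.unit hx u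
  have e0 : (2 * h x y w * h x (W x) y - h x (W x) y * (2 * h x y w)) / (2 * h x (W x) y ^ 2)
      = 0 := by rw [div_eq_zero_iff]; left; ring
  have e4 : h x (W x) y / (2 * h x (W x) y) = 1 / 2 := by field_simp
  simp only [killingSpray, killingConnection, d1, hy, hw, e0, e4, hSy]
  simp only [hΓ.symm x hx y w, zero_smul, sub_zero, map_add, map_sub, map_smul, add_apply,
    sub_apply, smul_apply, smul_eq_mul, hSu, hsy y (covDeriv Γ W x y), hSy, mul_zero, sub_zero,
    zero_add]
  have hKw : h x (covDeriv Γ W x y) w = -h x y (covDeriv Γ W x w) := hK x hx y w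
  have hSwy : h x (covDeriv Γ W x w) y = h x y (covDeriv Γ W x w) := hsy _ _
  have hG : h x (Γ x y y) w = h x w (Γ x y y) := hsy _ _
  rw [hKw, hSwy, hG]
  have hs : fderiv ℝ Γ x y y w = fderiv ℝ Γ x y w y := hΓ.fderiv_symm hh hx y y w
  have hs2 : Γ x (Γ x y y) w = Γ x w (Γ x y y) := hΓ.symm x hx _ _
  have hs3 : Γ x (Γ x w y) y = Γ x y (Γ x w y) := hΓ.symm x hx _ _
  have hs4 : Γ x (covDeriv Γ W x y) w = Γ x w (covDeriv Γ W x y) := hΓ.symm x hx _ _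
  have hs5 : Γ x (covDeriv Γ W x w) y = Γ x y (covDeriv Γ W x w) := hΓ.symm x hx _ _
  have hs6 : curv Γ x w y y = (2 : ℝ) • fderiv ℝ Γ x w y y - (2 : ℝ) • fderiv ℝ Γ x y w y
    + (4 : ℝ) • Γ x w (Γ x y y) - (4 : ℝ) • Γ x y (Γ x w y) := rfl
  rw [hs, hs2, hs3, hs4, hs5, hs6]
  generalize h x (W x) y = B at hB ⊢
  generalize h x y (Γ x w y) = t1
  generalize h x y (covDeriv Γ W x w) = t2
  generalize h x (W x) (Γ x w y) = t3
  generalize h x w (Γ x y y) = t4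
  generalize h x y w = t5
  generalize h x (W x) (Γ x y y) = t6
  generalize h x y (Γ x y y) = t7
  -- The non-tensorial scalar coefficients of Sy match here, and those of Sw in `c2`, so that only
  -- curvature and S² remain.
  have c1 : (4 * (t4 + t1) * B + 2 * t5 * (2 * t6) - 4 * t7 * (2 * t5) - B * (-t2 + 2 * t3)) /
      (2 * B ^ 2) = 2 * ((4 * t1 * B - B * (t2 + 2 * t3)) / (2 * B ^ 2)) +
      2 * ((2 * (t4 - 1 / 2 * -t2) * B + 2 * t5 * t6 - 2 * t7 * (2 * t5)) / (2 * B ^ 2)) -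
      (2 * (t1 + t1 - 1 / 2 * t2) * B - B * (t3 + t3)) / (2 * B ^ 2) := by
    field_simp; ring
  have c2 : (4 * t7 - 2 * t6) / (2 * B) = 2 * ((2 * t7 - t6) / (2 * B)) := by
    field_simp; ring
  rw [c1, c2]
  module

end KillingKropina

theorem curv_self {E : Type*} [NormedAddCommGroup E] [NormedSpace ℝ E]
    (Γ : E → E →L[ℝ] E →L[ℝ] E) (x u z : E) : curv Γ x u u z = 0 := by
  unfold curv; module

/-! ### Constant flag curvature forces constant sectional curvature. -/

section ConstantFlag

variable {n : ℕ} {U : Set (Model n)} {h : Model n → Model n →L[ℝ] Model n →L[ℝ] ℝ}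
  {Γ : Model n → Model n →L[ℝ] Model n →L[ℝ] Model n} {W : Model n → Model n} {x y : Model n}
  {F : Model n → Model n → ℝ}
  (hh : IsMetric U h) (hW : IsUnitField U h W) (hΓ : IsChristoffel U h Γ)
include hh hΓ

/-- The constancy of the sectional curvature in the sense of `flagCurvature`. -/
theorem flagCurvature_riemannian (hF : ∀ x ∈ U, ∀ y, energy F x y = h x y y) (hx : x ∈ U) {μ : ℝ}
    (hc : ∀ u v z, curv Γ x u v z = μ • (h x v z • u - h x u z • v)) (hy : y ≠ 0) {w : Model n}
    (hw : LinearIndependent ℝ ![y, w]) : flagCurvature F x y w = μ := by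
  have hg := fundForm_riemannian hh hF hx
  have hd := flag_denominator_pos (F := F) (x := x) (y := y)
    (fun v w => by rw [hg, hg, hh.symm x hx]) (fun w hw => by rw [hg]; exact hh.pos x hx w hw) hy hw
  rw [flagCurvature, div_eq_iff hd.ne', riemannVec_riemannian hh hF hΓ hx, hg, hg, hg, hg, hc,
    map_smul, map_sub, map_smul, map_smul]
  simp only [smul_apply, sub_apply, smul_eq_mul]
  rw [hh.symm x hx w y]
  ring

include hW
variable (hK : ∀ x ∈ U, ∀ v w, h x (covDeriv Γ W x v) w = -h x v (covDeriv Γ W x w))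
  (hF : ∀ q ∈ coneBundle U h W,
    energy F q.1 q.2 = (h q.1 q.2 q.2) ^ 2 / (h q.1 (W q.1) q.2) ^ 2)
include hK hF

/-- The point y = (W + e)/2 lies on the indicatrix, and w orthogonal to e means tangent to the
indicatrix at y. There the Finsler curvature of w is R(w,e)e/4, and the fundamental form of a pair
in which w occurs is the corresponding h-product up to a common factor. The case e = -W is excluded
because it would give y = 0. -/
theorem sectional_of_flag_unit (hn : 2 ≤ n) (hx : x ∈ U) {κ : ℝ}
    (hflag : ∀ y w, 0 < h x (W x) y → LinearIndependent ℝ ![y, w] → flagCurvature F x y w = κ)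
    {e w : Model n} (he : h x e e = 1) (heW : e ≠ -W x) (hw : h x w e = 0) :
    h x (curv Γ x w e e) w = 4 * κ * h x w w := by
  have hs := hh.symm x hx
  have hWW := hW.unit x hx
  have hc : 0 < h x (W x + e) (W x + e) :=
    hh.pos x hx _ fun h0 => heW (eq_neg_of_add_eq_zero_right h0)
  simp only [map_add, add_apply, hs e (W x), hWW, he] at hc
  set y : Model n := (1 / 2 : ℝ) • (W x + e) with hy
  have hB : h x (W x) y = (1 + h x (W x) e) / 2 := by
    simp only [hy, map_smul, map_add, hWW, smul_eq_mul]; ring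
  have hyB : h x y y = h x (W x) y := by
    rw [hB]
    simp only [hy, map_smul, map_add, hWW, smul_eq_mul, smul_apply, add_apply, hs e (W x), he]
    ring
  have hq : (x, y) ∈ coneBundle U h W := ⟨hx, by simp only [hB]; linarith⟩
  have hyw : h x (W x) w = 2 * h x y w := by
    simp only [hy, map_smul, map_add, smul_eq_mul, smul_apply, add_apply, hs e w, hw]; ring
  have hy0 : y ≠ 0 := by
    rintro h0
    have := hq.2
    simp [h0] at this
  have hg := fundForm_kropina hh hW hF hq
  have key := fundForm_riemannVec_of_flag (F := F) (x := x) (y := y)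
    (fun v w => by rw [hg, hg, hs v w]; simp only [kropinaTensor]; ring)
    (fun w hw => fundForm_kropina_pos hh hW hF hq hw) hn hy0
    (fun w hw => hflag y w hq.2 hw) w
  -- Insert y = (W + e)/2 and S²w = R(W,w)W. One Bianchi identity for w, W, e removes every term
  -- containing W.
  have hR : riemannVec F x y w = (1 / 4 : ℝ) • curv Γ x w e e := by
    rw [riemannVec_kropina_killing hh hW hΓ hK hF hq hyB hyw,
      covDeriv_covDeriv_unit hh hΓ hW.smooth hW.unit hK hx]
    have hb := curv_bianchi hh hΓ hx w (W x) e
    have hsw := curv_swap Γ x (W x) w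
    simp only [hy, curv_add_snd, curv_smul_snd, curv_add_trd, curv_smul_trd, hsw, curv_self]
    rw [curv_swap Γ x e w] at hb
    linear_combination (norm := module) (-1 / 4 : ℝ) • hb
  have hre : h x (curv Γ x w e e) e = 0 := by
    have := metric_curv_skew hh hΓ hx w e e e
    linarith
  have hry : h x (W x) (curv Γ x w e e) = 2 * h x (curv Γ x w e e) y := by
    simp only [hy, map_smul, map_add, hre, smul_eq_mul, hs _ (W x)]; ring
  have hwy := hs w y
  have hB0 : h x (W x) y ≠ 0 := hq.2.ne'
  rw [hR, fundForm_smul_left, hg, hg, hg, hg] at key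
  simp only [kropinaTensor, hyB, hry, hyw, hwy] at key
  field_simp at key
  refine mul_left_cancel₀ hB0 ?_
  linear_combination key / 2

/-- R(w,e)e is even in e, so the missing direction e = -W follows from e = W. Scaling and
subtracting the component of w along e then give all sectional curvatures. -/
theorem curv_of_const_flag (hn : 2 ≤ n) (hx : x ∈ U) {κ : ℝ}
    (hflag : ∀ y w, 0 < h x (W x) y → LinearIndependent ℝ ![y, w] → flagCurvature F x y w = κ)
    (u v z : Model n) :
    curv Γ x u v z = (4 * κ) • (h x v z • u - h x u z • v) := by
  have hs := hh.symm x hx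
  have hWW := hW.unit x hx
  have unit : ∀ e w, h x e e = 1 → h x w e = 0 → h x (curv Γ x w e e) w = 4 * κ * h x w w := by
    intro e w he hw
    by_cases heW : e = -W x
    · have h1 : W x ≠ -W x := by
        intro h0
        have := congrArg (h x (W x)) h0
        rw [map_neg, hWW] at this
        norm_num at this
      have h2 := sectional_of_flag_unit hh hW hΓ hK hF hn hx hflag hWW h1 (w := w)
        (by simpa [heW] using hw)
      rw [← h2, heW, ← neg_one_smul ℝ (W x), curv_smul_snd, curv_smul_trd, smul_smul]
      norm_num
    · exact sectional_of_flag_unit hh hW hΓ hK hF hn hx hflag he heW hw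
  refine curv_eq_of_const_sectional hh hΓ hx (fun y w => ?_) u v z
  by_cases hy : y = 0
  · subst hy
    have : curv Γ x w 0 0 = 0 := by
      have := curv_smul_snd Γ x 0 w 0 0
      simpa using this
    simp [this]
  have hA := hh.pos x hx y hy
  set s := Real.sqrt (h x y y) with hs'
  have hs2 : s ^ 2 = h x y y := Real.sq_sqrt hA.le
  have hs0 : s ≠ 0 := by
    intro h0
    rw [h0] at hs2
    simp at hs2
    linarith
  set e : Model n := s⁻¹ • y with he
  have hye : y = s • e := by rw [he, smul_smul, mul_inv_cancel₀ hs0, one_smul]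
  have hee : h x e e = 1 := by
    simp only [he, map_smul, smul_apply, smul_eq_mul, ← hs2]
    field_simp
  set c := h x w e with hc
  -- Replacing w by its component orthogonal to e changes nothing in R(w,e)e, since R(e,e) = 0.
  have h3 := unit e (w + (-c) • e) hee (by simp only [map_add, map_smul, add_apply, smul_apply, smul_eq_mul, hee]; ring)
  have h0 : curv Γ x e e e = 0 := curv_self Γ x e e
  have hre : h x (curv Γ x w e e) e = 0 := by
    have := metric_curv_skew hh hΓ hx w e e e
    linarith
  rw [curv_add_fst, curv_smul_fst, h0, smul_zero, add_zero] at h3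
  simp only [map_add, map_smul, add_apply, smul_apply, smul_eq_mul, hee, hre, hs e w] at h3
  rw [hye, curv_smul_snd, curv_smul_trd]
  simp only [map_smul, smul_apply, smul_eq_mul, hee, hs e w, ← hc] at h3 ⊢
  linear_combination s ^ 2 * h3

end ConstantFlag

/-! ### Local parallel sections of flat linear connections. -/

section Frobenius

section Instances

variable {E F G : Type*} [NormedAddCommGroup E] [NormedSpace ℝ E] [NormedAddCommGroup F]
  [NormedSpace ℝ F] [NormedAddCommGroup G] [NormedSpace ℝ G]

instance normedAddCommGroupMixedBilinear : NormedAddCommGroup (E →L[ℝ] F →L[ℝ] G) := inferInstance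

instance normedSpaceMixedBilinear : NormedSpace ℝ (E →L[ℝ] F →L[ℝ] G) := inferInstance

end Instances

open Metric

variable {E F : Type*} [NormedAddCommGroup E] [NormedSpace ℝ E]
  [NormedAddCommGroup F] [NormedSpace ℝ F] {A : E → E →L[ℝ] F →L[ℝ] F}

/-- Local bounds for a smooth map and its derivatives. -/
theorem exists_local_bounds {G : Type*} [NormedAddCommGroup G] [NormedSpace ℝ G] {U : Set E}
    (hU : IsOpen U) (h0 : (0 : E) ∈ U) {f : E → G} (hf : ContDiffOn ℝ ∞ f U) :
    ∃ C ε : ℝ, 1 ≤ C ∧ 0 < ε ∧ ball 0 ε ⊆ U ∧ (∀ x ∈ ball (0 : E) ε, ‖f x‖ ≤ C) ∧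
      ∀ a ∈ ball (0 : E) ε, ∀ b ∈ ball (0 : E) ε, ‖f b - f a‖ ≤ C * ‖b - a‖ ∧
        ‖f b - f a - fderiv ℝ f a (b - a)‖ ≤ C * ‖b - a‖ * ‖b - a‖ := by
  have h1 := contDiffOn_fderiv hU hf
  have h2 := contDiffOn_fderiv hU h1
  have hall := ((hU.eventually_mem h0).and
    ((((hf.continuousOn.continuousAt (hU.mem_nhds h0)).norm.eventually_le_const
      (lt_add_one _))).and
    ((((h1.continuousOn.continuousAt (hU.mem_nhds h0)).norm.eventually_le_const
      (lt_add_one _))).and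
    (((h2.continuousOn.continuousAt (hU.mem_nhds h0)).norm.eventually_le_const
      (lt_add_one _))))))
  obtain ⟨ε, hε, hb⟩ := Metric.eventually_nhds_iff_ball.1 hall
  set C := 1 + (‖f 0‖ + 1) + (‖fderiv ℝ f 0‖ + 1) + (‖fderiv ℝ (fderiv ℝ f) 0‖ + 1) with hC
  have n1 := norm_nonneg (f 0)
  have n2 := norm_nonneg (fderiv ℝ f 0)
  have n3 := norm_nonneg (fderiv ℝ (fderiv ℝ f) 0)
  have hconv := convex_ball (0 : E) ε
  have hd : ∀ x ∈ ball (0 : E) ε, DifferentiableAt ℝ f x := fun x hx =>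
    differentiableAt_of_contDiffOn hU hf (hb x hx).1
  have hlip1 : ∀ a ∈ ball (0 : E) ε, ∀ b ∈ ball (0 : E) ε,
      ‖fderiv ℝ f b - fderiv ℝ f a‖ ≤ C * ‖b - a‖ := fun a ha b hb' => by
    refine hconv.norm_image_sub_le_of_norm_fderiv_le (𝕜 := ℝ)
      (fun x hx => differentiableAt_of_contDiffOn hU h1 (hb x hx).1) (fun x hx => ?_) ha hb'
    linarith [(hb x hx).2.2.2]
  have hb1 : ∀ x ∈ ball (0 : E) ε, ‖fderiv ℝ f x‖ ≤ C := fun x hx => by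
    linarith [(hb x hx).2.2.1]
  refine ⟨C, ε, by linarith, hε, fun x hx => (hb x hx).1, fun x hx => ?_, fun a ha b hb' =>
    ⟨hconv.norm_image_sub_le_of_norm_fderiv_le (𝕜 := ℝ) hd hb1 ha hb', ?_⟩⟩
  · linarith [(hb x hx).2.1]
  · refine (convex_segment a b).norm_image_sub_le_of_norm_fderiv_le' (𝕜 := ℝ)
      (fun z hz => hd z (hconv.segment_subset ha hb' hz)) (fun z hz => ?_)
      (left_mem_segment ℝ a b) (right_mem_segment ℝ a b)
    refine (hlip1 a ha z (hconv.segment_subset ha hb' hz)).trans ?_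
    gcongr
    exact norm_sub_le_of_mem_segment hz

/-- Solutions of a linear differential equation along rays from the origin. -/
theorem exists_radial_solution [CompleteSpace F] {ε C R : ℝ} (hC : 0 ≤ C)
    (hA : ∀ x ∈ ball (0 : E) ε, ‖A x‖ ≤ C) (hc : ContinuousOn A (ball 0 ε))
    (hε : C * ε * (R + 1) ≤ 1) {y₀ : F} (hy : ‖y₀‖ ≤ R) {x : E} (hx : x ∈ ball (0 : E) ε) :
    ∃ y : ℝ → F, y 0 = y₀ ∧
      ∀ t ∈ Icc (0 : ℝ) 1, HasDerivWithinAt y (A (t • x) x (y t)) (Icc 0 1) t := by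
  have hxε : ‖x‖ ≤ ε := (mem_ball_zero_iff.1 hx).le
  have hmem : ∀ t ∈ Icc (0 : ℝ) 1, t • x ∈ ball (0 : E) ε := fun t ht =>
    (convex_ball (0 : E) ε).smul_mem_of_zero_mem (mem_ball_self (pos_of_mem_ball hx)) hx ht
  have hε0 : 0 ≤ ε := (norm_nonneg x).trans hxε
  have hb : ∀ t ∈ Icc (0 : ℝ) 1, ‖A (t • x) x‖ ≤ C * ε := fun t ht =>
    ((A (t • x)).le_opNorm x).trans (mul_le_mul (hA _ (hmem t ht)) hxε (norm_nonneg _) hC)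
  -- On the unit ball around the initial value the field is bounded by Cε(R + 1) ≤ 1, so the
  -- solution cannot leave that ball before time one.
  have hpl : IsPicardLindelof (fun t y => A (t • x) x y) (⟨0, by simp⟩ : Icc (0 : ℝ) 1) y₀ 1 0 1
      ⟨C * ε, by positivity⟩ := by
    refine ⟨fun t ht => ?_, fun y _ => ?_, fun t ht y hy' => ?_, by simp⟩
    · refine (((A (t • x) x).lipschitz).weaken ?_).lipschitzOnWith
      exact hb t ht
    · have h1 : ContinuousOn (fun t : ℝ => A (t • x)) (Icc 0 1) :=
        hc.comp (by fun_prop) hmem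
      exact (h1.clm_apply continuousOn_const).clm_apply continuousOn_const
    · have h1 : ‖y‖ ≤ R + 1 := by
        have h2 : ‖y - y₀‖ ≤ 1 := by simpa [dist_eq_norm] using hy'
        have := norm_le_norm_add_norm_sub' y y₀
        linarith
      refine ((A (t • x) x).le_opNorm y).trans ?_
      refine (mul_le_mul (hb t ht) h1 (norm_nonneg _) (by positivity)).trans ?_
      simpa using hε
  exact hpl.exists_eq_forall_mem_Icc_hasDerivWithinAt₀

/-- Bounds the defect with which the first-order variation of a ray solution solves the equation on
the neighbouring ray. The defect is the Taylor remainder of A plus products of two small quantities,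
hence quadratic in v. -/
theorem dist_approximate_derivative_le {C M t : ℝ} (hC : 1 ≤ C) (ht : t ∈ Icc (0 : ℝ) 1)
    {a a' : E →L[ℝ] F →L[ℝ] F} {d : E →L[ℝ] E →L[ℝ] F →L[ℝ] F} {x v : E} {y : F}
    (hx : ‖x‖ ≤ 1) (hy : ‖y‖ ≤ M) (ha : ‖a‖ ≤ C) (ha' : ‖a'‖ ≤ C)
    (e1 : ‖a' - a - d (t • v)‖ ≤ C * ‖v‖ * ‖v‖) (e2 : ‖a' - a‖ ≤ C * ‖v‖) :
    dist (a x y + (t • (d v x y + a x (a v y)) + a v y)) (a' (x + v) (y + t • a v y)) ≤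
      4 * C ^ 2 * M * ‖v‖ ^ 2 := by
  have hC0 : 0 ≤ C := zero_le_one.trans hC
  have hM0 : 0 ≤ M := (norm_nonneg _).trans hy
  have key : a x y + (t • (d v x y + a x (a v y)) + a v y) - a' (x + v) (y + t • a v y) =
      -((a' - a - d (t • v)) x y + (a' - a) v y + (a' - a) x (t • a v y) + a' v (t • a v y)) := by
    simp only [map_add, map_smul, add_apply, sub_apply, smul_apply]
    module
  have bav : ‖t • a v y‖ ≤ C * ‖v‖ * M := by
    rw [norm_smul, Real.norm_of_nonneg ht.1]
    refine (mul_le_of_le_one_left (norm_nonneg _) ht.2).trans ?_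
    exact (a.le_opNorm₂ v y).trans (by gcongr)
  rw [dist_eq_norm, key, norm_neg]
  have n1 : ‖(a' - a - d (t • v)) x y‖ ≤ C * ‖v‖ * ‖v‖ * 1 * M :=
    (ContinuousLinearMap.le_opNorm₂ _ _ _).trans (by gcongr)
  have n2 : ‖(a' - a) v y‖ ≤ C * ‖v‖ * ‖v‖ * M :=
    (ContinuousLinearMap.le_opNorm₂ _ _ _).trans (by gcongr)
  have n3 : ‖(a' - a) x (t • a v y)‖ ≤ C * ‖v‖ * 1 * (C * ‖v‖ * M) :=
    (ContinuousLinearMap.le_opNorm₂ _ _ _).trans (by gcongr)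
  have n4 : ‖a' v (t • a v y)‖ ≤ C * ‖v‖ * (C * ‖v‖ * M) :=
    (ContinuousLinearMap.le_opNorm₂ _ _ _).trans (by gcongr)
  refine norm_add₄_le.trans ?_
  have hp : 0 ≤ C * M * ‖v‖ ^ 2 := by positivity
  nlinarith [mul_le_mul_of_nonneg_right hC hp]

/-- The value at time one of the radial solutions is differentiable when the equation is
integrable. -/
theorem norm_radial_sub_le {ε C : ℝ} (hε1 : ε ≤ 1) (hC : 1 ≤ C)
    (hd : ∀ x ∈ ball (0 : E) ε, DifferentiableAt ℝ A x)
    (hA : ∀ x ∈ ball (0 : E) ε, ‖A x‖ ≤ C) 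
    (htay : ∀ a ∈ ball (0 : E) ε, ∀ b ∈ ball (0 : E) ε, ‖A b - A a‖ ≤ C * ‖b - a‖ ∧
      ‖A b - A a - fderiv ℝ A a (b - a)‖ ≤ C * ‖b - a‖ * ‖b - a‖)
    (flat : ∀ x ∈ ball (0 : E) ε, ∀ u v y, fderiv ℝ A x u v y + A x v (A x u y) =
      fderiv ℝ A x v u y + A x u (A x v y))
    {x x' : E} (hx : x ∈ ball (0 : E) ε) (hx' : x' ∈ ball (0 : E) ε) {y y' : ℝ → F} {M : ℝ}
    (hy : ∀ t ∈ Icc (0 : ℝ) 1, HasDerivWithinAt y (A (t • x) x (y t)) (Icc 0 1) t)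
    (hy' : ∀ t ∈ Icc (0 : ℝ) 1, HasDerivWithinAt y' (A (t • x') x' (y' t)) (Icc 0 1) t)
    (h0 : y 0 = y' 0) (hM : ∀ t ∈ Icc (0 : ℝ) 1, ‖y t‖ ≤ M) :
    ‖y' 1 - y 1 - A x (x' - x) (y 1)‖ ≤ 4 * C ^ 2 * M * (Real.exp C / C) * ‖x' - x‖ ^ 2 := by
  have hconv := convex_ball (0 : E) ε
  have h00 : (0 : E) ∈ ball (0 : E) ε := mem_ball_self (pos_of_mem_ball hx)
  have hmem : ∀ t ∈ Icc (0 : ℝ) 1, ∀ z ∈ ball (0 : E) ε, t • z ∈ ball (0 : E) ε := fun t ht z hz =>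
    hconv.smul_mem_of_zero_mem h00 hz ht
  have hn : ∀ z ∈ ball (0 : E) ε, ‖z‖ ≤ 1 := fun z hz => (mem_ball_zero_iff.1 hz).le.trans hε1
  have hC0 : 0 ≤ C := zero_le_one.trans hC
  have hM0 : 0 ≤ M := (norm_nonneg _).trans (hM 0 (by simp))
  set v := x' - x with hv
  -- The expected value at tx' to first order: a parallel section changes by A(tx)(tv)y when tx
  -- moves by tv.
  set w : ℝ → F := fun t => y t + t • A (t • x) v (y t) with hw
  set w' : ℝ → F := fun t => A (t • x) x (y t) + (t • (fderiv ℝ A (t • x) x v (y t) +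
    A (t • x) v (A (t • x) x (y t))) + A (t • x) v (y t)) with hw'
  have hwd : ∀ t ∈ Icc (0 : ℝ) 1, HasDerivWithinAt w (w' t) (Icc 0 1) t := by
    intro t ht
    have h1 : HasDerivWithinAt (fun t : ℝ => A (t • x)) (fderiv ℝ A (t • x) x) (Icc 0 1) t := by
      have h2 : HasDerivAt (fun t : ℝ => t • x) x t := by
        simpa using (hasDerivAt_id t).smul_const x
      exact ((hd _ (hmem t ht x hx)).hasFDerivAt.comp_hasDerivAt t h2).hasDerivWithinAt
    have h3 := ((h1.clm_apply (hasDerivWithinAt_const t _ v)).clm_apply (hy t ht))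
    refine ((hy t ht).fun_add ((hasDerivWithinAt_id t _).fun_smul h3)).congr_deriv ?_
    simp [hw']
  have cont : ∀ {f f' : ℝ → F}, (∀ t ∈ Icc (0 : ℝ) 1, HasDerivWithinAt f (f' t) (Icc 0 1) t) →
      ContinuousOn f (Icc 0 1) := fun h t ht => (h t ht).continuousWithinAt
  have right : ∀ {f f' : ℝ → F}, (∀ t ∈ Icc (0 : ℝ) 1, HasDerivWithinAt f (f' t) (Icc 0 1) t) →
      ∀ t ∈ Ico (0 : ℝ) 1, HasDerivWithinAt f (f' t) (Ici t) t := fun h t ht =>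
    (h t (Ico_subset_Icc_self ht)).mono_of_mem_nhdsWithin (Icc_mem_nhdsGE_of_mem ht)
  have herr : ∀ t ∈ Icc (0 : ℝ) 1,
      dist (w' t) (A (t • x') x' (w t)) ≤ 4 * C ^ 2 * M * ‖v‖ ^ 2 := by
    intro t ht
    have hz := hmem t ht x hx
    have hz' := hmem t ht x' hx'
    have htv : t • x' - t • x = t • v := by rw [hv, smul_sub]
    have hnt : ‖t • v‖ ≤ ‖v‖ := by
      rw [norm_smul, Real.norm_of_nonneg ht.1]
      exact mul_le_of_le_one_left (norm_nonneg _) ht.2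
    have e1 : ‖A (t • x') - A (t • x) - fderiv ℝ A (t • x) (t • v)‖ ≤ C * ‖v‖ * ‖v‖ := by
      have := (htay _ hz _ hz').2
      rw [htv] at this
      exact this.trans (by gcongr)
    have e2 : ‖A (t • x') - A (t • x)‖ ≤ C * ‖v‖ := by
      have := (htay _ hz _ hz').1
      rw [htv] at this
      exact this.trans (by gcongr)
    -- Flatness exchanges x and v in the derivative of A, which brings w' into the form of the
    -- linearized equation on the ray through x'.
    have hfl := flat _ hz x v (y t)
    have hx'v : x' = x + v := by rw [hv]; abel
    simp only [hw, hw', hx'v, hfl]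
    rw [hx'v] at e1 e2
    exact dist_approximate_derivative_le hC ht (hn x hx) (hM t ht) (hA _ hz)
      (hx'v ▸ hA _ hz') e1 e2
  obtain ⟨K, hK⟩ : ∃ K : NNReal, (K : ℝ) = C := ⟨⟨C, hC0⟩, rfl⟩
  -- Grönwall compares the exact solution y' with the approximate one w. They start at the same
  -- point, and the defect is quadratic in v.
  have hgr := dist_le_of_approx_trajectories_ODE_of_mem (v := fun t z => A (t • x') x' z)
    (K := K) (s := fun _ => univ) (a := 0) (b := 1) (δ := 0) (εf := 0)
    (εg := 4 * C ^ 2 * M * ‖v‖ ^ 2) (f := y') (g := w)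
    (fun t ht => by
      refine (((A (t • x') x').lipschitz).weaken ?_).lipschitzOnWith
      refine NNReal.coe_le_coe.1 (hK ▸ show ‖A (t • x') x'‖ ≤ C from ((A (t • x')).le_opNorm x').trans ?_)
      have := mul_le_mul (hA _ (hmem t (Ico_subset_Icc_self ht) x' hx')) (hn x' hx')
        (norm_nonneg _) hC0
      simpa using this)
    (cont hy') (right hy') (fun t _ => by simp) (fun _ _ => trivial)
    (cont hwd) (right hwd) (fun t ht => herr t (Ico_subset_Icc_self ht)) (fun _ _ => trivial)
    (by simp [hw, h0]) 1 (by simp)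
  rw [zero_add, sub_zero, gronwallBound_of_K_ne_0 (by rw [hK]; exact (zero_lt_one.trans_le hC).ne'), hK] at hgr
  have hw1 : w 1 = y 1 + A x v (y 1) := by simp [hw]
  rw [dist_eq_norm, hw1, ← sub_sub] at hgr
  refine hgr.trans ?_
  simp only [zero_mul, mul_one, zero_add]
  have hC1 : 0 < C := zero_lt_one.trans_le hC
  have hp : 0 ≤ 4 * C ^ 2 * M * ‖v‖ ^ 2 / C := by positivity
  calc _ ≤ 4 * C ^ 2 * M * ‖v‖ ^ 2 / C * Real.exp C := by gcongr; linarith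
    _ = _ := by ring

/-- A flat linear connection near the origin has parallel sections with given value there. -/
theorem exists_parallel_zero [CompleteSpace F] {U : Set E} (hU : IsOpen U) (h0 : (0 : E) ∈ U)
    (hA : ContDiffOn ℝ ∞ A U) (flat : ∀ x ∈ U, ∀ u v y, fderiv ℝ A x u v y + A x v (A x u y) =
      fderiv ℝ A x v u y + A x u (A x v y)) {R : ℝ} (hR : 0 ≤ R) :
    ∃ ε, 0 < ε ∧ ball 0 ε ⊆ U ∧ ∀ y₀ : F, ‖y₀‖ ≤ R → ∃ Y : E → F, Y 0 = y₀ ∧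
      ∀ x ∈ ball (0 : E) ε, HasFDerivAt Y ((A x).flip (Y x)) x := by
  obtain ⟨C, ε₀, hC, hε₀, hsub, hb, htay⟩ := exists_local_bounds hU h0 hA
  have hC0 : 0 < C := zero_lt_one.trans_le hC
  -- The three bounds are for the local estimates, for |x| ≤ 1, and for existence of the ray
  -- solutions up to time one.
  set ε := min ε₀ (min 1 (1 / (C * (R + 1)))) with hε
  have hεpos : 0 < ε := lt_min hε₀ (lt_min one_pos (by positivity))
  have hε1 : ε ≤ 1 := (min_le_right _ _).trans (min_le_left _ _)
  have hss : ball (0 : E) ε ⊆ ball 0 ε₀ := ball_subset_ball (min_le_left _ _)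
  have hε2 : C * ε * (R + 1) ≤ 1 := by
    have h1 : ε ≤ 1 / (C * (R + 1)) := (min_le_right _ _).trans (min_le_right _ _)
    rw [le_div_iff₀ (by positivity)] at h1
    linarith
  refine ⟨ε, hεpos, hss.trans hsub, fun y₀ hy₀ => ?_⟩
  have hex := fun x (hx : x ∈ ball (0 : E) ε) => exists_radial_solution hC0.le
    (fun x hx => hb x (hss hx)) (hA.continuousOn.mono (hss.trans hsub)) hε2 hy₀ hx
  choose! y hy0 hy using hex
  have hmem0 : (0 : E) ∈ ball (0 : E) ε := mem_ball_self hεpos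
  refine ⟨fun x => y x 1, ?_, fun x hx => ?_⟩
  · have := constant_of_has_deriv_right_zero (f := y 0) (a := 0) (b := 1)
      (fun t ht => (hy 0 hmem0 t ht).continuousWithinAt) (fun t ht => by
        simpa using (hy 0 hmem0 t (Ico_subset_Icc_self ht)).mono_of_mem_nhdsWithin
          (Icc_mem_nhdsGE_of_mem ht)) 1 (by simp)
    exact this.trans (hy0 0 hmem0)
  · have hcont : ContinuousOn (y x) (Icc 0 1) := fun t ht => (hy x hx t ht).continuousWithinAt
    obtain ⟨M, hM⟩ := isCompact_Icc.exists_bound_of_continuousOn hcont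
    rw [hasFDerivAt_iff_isLittleO]
    have hO : (fun x' => y x' 1 - y x 1 - (A x).flip (y x 1) (x' - x)) =O[𝓝 x]
        fun x' => ‖x' - x‖ ^ 2 := by
      refine Asymptotics.IsBigO.of_bound (4 * C ^ 2 * M * (Real.exp C / C)) ?_
      filter_upwards [isOpen_ball.mem_nhds hx] with x' hx'
      rw [norm_pow, norm_norm]
      exact norm_radial_sub_le hε1 hC (fun x hx => differentiableAt_of_contDiffOn hU hA
        (hsub (hss hx))) (fun x hx => hb x (hss hx)) (fun a ha b hb => htay a (hss ha) b (hss hb))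
        (fun x hx => flat x (hsub (hss hx))) hx hx' (hy x hx) (hy x' hx')
        (by rw [hy0 x hx, hy0 x' hx']) hM
    refine hO.trans_isLittleO ?_
    have h1 : (fun z : E => ‖z‖ ^ 2) =o[𝓝 0] fun z => z :=
      Asymptotics.isLittleO_norm_pow_id one_lt_two
    have h2 : Filter.Tendsto (fun x' => x' - x) (𝓝 x) (𝓝 0) := by
      have : Filter.Tendsto (fun x' => x' - x) (𝓝 x) (𝓝 (x - x)) :=
        (continuous_id.sub continuous_const).tendsto x
      rwa [sub_self] at this
    exact h1.comp_tendsto h2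

/-- Solutions of a smooth linear total differential equation are smooth. -/
theorem contDiffOn_of_parallel {U : Set E} (hU : IsOpen U) (hA : ContDiffOn ℝ ∞ A U) {Y : E → F}
    (hY : ∀ x ∈ U, HasFDerivAt Y ((A x).flip (Y x)) x) : ContDiffOn ℝ ∞ Y U := by
  have hd : DifferentiableOn ℝ Y U := fun x hx => (hY x hx).differentiableAt.differentiableWithinAt
  rw [contDiffOn_infty]
  intro k
  -- Bootstrap: if Y is C^k, so is the right side of its equation, hence Y is C^(k+1).
  induction k with
  | zero => exact contDiffOn_zero.2 hd.continuousOn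
  | succ k ih =>
    have hk : ((k : ℕ) : WithTop ℕ∞) ≤ ∞ := by exact_mod_cast le_top
    have h1 : ContDiffOn ℝ k (fun x => (A x).flip (Y x)) U :=
      (((ContinuousLinearMap.flipₗᵢ ℝ E F F).toContinuousLinearEquiv.contDiff.comp_contDiffOn
        (hA.of_le hk))).clm_apply ih
    rw [show ((k + 1 : ℕ) : WithTop ℕ∞) = k + 1 by norm_cast]
    rw [contDiffOn_succ_iff_fderiv_of_isOpen hU]
    exact ⟨hd, by simp, h1.congr fun x hx => (hY x hx).fderiv⟩

/-- A flat linear connection has local parallel sections with given value at a point. -/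
theorem exists_parallel [CompleteSpace F] {U : Set E} (hU : IsOpen U) {p : E} (hp : p ∈ U)
    (hA : ContDiffOn ℝ ∞ A U) (flat : ∀ x ∈ U, ∀ u v y, fderiv ℝ A x u v y + A x v (A x u y) =
      fderiv ℝ A x v u y + A x u (A x v y)) {R : ℝ} (hR : 0 ≤ R) :
    ∃ ε, 0 < ε ∧ ball p ε ⊆ U ∧ ∀ y₀ : F, ‖y₀‖ ≤ R → ∃ Y : E → F, Y p = y₀ ∧
      ContDiffOn ℝ ∞ Y (ball p ε) ∧ ∀ x ∈ ball p ε, ∀ u, fderiv ℝ Y x u = A x u (Y x) := by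
  have hc : Continuous fun z : E => p + z := continuous_const.add continuous_id
  -- The radius is fixed before the initial value, uniformly for norms up to R, so that finitely
  -- many sections live on one ball.
  obtain ⟨ε, hε, hsub, H⟩ := exists_parallel_zero (A := fun z => A (p + z)) (hU.preimage hc)
    (show p + 0 ∈ U by simpa) (hA.comp (by fun_prop) fun x hx => hx)
    (fun x hx u v y => by
      rw [fderiv_comp_add_left]
      exact flat _ hx u v y) hR
  have hmem : ∀ x ∈ ball p ε, x - p ∈ ball (0 : E) ε := fun x hx => by
    simpa [dist_eq_norm] using hx
  have hsub' : ball p ε ⊆ U := fun x hx => by simpa using hsub (hmem x hx)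
  refine ⟨ε, hε, hsub', fun y₀ hy₀ => ?_⟩
  obtain ⟨Y, hY0, hY⟩ := H y₀ hy₀
  have hY' : ∀ x ∈ ball p ε, HasFDerivAt (fun x => Y (x - p)) ((A x).flip (Y (x - p))) x := by
    intro x hx
    have h1 := hY _ (hmem x hx)
    simp only [add_sub_cancel] at h1
    exact (h1.comp x ((hasFDerivAt_id x).sub_const p)).congr_fderiv
      (ContinuousLinearMap.comp_id _)
  refine ⟨fun x => Y (x - p), by simpa using hY0, contDiffOn_of_parallel isOpen_ball
    (hA.mono hsub') hY', fun x hx u => ?_⟩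
  rw [(hY' x hx).fderiv]
  rfl

end Frobenius

/-! ### Orthonormal frames and Parseval's identity. -/

section OrthonormalFrames

variable {n : ℕ} {H : Model n →L[ℝ] Model n →L[ℝ] ℝ}

theorem exists_orthonormal_frame (hs : ∀ v w, H v w = H w v)
    (hp : ∀ v, v ≠ 0 → 0 < H v v) :
    ∃ e : Fin n → Model n, ∀ i j, H (e i) (e j) = if i = j then 1 else 0 := by
  let B : LinearMap.BilinForm ℝ (Model n) :=
    LinearMap.mk₂ ℝ (fun v w => H v w) (by simp) (by simp) (by simp) (by simp)
  have hB : LinearMap.IsSymm B := ⟨fun v w => hs v w⟩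
  obtain ⟨b, hb⟩ := LinearMap.BilinForm.exists_orthogonal_basis hB
  have hcard : Module.finrank ℝ (Model n) = n := finrank_euclideanSpace_fin
  let b' := b.reindex (finCongr hcard)
  have hb' : ∀ i j, i ≠ j → H (b' i) (b' j) = 0 := by
    intro i j hij
    simp only [b', Module.Basis.reindex_apply]
    exact hb (fun h0 => hij ((finCongr hcard).symm.injective h0))
  have hpos : ∀ i, 0 < H (b' i) (b' i) := fun i => hp _ (b'.ne_zero i)
  refine ⟨fun i => (Real.sqrt (H (b' i) (b' i)))⁻¹ • b' i, fun i j => ?_⟩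
  simp only [map_smul, smul_apply, smul_eq_mul]
  split_ifs with hij
  · subst hij
    have h1 := Real.mul_self_sqrt (hpos i).le
    have h2 := (Real.sqrt_pos.2 (hpos i)).ne'
    field_simp
    linarith
  · rw [hb' i j hij]; simp

/-- Parseval's identity. -/
theorem sum_orthonormal_frame {e : Fin n → Model n}
    (he : ∀ i j, H (e i) (e j) = if i = j then 1 else 0) (v w : Model n) :
    ∑ i, H (e i) v * H (e i) w = H v w := by
  classical
  have hli : LinearIndependent ℝ e := by
    rw [Fintype.linearIndependent_iff]
    intro g hg i
    have := congrArg (H (e i)) hg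
    simpa [he] using this
  let b := basisOfLinearIndependentOfCardEqFinrank' e hli
    (by rw [finrank_euclideanSpace_fin, Fintype.card_fin])
  have hb : ∀ i, b i = e i := fun i => by simp [b]
  have hv : v = ∑ i, H (e i) v • e i := by
    have h1 := b.sum_repr v
    simp only [hb] at h1
    have h2 : ∀ i, H (e i) v = b.repr v i := by
      intro i
      conv_lhs => rw [← h1]
      simp [he]
    simp only [h2, h1]
  conv_rhs => rw [hv]
  simp

end OrthonormalFrames

/-! ### Stereographic coordinates on a space of constant curvature. -/

section ConstantCurvature

open Metric

variable {n : ℕ}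

/-- The algebra behind the conformally flat coordinates of a space of constant curvature. -/
theorem model_coordinates_algebra {H : Model n →L[ℝ] Model n →L[ℝ] ℝ} {μ : ℝ}
    (hs : ∀ v w, H v w = H w v) {u : Fin n → Model n} {u₀ : Model n} {f : Fin n → ℝ} {f₀ : ℝ}
    (hij : ∀ i j, H (u i) (u j) + μ * (f i * f j) = if i = j then 1 else 0)
    (hi0 : ∀ i, H (u i) u₀ + μ * (f i * f₀) = 0) (h00 : H u₀ u₀ + μ * (f₀ * f₀) = μ)
    (hμ : μ = 0 → f₀ = 1) (hf : 0 < 1 + f₀) :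
    1 + μ * ∑ i, (f i / (1 + f₀)) ^ 2 = 2 / (1 + f₀) ∧
    ∀ v w, ∑ i, ((H (u i) v * (1 + f₀) - f i * H u₀ v) / (1 + f₀) ^ 2) *
      ((H (u i) w * (1 + f₀) - f i * H u₀ w) / (1 + f₀) ^ 2) = H v w / (1 + f₀) ^ 2 := by
  have hf' := hf.ne'
  set e : Fin n → Model n := fun i => u i - (f i / (1 + f₀)) • u₀ with he
  have hee : ∀ i j, H (e i) (e j) = if i = j then 1 else 0 := by
    intro i j
    have h1 : H (u i) (u j) = (if i = j then 1 else 0) - μ * (f i * f j) := by linarith [hij i j]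
    have h2 : ∀ i, H (u i) u₀ = -(μ * (f i * f₀)) := fun i => by linarith [hi0 i]
    have h3 : H u₀ u₀ = μ - μ * (f₀ * f₀) := by linarith
    simp only [he, map_sub, map_smul, sub_apply, smul_apply, smul_eq_mul, h1, hs u₀ (u j), h2, h3]
    field_simp
    ring
  have hP := sum_orthonormal_frame hee
  have hev : ∀ i v, H (e i) v = (H (u i) v * (1 + f₀) - f i * H u₀ v) / (1 + f₀) := by
    intro i v
    simp only [he, map_sub, map_smul, sub_apply, smul_apply, smul_eq_mul]
    field_simp
  constructor
  -- For μ ≠ 0, Parseval for u₀ gives μ² ∑ f_i² and one factor μ is cancelled. For μ = 0 nothing is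
  -- left of the relation, and f₀ = 1 has to be supplied.
  · by_cases h0 : μ = 0
    · rw [hμ h0, h0]; norm_num
    · have h1 : ∀ i, H (e i) u₀ = -(μ * f i) := by
        intro i
        have h2 : H (u i) u₀ = -(μ * (f i * f₀)) := by linarith [hi0 i]
        have h3 : H u₀ u₀ = μ - μ * (f₀ * f₀) := by linarith
        rw [hev, h2, h3]
        field_simp
        ring
      have h2 := hP u₀ u₀
      simp only [h1] at h2
      have h3 : μ * ∑ i, f i ^ 2 = 1 - f₀ ^ 2 := by
        refine mul_left_cancel₀ h0 ?_
        rw [Finset.mul_sum, Finset.mul_sum]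
        have : ∀ i, μ * (μ * f i ^ 2) = -(μ * f i) * -(μ * f i) := fun i => by ring
        simp only [this]
        linarith
      have h4 : ∑ i, (f i / (1 + f₀)) ^ 2 = (∑ i, f i ^ 2) / (1 + f₀) ^ 2 := by
        rw [Finset.sum_div]
        exact Finset.sum_congr rfl fun i _ => by rw [div_pow]
      rw [h4, ← mul_div_assoc, h3]
      field_simp
      ring
  · intro v w
    rw [← hP v w, Finset.sum_div]
    refine Finset.sum_congr rfl fun i _ => ?_
    rw [hev, hev]
    field_simp

/-- A flat connection on pairs of a vector and a scalar, over a space of constant curvature. -/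
def modelConnection (μ : ℝ) (h : Model n → Model n →L[ℝ] Model n →L[ℝ] ℝ)
    (Γ : Model n → Model n →L[ℝ] Model n →L[ℝ] Model n) (x : Model n) :
    Model n →L[ℝ] (Model n × ℝ) →L[ℝ] (Model n × ℝ) :=
  LinearMap.toContinuousLinearMap
    { toFun := fun w => (-((2 : ℝ) • (Γ x w).comp (ContinuousLinearMap.fst ℝ (Model n) ℝ))
          - μ • (ContinuousLinearMap.snd ℝ (Model n) ℝ).smulRight w).prod
          ((h x w).comp (ContinuousLinearMap.fst ℝ (Model n) ℝ))
      map_add' := fun w w' => by ext <;> simp <;> ring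
      map_smul' := fun c w => by ext <;> simp <;> ring }

theorem modelConnection_apply (μ : ℝ) (h : Model n → Model n →L[ℝ] Model n →L[ℝ] ℝ)
    (Γ : Model n → Model n →L[ℝ] Model n →L[ℝ] Model n) (x w : Model n) (y : Model n × ℝ) :
    modelConnection μ h Γ x w y = (-((2 : ℝ) • Γ x w y.1) - μ • y.2 • w, h x w y.1) := rfl

variable {U : Set (Model n)} {h : Model n → Model n →L[ℝ] Model n →L[ℝ] ℝ}
  {Γ : Model n → Model n →L[ℝ] Model n →L[ℝ] Model n} {p x : Model n} {μ : ℝ}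
  (hh : IsMetric U h) (hΓ : IsChristoffel U h Γ)
include hh hΓ

theorem contDiffOn_modelConnection : ContDiffOn ℝ ∞ (modelConnection μ h Γ) U := by
  rw [contDiffOn_clm_apply]
  intro w
  rw [contDiffOn_clm_apply]
  intro y
  simp only [modelConnection_apply]
  exact ((((hΓ.smooth.clm_apply contDiffOn_const).clm_apply contDiffOn_const).const_smul
    (2 : ℝ)).neg.sub contDiffOn_const).prodMk
    ((hh.smooth.clm_apply contDiffOn_const).clm_apply contDiffOn_const)

omit hh hΓ in
theorem hasDerivAt_line_fst_snd {Y : Model n → Model n × ℝ} (hY : DifferentiableAt ℝ Y x)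
    (u : Model n) : HasDerivAt (fun t : ℝ => (Y (x + t • u)).1) (fderiv ℝ Y x u).1 0 ∧
      HasDerivAt (fun t : ℝ => (Y (x + t • u)).2) (fderiv ℝ Y x u).2 0 :=
  ⟨(ContinuousLinearMap.fst ℝ (Model n) ℝ).hasFDerivAt.comp_hasDerivAt 0 (hasDerivAt_line hY u),
    (ContinuousLinearMap.snd ℝ (Model n) ℝ).hasFDerivAt.comp_hasDerivAt 0 (hasDerivAt_line hY u)⟩

theorem fderiv_modelConnection (hx : x ∈ U) (u w : Model n) (y : Model n × ℝ) :
    fderiv ℝ (modelConnection μ h Γ) x u w y =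
      (-((2 : ℝ) • fderiv ℝ Γ x u w y.1), fderiv ℝ h x u w y.1) := by
  have h1 := ((hasDerivAt_line (differentiableAt_of_contDiffOn hh.isOpen
    (contDiffOn_modelConnection (μ := μ) hh hΓ) hx) u).clm_apply
      (hasDerivAt_const_smooth w)).clm_apply (hasDerivAt_const_smooth y)
  have h2 := ((((((hasDerivAt_line (hΓ.differentiableAt hh hx) u).clm_apply
      (hasDerivAt_const_smooth w)).clm_apply (hasDerivAt_const_smooth y.1)).fun_const_smul
    (2 : ℝ)).fun_neg.fun_sub (hasDerivAt_const_smooth (μ • y.2 • w)))).prodMk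
    (((hasDerivAt_line (hh.differentiableAt hx) u).clm_apply (hasDerivAt_const_smooth w)).clm_apply
      (hasDerivAt_const_smooth y.1))
  have := h1.unique h2
  simpa using this

/-- The vector part of the curvature of this connection is the difference between R and the tensor
of constant curvature μ. The scalar part vanishes by metric compatibility and the symmetry of h and
Γ. -/
theorem modelConnection_flat (hx : x ∈ U)
    (hc : ∀ u v z, curv Γ x u v z = μ • (h x v z • u - h x u z • v)) (u v : Model n)
    (y : Model n × ℝ) :
    fderiv ℝ (modelConnection μ h Γ) x u v y +
        modelConnection μ h Γ x v (modelConnection μ h Γ x u y) =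
      fderiv ℝ (modelConnection μ h Γ) x v u y +
        modelConnection μ h Γ x u (modelConnection μ h Γ x v y) := by
  have h1 := hc u v y.1
  rw [curv] at h1
  simp only [fderiv_modelConnection hh hΓ hx, modelConnection_apply, hΓ.compat x hx]
  refine Prod.ext ?_ ?_
  · simp only [Prod.fst_add, map_sub, map_neg, map_smul, hΓ.symm x hx v u]
    linear_combination (norm := module) -h1
  · simp only [Prod.snd_add, map_sub, map_neg, map_smul, smul_eq_mul, hΓ.symm x hx v u,
      hh.symm x hx v u, hh.symm x hx (Γ x u v), hh.symm x hx v (Γ x u y.1),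
      hh.symm x hx u (Γ x v y.1)]
    ring

/-- The quantity preserved by the connection of `modelConnection`. -/
theorem modelConnection_invariant {ε : ℝ} (hsub : ball p ε ⊆ U) {Y Y' : Model n → Model n × ℝ}
    (hY : ContDiffOn ℝ ∞ Y (ball p ε)) (hY' : ContDiffOn ℝ ∞ Y' (ball p ε))
    (hA : ∀ x ∈ ball p ε, ∀ u, fderiv ℝ Y x u = modelConnection μ h Γ x u (Y x))
    (hA' : ∀ x ∈ ball p ε, ∀ u, fderiv ℝ Y' x u = modelConnection μ h Γ x u (Y' x))
    (hx : x ∈ ball p ε) :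
    h x (Y x).1 (Y' x).1 + μ * ((Y x).2 * (Y' x).2) =
      h p (Y p).1 (Y' p).1 + μ * ((Y p).2 * (Y' p).2) := by
  have hs : ContDiffOn ℝ ∞ (fun x => h x (Y x).1 (Y' x).1 + μ * ((Y x).2 * (Y' x).2))
      (ball p ε) :=
    (((hh.smooth.mono hsub).clm_apply hY.fst).clm_apply hY'.fst).add
      (contDiffOn_const.mul (hY.snd.mul hY'.snd))
  refine isOpen_ball.is_const_of_fderiv_eq_zero (𝕜 := ℝ) (convex_ball p ε).isPreconnected
    (hs.differentiableOn (by simp)) (fun z hz => ?_) hx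
    (mem_ball_self (pos_of_mem_ball hx))
  ext u
  refine fderiv_eq_of_hasDerivAt_line (differentiableAt_of_contDiffOn isOpen_ball hs hz) ?_
  obtain ⟨d1, e1⟩ := hasDerivAt_line_fst_snd (differentiableAt_of_contDiffOn isOpen_ball hY hz) u
  obtain ⟨d2, e2⟩ := hasDerivAt_line_fst_snd (differentiableAt_of_contDiffOn isOpen_ball hY' hz) u
  have d3 := hasDerivAt_line (hh.differentiableAt (hsub hz)) u
  refine ((((d3.clm_apply d1).clm_apply d2).fun_add
    ((e1.fun_mul e2).const_mul μ))).congr_deriv ?_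
  simp only [zero_smul, add_zero, hA z hz, hA' z hz, modelConnection_apply,
    hΓ.compat z (hsub hz), map_sub, map_neg, map_smul, sub_apply, neg_apply, smul_apply,
    smul_eq_mul, add_apply, hh.symm z (hsub hz) u]
  change _ = (0 : ℝ)
  ring

/-- A space of constant curvature is locally conformally flat with the model factor. -/
theorem exists_model_coordinates (hp : p ∈ U)
    (hc : ∀ x ∈ U, ∀ u v z, curv Γ x u v z = μ • (h x v z • u - h x u z • v)) :
    ∃ ε, 0 < ε ∧ ball p ε ⊆ U ∧ ∃ X : Model n → Model n, ContDiffOn ℝ ∞ X (ball p ε) ∧ X p = 0 ∧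
      ∀ x ∈ ball p ε, 0 < 1 + μ * ‖X x‖ ^ 2 ∧ ∀ v w, h x v w =
        4 * inner ℝ (fderiv ℝ X x v) (fderiv ℝ X x w) / (1 + μ * ‖X x‖ ^ 2) ^ 2 := by
  obtain ⟨e, he⟩ := exists_orthonormal_frame (hh.symm p hp) (hh.pos p hp)
  obtain ⟨ε, hε, hsub, H⟩ := exists_parallel hh.isOpen hp
    (contDiffOn_modelConnection (μ := μ) hh hΓ)
    (fun x hx => modelConnection_flat hh hΓ hx (hc x hx))
    -- A common bound for the initial values (e_i, 0) and (0, 1).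
    (R := 1 + ∑ i, ‖e i‖) (by positivity)
  obtain ⟨Y₀, hY₀, hs₀, hA₀⟩ := H (0, 1) (by
    simp only [Prod.norm_def, norm_zero, norm_one]
    have : 0 ≤ ∑ i, ‖e i‖ := by positivity
    simpa using this)
  have hex := fun i => H (e i, 0) (by
    simp only [Prod.norm_def, norm_zero]
    have := Finset.single_le_sum (f := fun i => ‖e i‖) (fun i _ => norm_nonneg _)
      (Finset.mem_univ i)
    rw [max_eq_left (norm_nonneg _)]
    linarith)
  choose Y hY hs hA using hex
  have hmem := mem_ball_self (x := p) hε
  -- For μ = 0 the invariant says that the vector part of Y₀ keeps length zero, so its scalar part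
  -- is constantly 1.
  have hμ : μ = 0 → ∀ x ∈ ball p ε, (Y₀ x).2 = 1 := by
    intro h0 x hx
    have h1 : ∀ z ∈ ball p ε, (Y₀ z).1 = 0 := by
      intro z hz
      by_contra hne
      have h2 := modelConnection_invariant hh hΓ hsub hs₀ hs₀ hA₀ hA₀ hz
      have h3 := hh.pos z (hsub hz) _ hne
      simp only [hY₀, h0, map_zero, zero_mul, add_zero] at h2
      linarith
    have h2 := isOpen_ball.is_const_of_fderiv_eq_zero (𝕜 := ℝ) (f := fun z => (Y₀ z).2)
      (convex_ball p ε).isPreconnected (hs₀.snd.differentiableOn (by simp)) (fun z hz => by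
        ext u
        refine fderiv_eq_of_hasDerivAt_line
          (differentiableAt_of_contDiffOn isOpen_ball hs₀.snd hz) ?_
        refine (hasDerivAt_line_fst_snd (differentiableAt_of_contDiffOn isOpen_ball hs₀ hz)
          u).2.congr_deriv ?_
        rw [hA₀ z hz, modelConnection_apply, h1 z hz]
        simp) hx hmem
    simpa [hY₀] using h2
  have hpos : ∀ᶠ x in 𝓝 p, 0 < 1 + (Y₀ x).2 := by
    have h1 : ContinuousAt (fun x => 1 + (Y₀ x).2) p :=
      continuousAt_const.add (hs₀.snd.continuousOn.continuousAt (isOpen_ball.mem_nhds hmem))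
    refine h1.eventually (lt_mem_nhds ?_)
    simp [hY₀]
  obtain ⟨ε', hε', hpos'⟩ := Metric.eventually_nhds_iff_ball.1 hpos
  set r := min ε ε' with hr
  have hr1 : ball p r ⊆ ball p ε := ball_subset_ball (min_le_left _ _)
  have hr2 : ball p r ⊆ ball p ε' := ball_subset_ball (min_le_right _ _)
  -- In the model these are stereographic coordinates: the f_i and f₀ play the role of ambient
  -- linear coordinates, with projection from f₀ = -1.
  set X : Model n → Model n := fun x => WithLp.toLp 2 fun i => (Y i x).2 / (1 + (Y₀ x).2) with hX
  have hXs : ContDiffOn ℝ ∞ X (ball p r) := by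
    rw [contDiffOn_euclidean]
    intro i
    exact ((hs i).snd.mono hr1).div (contDiffOn_const.add (hs₀.snd.mono hr1))
      fun x hx => (hpos' x (hr2 hx)).ne'
  refine ⟨r, lt_min hε hε', hr1.trans hsub, X, hXs, ?_, fun x hx => ?_⟩
  · ext i
    simp [hX, hY]
  have hxε := hr1 hx
  have hf := hpos' x (hr2 hx)
  obtain ⟨k1, k2⟩ := model_coordinates_algebra (μ := μ) (hh.symm x (hsub hxε))
    (u := fun i => (Y i x).1) (u₀ := (Y₀ x).1) (f := fun i => (Y i x).2) (f₀ := (Y₀ x).2)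
    (fun i j => by
      rw [modelConnection_invariant hh hΓ hsub (hs i) (hs j) (hA i) (hA j) hxε, hY, hY, he]; simp)
    (fun i => by
      rw [modelConnection_invariant hh hΓ hsub (hs i) hs₀ (hA i) hA₀ hxε, hY, hY₀]; simp)
    (by rw [modelConnection_invariant hh hΓ hsub hs₀ hs₀ hA₀ hA₀ hxε, hY₀]; simp)
    (fun h0 => hμ h0 x hxε) hf
  have hnorm : 1 + μ * ‖X x‖ ^ 2 = 2 / (1 + (Y₀ x).2) := by
    rw [← k1, EuclideanSpace.real_norm_sq_eq]
  have hD : ∀ v i, fderiv ℝ X x v i = (h x (Y i x).1 v * (1 + (Y₀ x).2) -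
      (Y i x).2 * h x (Y₀ x).1 v) / (1 + (Y₀ x).2) ^ 2 := by
    intro v i
    have hXd := differentiableAt_of_contDiffOn isOpen_ball hXs hx
    have d1 := (EuclideanSpace.proj (𝕜 := ℝ) i).hasFDerivAt.comp_hasDerivAt 0
      (hasDerivAt_line hXd v)
    have d2 := (hasDerivAt_line_fst_snd (differentiableAt_of_contDiffOn isOpen_ball (hs i) hxε)
          v).2.fun_div ((hasDerivAt_line_fst_snd (differentiableAt_of_contDiffOn isOpen_ball hs₀ hxε)
          v).2.const_add 1) (by simpa using hf.ne')
    have := d1.unique d2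
    simp only [hA i x hxε, hA₀ x hxε, modelConnection_apply, zero_smul, add_zero] at this
    rw [hh.symm x (hsub hxε) _ v, hh.symm x (hsub hxε) _ v]
    exact this
  refine ⟨by rw [hnorm]; positivity, fun v w => ?_⟩
  have h3 := k2 v w
  rw [hnorm, PiLp.inner_apply]
  simp only [hD, RCLike.inner_apply, conj_trivial]
  have h4 : ∑ i, (h x (Y i x).1 w * (1 + (Y₀ x).2) - (Y i x).2 * h x (Y₀ x).1 w) /
      (1 + (Y₀ x).2) ^ 2 * ((h x (Y i x).1 v * (1 + (Y₀ x).2) - (Y i x).2 * h x (Y₀ x).1 v) /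
      (1 + (Y₀ x).2) ^ 2) = h x v w / (1 + (Y₀ x).2) ^ 2 := by
    rw [← h3]
    exact Finset.sum_congr rfl fun i _ => mul_comm _ _
  rw [h4]
  field_simp
  norm_num

end ConstantCurvature

/-! ### Second derivatives of Euclidean conformal fields. -/

section ConformalFieldsOfEuclideanSpace

open Metric

variable {n : ℕ} {U : Set (Model n)} {V : Model n → Model n} {ρ : Model n → ℝ} {x : Model n}

/-- The second derivatives of a conformal vector field of Euclidean space. -/
theorem inner_fderiv_fderiv_conformal (hU : IsOpen U) (hV : ContDiffOn ℝ ∞ V U)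
    (hρ : ContDiffOn ℝ ∞ ρ U) (H : ∀ x ∈ U, ∀ y, inner ℝ (fderiv ℝ V x y) y = ρ x * ‖y‖ ^ 2)
    (hx : x ∈ U) (u v w : Model n) :
    inner ℝ (fderiv ℝ (fderiv ℝ V) x u v) w = fderiv ℝ ρ x u * inner ℝ v w
      + fderiv ℝ ρ x v * inner ℝ u w - fderiv ℝ ρ x w * inner ℝ u v := by
  have pol : ∀ x ∈ U, ∀ u v, inner ℝ (fderiv ℝ V x u) v + inner ℝ (fderiv ℝ V x v) u =
      2 * ρ x * inner ℝ u v := by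
    intro x hx u v
    have h1 := H x hx (u + v)
    have h2 := H x hx u
    have h3 := H x hx v
    rw [norm_add_sq_real] at h1
    simp only [map_add, inner_add_left, inner_add_right] at h1
    linear_combination h1 - h2 - h3
  have d1 := hasDerivAt_line (differentiableAt_of_contDiffOn hU (contDiffOn_fderiv hU hV) hx)
  have dρ := hasDerivAt_line (differentiableAt_of_contDiffOn hU hρ hx)
  have key : ∀ a u v, inner ℝ (fderiv ℝ (fderiv ℝ V) x a u) v +
      inner ℝ (fderiv ℝ (fderiv ℝ V) x a v) u = 2 * fderiv ℝ ρ x a * inner ℝ u v := by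
    intro a u v
    have e1 := ((d1 a).clm_apply (hasDerivAt_const_smooth u)).inner ℝ (hasDerivAt_const_smooth v)
    have e2 := ((d1 a).clm_apply (hasDerivAt_const_smooth v)).inner ℝ (hasDerivAt_const_smooth u)
    have e3 := ((dρ a).const_mul 2).mul_const (inner ℝ u v)
    have := hasDerivAt_line_unique (f := fun x => inner ℝ (fderiv ℝ V x u) v +
      inner ℝ (fderiv ℝ V x v) u) (g := fun x => 2 * ρ x * inner ℝ u v) hU hx
      (fun z hz => pol z hz u v) (e1.fun_add e2) e3
    simpa using this
  have sy := fderiv_fderiv_symm hU hV hx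
  -- The same cyclic combination as in the Koszul formula: the second derivative is symmetric in its
  -- first two slots, and `key` prescribes its symmetrization in the last two.
  have k1 := key u v w
  have k2 := key v u w
  have k3 := key w u v
  rw [sy v u] at k2
  rw [sy w u, sy w v] at k3
  linear_combination (k1 + k2 - k3) / 2

end ConformalFieldsOfEuclideanSpace

/-! ### Homothetic fields are determined by their one-jet. -/

section ModelFields

open Metric

variable {n : ℕ} {V : Model n → Model n} {x : Model n} {μ k r : ℝ}

theorem hasDerivAt_normSq_line (x u : Model n) :
    HasDerivAt (fun t : ℝ => ‖x + t • u‖ ^ 2) (2 * inner ℝ x u) 0 := by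
  have := (hasDerivAt_line_id x u).norm_sq
  simpa using this

/-- The divergence, up to a constant factor, of a homothetic vector field in model coordinates. -/
def modelFactor (μ k : ℝ) (V : Model n → Model n) (x : Model n) : ℝ :=
  2 * k + 2 * μ * inner ℝ x (V x) / (1 + μ * ‖x‖ ^ 2)

theorem contDiffOn_modelFactor (hV : ContDiffOn ℝ ∞ V (ball 0 r))
    (hN : ∀ x ∈ ball (0 : Model n) r, 0 < 1 + μ * ‖x‖ ^ 2) :
    ContDiffOn ℝ ∞ (modelFactor μ k V) (ball 0 r) :=
  contDiffOn_const.add ((contDiffOn_const.mul (contDiffOn_id.inner ℝ hV)).div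
    (contDiffOn_const.add (contDiffOn_const.mul (contDiff_id.norm_sq ℝ).contDiffOn))
    fun x hx => (hN x hx).ne')

theorem fderiv_modelFactor (hV : ContDiffOn ℝ ∞ V (ball 0 r))
    (hN : ∀ x ∈ ball (0 : Model n) r, 0 < 1 + μ * ‖x‖ ^ 2) (hx : x ∈ ball (0 : Model n) r)
    (u : Model n) : fderiv ℝ (modelFactor μ k V) x u =
      2 * μ * ((inner ℝ x (fderiv ℝ V x u) + inner ℝ u (V x)) / (1 + μ * ‖x‖ ^ 2)
        - 2 * μ * inner ℝ x u * inner ℝ x (V x) / (1 + μ * ‖x‖ ^ 2) ^ 2) := by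
  have h0 := (hN x hx).ne'
  refine fderiv_eq_of_hasDerivAt_line (differentiableAt_of_contDiffOn isOpen_ball
    (contDiffOn_modelFactor hV hN) hx) ?_
  have d1 := hasDerivAt_line (differentiableAt_of_contDiffOn isOpen_ball hV hx) u
  refine (((((hasDerivAt_line_id x u).inner ℝ d1).const_mul (2 * μ)).fun_div
    (((hasDerivAt_normSq_line x u).const_mul μ).const_add 1) (by simpa using h0)).const_add
      (2 * k)).congr_deriv ?_
  simp only [zero_smul, add_zero]
  field_simp

variable (hV : ContDiffOn ℝ ∞ V (ball 0 r))
  (hN : ∀ x ∈ ball (0 : Model n) r, 0 < 1 + μ * ‖x‖ ^ 2)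
  (H : ∀ x ∈ ball (0 : Model n) r, ∀ y, inner ℝ (fderiv ℝ V x y) y =
    modelFactor μ k V x * ‖y‖ ^ 2)
include hV hN H

/-- At the origin the factor has derivative 2μ⟨u, V(0)⟩, which is inserted into the formula for the
second derivatives of a conformal field. -/
theorem fderiv_fderiv_homothetic_zero (hr : 0 < r) (u v : Model n) :
    fderiv ℝ (fderiv ℝ V) 0 u v = (2 * μ) • (inner ℝ u (V 0) • v + inner ℝ v (V 0) • u -
      inner ℝ u v • V 0) := by
  have h0 : (0 : Model n) ∈ ball (0 : Model n) r := mem_ball_self hr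
  refine ext_inner_right ℝ fun w => ?_
  rw [inner_fderiv_fderiv_conformal isOpen_ball hV (contDiffOn_modelFactor hV hN) H h0]
  simp only [fderiv_modelFactor hV hN h0, real_inner_smul_left, inner_sub_left, inner_add_left,
    inner_zero_left, norm_zero]
  rw [real_inner_comm w (V 0)]
  norm_num
  ring

omit hV hN in
theorem skew_fderiv_homothetic_zero (hr : 0 < r) (u v : Model n) :
    inner ℝ ((fderiv ℝ V 0 - (2 * k) • ContinuousLinearMap.id ℝ (Model n)) u) v =
      -inner ℝ u ((fderiv ℝ V 0 - (2 * k) • ContinuousLinearMap.id ℝ (Model n)) v) := by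
  have h0 : (0 : Model n) ∈ ball (0 : Model n) r := mem_ball_self hr
  have h1 := H 0 h0 (u + v)
  have h2 := H 0 h0 u
  have h3 := H 0 h0 v
  rw [norm_add_sq_real] at h1
  simp only [modelFactor, inner_zero_left, mul_zero, zero_div, add_zero, map_add, inner_add_left,
    inner_add_right] at h1 h2 h3
  simp only [sub_apply, smul_apply, ContinuousLinearMap.id_apply, inner_sub_left, inner_sub_right,
    inner_smul_left, inner_smul_right, conj_trivial, real_inner_comm (fderiv ℝ V 0 v) u]
  linear_combination h1 - h2 - h3

omit H in
-- The derivative of the factor involves only the one-jet of V. Thus the second derivatives of V are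
-- controlled by its one-jet, which closes the system for Grönwall's inequality.
theorem norm_fderiv_modelFactor_le {m : ℝ} (hm : 0 < m) (hmN : m ≤ 1 + μ * ‖x‖ ^ 2)
    (hx : x ∈ ball (0 : Model n) r) (u : Model n) :
    |fderiv ℝ (modelFactor μ k V) x u| ≤ (2 * |μ| * ((r + 1) / m + 2 * |μ| * r ^ 2 / m ^ 2)) *
      max ‖V x‖ ‖fderiv ℝ V x‖ * ‖u‖ := by
  rw [fderiv_modelFactor hV hN hx]
  have hxr : ‖x‖ ≤ r := (mem_ball_zero_iff.1 hx).le
  have hr0 : 0 ≤ r := (norm_nonneg x).trans hxr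
  set G := max ‖V x‖ ‖fderiv ℝ V x‖ with hG
  have hG0 : 0 ≤ G := (norm_nonneg _).trans (le_max_left _ _)
  set N := 1 + μ * ‖x‖ ^ 2
  have hN0 : 0 < N := hm.trans_le hmN
  have b1 : |inner ℝ x (fderiv ℝ V x u)| ≤ r * (G * ‖u‖) := by
    refine (abs_real_inner_le_norm _ _).trans ?_
    have : ‖fderiv ℝ V x u‖ ≤ G * ‖u‖ :=
      ((fderiv ℝ V x).le_opNorm u).trans (by gcongr; exact le_max_right _ _)
    gcongr
  have b2 : |inner ℝ u (V x)| ≤ G * ‖u‖ := by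
    refine (abs_real_inner_le_norm _ _).trans ?_
    rw [mul_comm]
    gcongr
    exact le_max_left _ _
  have b3 : |inner ℝ x u| ≤ r * ‖u‖ :=
    (abs_real_inner_le_norm _ _).trans (by gcongr)
  have b4 : |inner ℝ x (V x)| ≤ r * G :=
    (abs_real_inner_le_norm _ _).trans (by gcongr; exact le_max_left _ _)
  have c1 : |(inner ℝ x (fderiv ℝ V x u) + inner ℝ u (V x)) / N| ≤
      (r * (G * ‖u‖) + G * ‖u‖) / m := by
    rw [abs_div, abs_of_pos hN0]
    gcongr
    exact (abs_add_le _ _).trans (add_le_add b1 b2)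
  have c2 : |2 * μ * inner ℝ x u * inner ℝ x (V x) / N ^ 2| ≤
      2 * |μ| * (r * ‖u‖) * (r * G) / m ^ 2 := by
    rw [abs_div, abs_of_pos (pow_pos hN0 2), abs_mul, abs_mul, abs_mul, abs_two]
    gcongr
  rw [abs_mul, abs_mul, abs_two]
  calc _ ≤ 2 * |μ| * ((r * (G * ‖u‖) + G * ‖u‖) / m +
        2 * |μ| * (r * ‖u‖) * (r * G) / m ^ 2) := by
        gcongr
        exact (abs_sub _ _).trans (add_le_add c1 c2)
    _ = _ := by ring

/-- A Killing field of the model metric with vanishing one-jet at the origin vanishes. -/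
theorem eq_zero_of_killing_jet (h0 : V 0 = 0) (h1 : fderiv ℝ V 0 = 0)
    (hx : x ∈ ball (0 : Model n) r) : V x = 0 := by
  have hr : 0 < r := pos_of_mem_ball hx
  have hmem : ∀ t ∈ Icc (0 : ℝ) 1, t • x ∈ ball (0 : Model n) r := fun t ht =>
    (convex_ball (0 : Model n) r).smul_mem_of_zero_mem (mem_ball_self hr) hx ht
  have hxr : ‖x‖ ≤ r := (mem_ball_zero_iff.1 hx).le
  -- A lower bound for 1 + μ|tx|² on the segment: this is a convex combination, with weight t², of 1
  -- and its value at x. It covers both signs of μ.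
  set m := min 1 (1 + μ * ‖x‖ ^ 2) with hm
  have hm0 : 0 < m := lt_min one_pos (hN x hx)
  have hmN : ∀ t ∈ Icc (0 : ℝ) 1, m ≤ 1 + μ * ‖t • x‖ ^ 2 := by
    intro t ht
    rw [norm_smul, mul_pow, Real.norm_eq_abs, sq_abs]
    have e1 := min_le_left 1 (1 + μ * ‖x‖ ^ 2)
    have e2 := min_le_right 1 (1 + μ * ‖x‖ ^ 2)
    have ht2 : t ^ 2 ≤ 1 := pow_le_one₀ ht.1 ht.2
    have ht0 : 0 ≤ t ^ 2 := sq_nonneg t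
    calc m = (1 - t ^ 2) * m + t ^ 2 * m := by ring
      _ ≤ (1 - t ^ 2) * 1 + t ^ 2 * (1 + μ * ‖x‖ ^ 2) := by
        refine add_le_add (mul_le_mul_of_nonneg_left e1 (by linarith))
          (mul_le_mul_of_nonneg_left e2 ht0)
      _ = _ := by ring
  set K₁ := 2 * |μ| * ((r + 1) / m + 2 * |μ| * r ^ 2 / m ^ 2) with hK₁
  have hK₁0 : 0 ≤ K₁ := by positivity
  have hDV := contDiffOn_fderiv isOpen_ball hV
  have hder : ∀ t ∈ Icc (0 : ℝ) 1, HasDerivAt (fun t : ℝ => (V (t • x), fderiv ℝ V (t • x)))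
      (fderiv ℝ V (t • x) x, fderiv ℝ (fderiv ℝ V) (t • x) x) t := by
    intro t ht
    have d0 : HasDerivAt (fun t : ℝ => t • x) x t := by
      simpa using (hasDerivAt_id t).smul_const x
    exact ((differentiableAt_of_contDiffOn isOpen_ball hV
      (hmem t ht)).hasFDerivAt.comp_hasDerivAt t d0).prodMk
      ((differentiableAt_of_contDiffOn isOpen_ball hDV
      (hmem t ht)).hasFDerivAt.comp_hasDerivAt t d0)
  -- Grönwall for the pair (V, DV) along the ray to x. Testing the second derivative against itself
  -- bounds its norm by that of the pair.
  have key := eq_zero_of_abs_deriv_le_mul_abs_self_of_eq_zero_right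
    (f := fun t : ℝ => (V (t • x), fderiv ℝ V (t • x))) (K := r + 3 * K₁ * r) (a := 0) (b := 1)
    (fun t ht => (hder t ht).continuousAt.continuousWithinAt)
    (fun t ht => (hder t (Ico_subset_Icc_self ht)).hasDerivWithinAt) (by simp [h0, h1])
    (fun t ht => by
      have ht' := Ico_subset_Icc_self ht
      have hz := hmem t ht'
      set G := max ‖V (t • x)‖ ‖fderiv ℝ V (t • x)‖ with hG
      have hG0 : 0 ≤ G := (norm_nonneg _).trans (le_max_left _ _)
      rw [Prod.norm_def, Prod.norm_def, max_le_iff]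
      constructor
      · refine ((fderiv ℝ V (t • x)).le_opNorm x).trans ?_
        have e1 : ‖fderiv ℝ V (t • x)‖ * ‖x‖ ≤ G * r := by
          gcongr
          exact le_max_right _ _
        have e2 : 0 ≤ 3 * K₁ * r * G := by positivity
        calc _ ≤ G * r := e1
          _ ≤ (r + 3 * K₁ * r) * G := by linarith
      · refine ContinuousLinearMap.opNorm_le_bound _ (by positivity) fun v => ?_
        set w := fderiv ℝ (fderiv ℝ V) (t • x) x v with hw
        by_cases hw0 : w = 0
        · rw [hw0, norm_zero]; positivity
        have hwpos : 0 < ‖w‖ := norm_pos_iff.2 hw0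
        have e0 := inner_fderiv_fderiv_conformal isOpen_ball hV (contDiffOn_modelFactor hV hN) H
          hz x v w
        rw [← hw, real_inner_self_eq_norm_sq] at e0
        have B := norm_fderiv_modelFactor_le (k := k) hV hN hm0 (hmN t ht') hz
        rw [← hK₁, ← hG] at B
        have f1 := (le_abs_self _).trans ((abs_mul _ _).le.trans (mul_le_mul (B x)
          (abs_real_inner_le_norm v w) (abs_nonneg _) (by positivity)))
        have f2 := (le_abs_self _).trans ((abs_mul _ _).le.trans (mul_le_mul (B v)
          (abs_real_inner_le_norm x w) (abs_nonneg _) (by positivity)))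
        have f3 := (neg_le_abs _).trans ((abs_mul _ _).le.trans (mul_le_mul (B w)
          (abs_real_inner_le_norm x v) (abs_nonneg _) (by positivity)))
        have e1 : ‖w‖ * ‖w‖ ≤ (3 * K₁ * ‖x‖ * G * ‖v‖) * ‖w‖ := by
          nlinarith [e0, f1, f2, f3]
        have e2 : ‖w‖ ≤ 3 * K₁ * ‖x‖ * G * ‖v‖ := le_of_mul_le_mul_right e1 hwpos
        have e3 : 3 * K₁ * ‖x‖ * G * ‖v‖ ≤ 3 * K₁ * r * G * ‖v‖ := by gcongr
        have e4 : 0 ≤ r * G * ‖v‖ := by positivity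
        linarith)
  have := key 1 (by simp)
  simpa using congrArg Prod.fst this

end ModelFields

/-! ### Classification of unit Killing and homothetic fields in model coordinates. -/

section ModelClassification

open Metric

variable {n : ℕ} {V W : Model n → Model n} {x γ δ : Model n} {μ k r : ℝ}
  {P Q : Model n →L[ℝ] Model n}

theorem IsSkew.inner_self (hQ : IsSkew Q) (y : Model n) : inner ℝ (Q y) y = 0 := by
  have := hQ y y
  rw [real_inner_comm (Q y) y] at this
  linarith

theorem contDiff_modelField : ContDiff ℝ ∞ (modelField μ γ Q) := by
  have h1 : ContDiff ℝ ∞ fun x : Model n => inner ℝ γ x := contDiff_const.inner ℝ contDiff_id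
  have h2 : ContDiff ℝ ∞ fun x : Model n => ‖x‖ ^ 2 := contDiff_id.norm_sq ℝ
  exact (contDiff_const.add Q.contDiff).add (contDiff_const.fun_smul
    (((contDiff_const.mul h1).fun_smul contDiff_id).sub (h2.fun_smul contDiff_const)))

theorem fderiv_modelField (x u : Model n) : fderiv ℝ (modelField μ γ Q) x u =
    Q u + μ • ((2 * inner ℝ γ x) • u + (2 * inner ℝ γ u) • x - (2 * inner ℝ x u) • γ) := by
  refine fderiv_eq_of_hasDerivAt_line (contDiff_modelField.differentiable (by simp) x) ?_
  have d1 := ((hasDerivAt_const_smooth γ).inner ℝ (hasDerivAt_line_id x u)).const_mul 2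
  have d2 := (d1.fun_smul (hasDerivAt_line_id x u)).fun_sub
    ((hasDerivAt_normSq_line x u).smul_const γ)
  refine (((hasDerivAt_clm_snd Q x u).const_add γ).fun_add (d2.fun_const_smul μ)).congr_deriv ?_
  simp

theorem inner_modelField (hQ : IsSkew Q) (x : Model n) :
    inner ℝ x (modelField μ γ Q x) = inner ℝ x γ * (1 + μ * ‖x‖ ^ 2) := by
  have := hQ.inner_self x
  rw [real_inner_comm] at this
  simp only [modelField, inner_add_right, inner_sub_right, real_inner_smul_right, this,
    real_inner_self_eq_norm_sq, real_inner_comm x γ]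
  ring

theorem modelField_zero : modelField μ γ Q 0 = γ := by simp [modelField]

theorem fderiv_modelField_zero : fderiv ℝ (modelField μ γ Q) 0 = Q := by
  ext u
  simp [fderiv_modelField]

/-- The product ⟨x, K(x)⟩ contains the factor 1 + μ|x|², so the conformal factor of K is simply
2μ⟨γ,x⟩, as read off from its derivative. -/
theorem inner_fderiv_modelField (hQ : IsSkew Q) (hx : 1 + μ * ‖x‖ ^ 2 ≠ 0) (y : Model n) :
    inner ℝ (fderiv ℝ (modelField μ γ Q) x y) y =
      modelFactor μ 0 (modelField μ γ Q) x * ‖y‖ ^ 2 := by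
  have h1 : modelFactor μ 0 (modelField μ γ Q) x = 2 * μ * inner ℝ γ x := by
    rw [modelFactor, inner_modelField hQ, real_inner_comm x γ]
    field_simp
    ring
  rw [h1, fderiv_modelField]
  simp only [inner_add_left, inner_sub_left, real_inner_smul_left, hQ.inner_self,
    real_inner_self_eq_norm_sq]
  ring

/-- The homothetic vector fields in model coordinates. -/
theorem homothetic_eq_modelField (hV : ContDiffOn ℝ ∞ V (ball 0 r))
    (hN : ∀ x ∈ ball (0 : Model n) r, 0 < 1 + μ * ‖x‖ ^ 2)
    (H : ∀ x ∈ ball (0 : Model n) r, ∀ y, inner ℝ (fderiv ℝ V x y) y =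
      modelFactor μ k V x * ‖y‖ ^ 2) (hμk : μ * k = 0) (hx : x ∈ ball (0 : Model n) r) :
    V x = (2 * k) • x +
      modelField μ (V 0) (fderiv ℝ V 0 - (2 * k) • ContinuousLinearMap.id ℝ (Model n)) x := by
  have hr : 0 < r := pos_of_mem_ball hx
  have hQ : IsSkew (fderiv ℝ V 0 - (2 * k) • ContinuousLinearMap.id ℝ (Model n)) :=
    skew_fderiv_homothetic_zero H hr
  set Q := fderiv ℝ V 0 - (2 * k) • ContinuousLinearMap.id ℝ (Model n) with hQdef
  set K := modelField μ (V 0) Q with hK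
  have hKs : ContDiff ℝ ∞ K := contDiff_modelField
  have hs : ContDiffOn ℝ ∞ (fun x => V x - ((2 * k) • x + K x)) (ball 0 r) :=
    hV.sub ((contDiff_const.fun_smul contDiff_id).add hKs).contDiffOn
  have hd : ∀ z ∈ ball (0 : Model n) r, ∀ u, fderiv ℝ (fun x => V x - ((2 * k) • x + K x)) z u =
      fderiv ℝ V z u - ((2 * k) • u + fderiv ℝ K z u) := by
    intro z hz u
    refine fderiv_eq_of_hasDerivAt_line (differentiableAt_of_contDiffOn isOpen_ball hs hz) ?_
    exact (hasDerivAt_line (differentiableAt_of_contDiffOn isOpen_ball hV hz) u).fun_sub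
      (((hasDerivAt_line_id z u).fun_const_smul (2 * k)).fun_add
        (hasDerivAt_line (hKs.differentiable (by simp) z) u))
  have hKfac : ∀ z ∈ ball (0 : Model n) r, ∀ y, inner ℝ (fderiv ℝ K z y) y =
      modelFactor μ 0 K z * ‖y‖ ^ 2 := fun z hz y => inner_fderiv_modelField hQ (hN z hz).ne' y
  -- The Euler field contributes an extra term proportional to μk, which vanishes. The difference of
  -- the two fields is thus a Killing field with zero one-jet.
  have := eq_zero_of_killing_jet (k := 0) hs hN (fun z hz y => ?_) ?_ ?_ hx
  · rwa [sub_eq_zero] at this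
  · rw [hd z hz, inner_sub_left, inner_add_left, H z hz, hKfac z hz, real_inner_smul_left,
      real_inner_self_eq_norm_sq]
    have h0 := (hN z hz).ne'
    simp only [modelFactor, inner_sub_right, inner_add_right, real_inner_smul_right,
      real_inner_self_eq_norm_sq]
    field_simp
    linear_combination (2 * ‖z‖ ^ 2 * ‖y‖ ^ 2 : ℝ) * hμk
  · simp [hK, modelField_zero]
  · ext1 u
    rw [hd 0 (mem_ball_self hr), hK, fderiv_modelField_zero]
    simp [hQdef]

/-- The unit Killing fields in model coordinates. -/
theorem unit_modelField_relations (hr : 0 < r) (hP : IsSkew P)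
    (h1 : ∀ x ∈ ball (0 : Model n) r,
      4 * ‖modelField μ δ P x‖ ^ 2 = (1 + μ * ‖x‖ ^ 2) ^ 2) :
    ‖δ‖ = 1 / 2 ∧ P δ = 0 ∧ ∀ u, P (P u) = -(μ • (u - (4 * inner ℝ δ u) • δ)) := by
  have hδ : ‖δ‖ ^ 2 = 1 / 4 := by
    have := h1 0 (mem_ball_self hr)
    rw [modelField_zero, norm_zero] at this
    linarith
  -- The unit condition expanded. The vector 2⟨δ,x⟩x - |x|²δ is |x|² times a reflection of δ, which
  -- makes the quartic terms cancel.
  have hexp : ∀ x ∈ ball (0 : Model n) r, ‖P x‖ ^ 2 + 2 * inner ℝ δ (P x) * (1 - μ * ‖x‖ ^ 2)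
      + 4 * μ * inner ℝ δ x ^ 2 - μ * ‖x‖ ^ 2 = 0 := by
    intro x hx
    have h2 := h1 x hx
    have h3 := hP.inner_self x
    have h4 : ‖(2 * inner ℝ δ x) • x - ‖x‖ ^ 2 • δ‖ ^ 2 = ‖x‖ ^ 4 / 4 := by
      rw [norm_sub_sq_real, norm_smul, norm_smul, mul_pow, mul_pow, hδ, real_inner_smul_left,
        real_inner_smul_right, real_inner_comm δ x, Real.norm_eq_abs, Real.norm_eq_abs, sq_abs,
        sq_abs]
      ring
    rw [modelField, norm_add_sq_real, norm_add_sq_real, hδ, norm_smul, mul_pow, h4,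
      Real.norm_eq_abs, sq_abs] at h2
    simp only [inner_add_left, inner_sub_right, real_inner_smul_right, h3, real_inner_comm δ (P x),
      real_inner_self_eq_norm_sq, hδ] at h2
    linear_combination h2 / 4
  -- Shrinks u into the ball while keeping the factor 1 - μ|x|² invertible.
  have hball : ∀ u : Model n, ∃ t : ℝ, 0 < t ∧ t • u ∈ ball (0 : Model n) r ∧
      1 - μ * ‖t • u‖ ^ 2 ≠ 0 := by
    intro u
    have c1 : ContinuousAt (fun t : ℝ => t • u) 0 := by fun_prop
    have c2 : ContinuousAt (fun t : ℝ => 1 - μ * ‖t • u‖ ^ 2) 0 := by fun_prop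
    have f1 : ∀ᶠ t in 𝓝 (0 : ℝ), t • u ∈ ball (0 : Model n) r :=
      c1 (isOpen_ball.mem_nhds (by simpa using hr))
    have f2 : ∀ᶠ t in 𝓝 (0 : ℝ), 1 - μ * ‖t • u‖ ^ 2 ≠ 0 :=
      c2.eventually_ne (by simp)
    obtain ⟨t, ⟨h1, h2⟩, h3⟩ := (((f1.and f2).filter_mono nhdsWithin_le_nhds).and
      (self_mem_nhdsWithin : Ioi (0 : ℝ) ∈ 𝓝[>] 0)).exists
    exact ⟨t, h3, h1, h2⟩
  have hneg : ∀ x ∈ ball (0 : Model n) r, -x ∈ ball (0 : Model n) r := by simp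
  -- The even part of the relation in x; polarized below, it gives P². The odd part gives Pδ = 0.
  have heven : ∀ u, ‖P u‖ ^ 2 = μ * (‖u‖ ^ 2 - 4 * inner ℝ δ u ^ 2) := by
    intro u
    obtain ⟨t, ht, hu, -⟩ := hball u
    have e1 := hexp _ hu
    have e2 := hexp _ (hneg _ hu)
    simp only [map_neg, norm_neg, inner_neg_right, map_smul, norm_smul, real_inner_smul_right,
      mul_pow, Real.norm_eq_abs, sq_abs] at e1 e2
    refine mul_left_cancel₀ (pow_pos ht 2).ne' ?_
    linear_combination (e1 + e2) / 2
  have hodd : ∀ u, inner ℝ δ (P u) = 0 := by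
    intro u
    obtain ⟨t, ht, hu, hne⟩ := hball u
    have e1 := hexp _ hu
    have e2 := hexp _ (hneg _ hu)
    simp only [map_neg, norm_neg, inner_neg_right, neg_sq] at e1 e2
    have e3 : inner ℝ δ (P (t • u)) * (1 - μ * ‖t • u‖ ^ 2) = 0 := by
      linear_combination (e1 - e2) / 4
    have e4 := (mul_eq_zero.1 e3).resolve_right hne
    rw [map_smul, real_inner_smul_right] at e4
    exact (mul_eq_zero.1 e4).resolve_left ht.ne'
  refine ⟨?_, ?_, fun u => ?_⟩
  · nlinarith [norm_nonneg δ]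
  · refine ext_inner_right ℝ fun v => ?_
    rw [hP, hodd, inner_zero_left, neg_zero]
  · refine ext_inner_right ℝ fun v => ?_
    have e1 := heven (u + v)
    have e2 := heven u
    have e3 := heven v
    rw [map_add, norm_add_sq_real, norm_add_sq_real, inner_add_right] at e1
    rw [hP]
    simp only [inner_neg_left, real_inner_smul_left, inner_sub_left]
    linear_combination (-1 / 2) * (e1 - e2 - e3)

/-- Since 2δ is a unit vector, P² is -μ times the orthogonal projection onto the complement of δ,
which has trace n - 1. -/
theorem trace_mul_self_unit_killing (hδ : ‖δ‖ = 1 / 2)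
    (hP : ∀ u, P (P u) = -(μ • (u - (4 * inner ℝ δ u) • δ))) :
    LinearMap.trace ℝ (Model n) (P.toLinearMap * P.toLinearMap) = -(μ * (n - 1)) := by
  rw [LinearMap.trace_eq_sum_inner _ (EuclideanSpace.basisFun (Fin n) ℝ)]
  have h1 : ∀ i : Fin n, inner ℝ (EuclideanSpace.single i (1 : ℝ))
      ((P.toLinearMap * P.toLinearMap) (EuclideanSpace.single i (1 : ℝ))) =
      -(μ * (1 - 4 * δ i ^ 2)) := by
    intro i
    change inner ℝ (EuclideanSpace.single i (1 : ℝ)) (P (P (EuclideanSpace.single i (1 : ℝ)))) = _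
    rw [hP]
    simp only [inner_neg_right, EuclideanSpace.inner_single_left, EuclideanSpace.inner_single_right]
    simp
    ring_nf
    simp
  simp only [EuclideanSpace.basisFun_apply, h1]
  have h2 : ∑ i, δ i ^ 2 = 1 / 4 := by
    rw [← EuclideanSpace.real_norm_sq_eq, hδ]; norm_num
  rw [Finset.sum_neg_distrib, ← Finset.mul_sum, Finset.sum_sub_distrib, ← Finset.mul_sum, h2]
  simp

/-- The relations between a unit Killing field and a homothetic field in model coordinates. -/
theorem homothetic_modelField_relations (hn : 2 ≤ n) (hr : 0 < r)
    (hN : ∀ x ∈ ball (0 : Model n) r, 0 < 1 + μ * ‖x‖ ^ 2)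
    (hW : ContDiffOn ℝ ∞ W (ball 0 r)) (hV : ContDiffOn ℝ ∞ V (ball 0 r))
    (HW : ∀ x ∈ ball (0 : Model n) r, ∀ y, inner ℝ (fderiv ℝ W x y) y =
      modelFactor μ 0 W x * ‖y‖ ^ 2)
    (HV : ∀ x ∈ ball (0 : Model n) r, ∀ y, inner ℝ (fderiv ℝ V x y) y =
      modelFactor μ k V x * ‖y‖ ^ 2)
    (hb : ∀ x ∈ ball (0 : Model n) r, fderiv ℝ W x (V x) - fderiv ℝ V x (W x) = -(2 * k) • W x)
    (hδ : ‖W 0‖ = 1 / 2) (hPδ : fderiv ℝ W 0 (W 0) = 0)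
    (hPP : ∀ u, fderiv ℝ W 0 (fderiv ℝ W 0 u) = -(μ • (u - (4 * inner ℝ (W 0) u) • W 0)))
    (hQ : Q = fderiv ℝ V 0 - (2 * k) • ContinuousLinearMap.id ℝ (Model n)) :
    μ * k = 0 ∧ Q (W 0) = fderiv ℝ W 0 (V 0) ∧
    ∀ u, fderiv ℝ W 0 (Q u) - Q (fderiv ℝ W 0 u) =
      (4 * μ) • ((inner ℝ (V 0) u) • W 0 - (inner ℝ (W 0) u) • V 0) := by
  have h0 : (0 : Model n) ∈ ball (0 : Model n) r := mem_ball_self hr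
  have hP : IsSkew (fderiv ℝ W 0) := by
    have := skew_fderiv_homothetic_zero HW hr
    intro u v
    simpa using this u v
  have hVd := differentiableAt_of_contDiffOn isOpen_ball hV h0
  have hWd := differentiableAt_of_contDiffOn isOpen_ball hW h0
  have hDV := differentiableAt_of_contDiffOn isOpen_ball (contDiffOn_fderiv isOpen_ball hV) h0
  have hDW := differentiableAt_of_contDiffOn isOpen_ball (contDiffOn_fderiv isOpen_ball hW) h0
  have hQ' : ∀ u, fderiv ℝ V 0 u = (2 * k) • u + Q u := fun u => by simp [hQ]
  set P := fderiv ℝ W 0 with hPdef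
  -- The bracket relation differentiated at the origin. The second derivatives of V and W there are
  -- known, and the unwanted term -2kP is removed afterwards.
  have hcomm : ∀ u, P (Q u) - Q (P u) =
      (4 * μ) • ((inner ℝ (V 0) u) • W 0 - (inner ℝ (W 0) u) • V 0) - (2 * k) • P u := by
    intro u
    have e1 := ((hasDerivAt_line hDW u).clm_apply (hasDerivAt_line hVd u)).fun_sub
      ((hasDerivAt_line hDV u).clm_apply (hasDerivAt_line hWd u))
    have e2 := (hasDerivAt_line hWd u).fun_const_smul (-(2 * k))
    have e3 := hasDerivAt_line_unique isOpen_ball h0 hb e1 e2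
    rw [fderiv_fderiv_homothetic_zero hW hN HW hr, fderiv_fderiv_homothetic_zero hV hN HV hr] at e3
    simp only [zero_smul, add_zero, hQ', ← hPdef, map_add, map_smul] at e3
    rw [real_inner_comm (W 0) (V 0), real_inner_comm (W 0) u, real_inner_comm (V 0) u] at e3
    linear_combination (norm := module) e3
  have hQδ : Q (W 0) = P (V 0) := by
    have := hb 0 h0
    rw [hQ', ← hPdef] at this
    linear_combination (norm := module) -this
  -- Compose with P and take the trace: PQP and PPQ have equal traces, and the rank-one terms
  -- contribute ⟨V(0), Pδ⟩ and ⟨δ, PV(0)⟩, both zero.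
  have htr : (2 * k) * LinearMap.trace ℝ (Model n) (P.toLinearMap * P.toLinearMap) = 0 := by
    have e1 : (2 * k) • (P.toLinearMap * P.toLinearMap) =
        P.toLinearMap * (Q.toLinearMap * P.toLinearMap) -
        (P.toLinearMap * P.toLinearMap) * Q.toLinearMap +
        (4 * μ) • ((innerₛₗ ℝ (V 0)).smulRight (P (W 0))
          - (innerₛₗ ℝ (W 0)).smulRight (P (V 0))) := by
      refine LinearMap.ext fun u => ?_
      have := congrArg P (hcomm u)
      simp only [map_sub, map_smul] at this
      change (2 * k) • P (P u) = P (Q (P u)) - P (P (Q u)) + (4 * μ) •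
        (inner ℝ (V 0) u • P (W 0) - inner ℝ (W 0) u • P (V 0))
      linear_combination (norm := module) this
    have e2 : inner ℝ (W 0) (P (V 0)) = (0 : ℝ) := by
      have := hP (W 0) (V 0)
      rw [hPδ, inner_zero_left] at this
      linarith
    rw [← smul_eq_mul, ← map_smul, e1]
    simp only [map_add, map_sub, map_smul, LinearMap.trace_smulRight, hPδ, map_zero]
    rw [← mul_assoc, LinearMap.trace_mul_comm ℝ (P.toLinearMap * Q.toLinearMap), ← mul_assoc]
    simp [e2]
  have hμk : μ * k = 0 := by
    rw [trace_mul_self_unit_killing hδ hPP] at htr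
    have hn' : (n : ℝ) - 1 ≠ 0 := by
      have : (2 : ℝ) ≤ n := by exact_mod_cast hn
      linarith
    have : μ * k * ((n : ℝ) - 1) = 0 := by linear_combination (-1 / 2) * htr
    exact (mul_eq_zero.1 this).resolve_right hn'
  -- If k ≠ 0, then μ = 0, so P² = 0, and a skew map with zero square vanishes.
  have hkP : ∀ u, (2 * k) • P u = 0 := by
    intro u
    by_cases hk : k = 0
    · simp [hk]
    have hμ0 : μ = 0 := (mul_eq_zero.1 hμk).resolve_right hk
    have e1 : inner ℝ (P u) (P u) = (0 : ℝ) := by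
      have e2 := hP u (P u)
      rw [hPP, hμ0] at e2
      simpa using e2
    rw [inner_self_eq_zero.1 e1, smul_zero]
  refine ⟨hμk, hQδ, fun u => ?_⟩
  rw [hcomm, hkP, sub_zero]

end ModelClassification

/-! ### Infinitesimal conformal maps of a Kropina metric. -/

section ConformalFieldsOfKropina

/-- Equality of cubic polynomials on the positive half line. -/
theorem coeff_eq_zero_of_cubic {a₀ a₁ a₂ a₃ : ℝ}
    (H : ∀ t : ℝ, 0 < t → a₀ + a₁ * t + a₂ * t ^ 2 + a₃ * t ^ 3 = 0) :
    a₀ = 0 ∧ a₁ = 0 ∧ a₂ = 0 ∧ a₃ = 0 := by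
  have h1 := H 1 (by norm_num)
  have h2 := H 2 (by norm_num)
  have h3 := H 3 (by norm_num)
  have h4 := H 4 (by norm_num)
  norm_num at h1 h2 h3 h4
  refine ⟨?_, ?_, ?_, ?_⟩ <;> linarith

variable {n : ℕ}

/-- An infinitesimal conformal map of a Kropina metric `A / B` is conformal for `A` and `B`. -/
theorem kropina_conformal_algebra {H : Model n →L[ℝ] Model n →L[ℝ] ℝ}
    (hs : ∀ v w, H v w = H w v) (hp : ∀ v, v ≠ 0 → 0 < H v v) {w s : Model n} (hw : H w w = 1)
    (hsw : H s w = 0) {T : Model n →L[ℝ] Model n} {c : ℝ}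
    (hc : ∀ y, 0 < H w y → 2 * H (T y) y * H w y - H y y * (H s y + H w (T y)) =
      2 * c * H y y * H w y) :
    (∀ y, H (T y) y = 2 * c * H y y) ∧ s - T w = -(2 * c) • w := by
  -- At y = z + tw with z orthogonal to w the condition is a cubic polynomial in t > 0; these are
  -- its coefficients.
  have key : ∀ z, H w z = 0 → (H z z * (H s z + H w (T z)) = 0) ∧
      (2 * H (T z) z - H z z * H w (T w) = 2 * c * H z z) ∧
      (2 * (H (T z) w + H (T w) z) = H s z + H w (T z)) ∧ H (T w) w = 2 * c := by
    intro z hz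
    have h1 : H z w = 0 := by rw [hs, hz]
    obtain ⟨e0, e1, e2, e3⟩ := coeff_eq_zero_of_cubic
      (a₀ := -(H z z * (H s z + H w (T z))))
      (a₁ := 2 * H (T z) z - H z z * H w (T w) - 2 * c * H z z)
      (a₂ := 2 * (H (T z) w + H (T w) z) - (H s z + H w (T z)))
      (a₃ := 2 * H (T w) w - H w (T w) - 2 * c) (fun t ht => by
        have := hc (z + t • w) (by simpa [hz, hw] using ht)
        simp only [map_add, map_smul, add_apply, smul_apply, smul_eq_mul, hz, hw, h1, hsw] at this
        linear_combination this)
    rw [hs w (T w)] at e3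
    exact ⟨by linarith, by linarith, by linarith, by linarith⟩
  have hTw : H (T w) w = 2 * c := (key 0 (by simp)).2.2.2
  have hdec : ∀ y, ∃ z t, H w z = 0 ∧ y = z + t • w := fun y =>
    ⟨y - H w y • w, H w y, by simp [hw], by module⟩
  -- The constant coefficient is H(z,z) times this expression, so definiteness allows division.
  have hl : ∀ z, H w z = 0 → H s z + H w (T z) = 0 := by
    intro z hz
    by_cases h0 : z = 0
    · simp [h0]
    · exact (mul_eq_zero.1 (key z hz).1).resolve_left (hp z h0).ne'
  have hA : ∀ y, H (T y) y = 2 * c * H y y := by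
    intro y
    obtain ⟨z, t, hz, rfl⟩ := hdec y
    obtain ⟨-, e1, e2, -⟩ := key z hz
    have h1 : H z w = 0 := by rw [hs, hz]
    rw [hl z hz] at e2
    rw [hs w (T w), hTw] at e1
    simp only [map_add, map_smul, add_apply, smul_apply, smul_eq_mul, hz, hw, h1, hTw]
    linear_combination e1 / 2 + t * e2 / 2
  refine ⟨hA, ?_⟩
  have hpol : ∀ u v, H (T u) v + H (T v) u = 4 * c * H u v := by
    intro u v
    have e1 := hA (u + v)
    have e2 := hA u
    have e3 := hA v
    simp only [map_add, add_apply] at e1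
    rw [hs v u] at e1
    linarith
  have h0 : ∀ y, H (s - T w + (2 * c) • w) y = 0 := by
    intro y
    obtain ⟨z, t, hz, rfl⟩ := hdec y
    have e1 := hl z hz
    have e2 := hpol w z
    rw [hs (T z) w, hz] at e2
    simp only [map_add, map_sub, map_smul, add_apply, sub_apply, smul_apply, smul_eq_mul, hz, hw,
      hsw, hTw]
    linear_combination e1 - e2
  have h1 : s - T w + (2 * c) • w = 0 := by
    by_contra hne
    exact (hp _ hne).ne' (h0 _)
  linear_combination (norm := module) h1

variable {U : Set (Model n)} {h : Model n → Model n →L[ℝ] Model n →L[ℝ] ℝ}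
  {Γ : Model n → Model n →L[ℝ] Model n →L[ℝ] Model n} {W V : Model n → Model n} {x : Model n}
  {c : Model n → ℝ} (hh : IsMetric U h) (hW : IsUnitField U h W) (hΓ : IsChristoffel U h Γ)
include hh hΓ

/-- The polarized conformal equation differentiated along a; as the connection is metric, all terms
with Γ cancel. -/
theorem covDerivEnd_conformal (hV : ContDiffOn ℝ ∞ V U) (hc : ContDiffOn ℝ ∞ c U)
    (hT : ∀ x ∈ U, ∀ y, h x (covDeriv Γ V x y) y = 2 * c x * h x y y) (hx : x ∈ U)
    (a u v : Model n) :
    h x (covDerivEnd Γ (covDeriv Γ V) x a u) v + h x (covDerivEnd Γ (covDeriv Γ V) x a v) u =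
      4 * fderiv ℝ c x a * h x u v := by
  have hpol : ∀ x ∈ U, ∀ u v, h x (covDeriv Γ V x u) v + h x (covDeriv Γ V x v) u =
      4 * c x * h x u v := by
    intro x hx u v
    have e1 := hT x hx (u + v)
    have e2 := hT x hx u
    have e3 := hT x hx v
    simp only [map_add, add_apply] at e1
    rw [hh.symm x hx v u] at e1
    linarith
  have hTd := hasDerivAt_line (differentiableAt_of_contDiffOn hh.isOpen
    (contDiffOn_covDeriv hh hΓ hV) hx) a
  have hH := hasDerivAt_line (hh.differentiableAt hx) a
  have hcd := hasDerivAt_line (differentiableAt_of_contDiffOn hh.isOpen hc hx) a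
  have cs := fun z : Model n => hasDerivAt_const_smooth z
  have h1 := ((hH.clm_apply (hTd.clm_apply (cs u))).clm_apply (cs v)).fun_add
    ((hH.clm_apply (hTd.clm_apply (cs v))).clm_apply (cs u))
  have h2 := (hcd.const_mul 4).fun_mul ((hH.clm_apply (cs u)).clm_apply (cs v))
  have := hasDerivAt_line_unique (f := fun x => h x (covDeriv Γ V x u) v +
    h x (covDeriv Γ V x v) u) (g := fun x => 4 * c x * h x u v) hh.isOpen hx
    (fun z hz => hpol z hz u v) h1 h2
  simp only [zero_smul, add_zero, add_apply, hΓ.compat x hx, map_zero] at this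
  simp only [covDerivEnd, map_add, map_sub, map_smul, add_apply, sub_apply, smul_apply, smul_eq_mul]
  have k1 := hpol x hx (Γ x a u) v
  have k2 := hpol x hx u (Γ x a v)
  rw [hh.symm x hx (covDeriv Γ V x u)] at k2
  rw [hh.symm x hx (covDeriv Γ V x u) (Γ x a v)] at this
  rw [hh.symm x hx (covDeriv Γ V x v) (Γ x a u)] at this
  rw [hh.symm x hx (covDeriv Γ V x v) (Γ x a u)] at k1
  linarith

include hW
/-- The conformal factor of a conformal vector field of a Kropina metric with Killing unit form is
locally constant. -/
theorem fderiv_conformalFactor_eq_zero (hn : 2 ≤ n)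
    (hK : ∀ x ∈ U, ∀ v w, h x (covDeriv Γ W x v) w = -h x v (covDeriv Γ W x w))
    (hV : ContDiffOn ℝ ∞ V U) (hc : ContDiffOn ℝ ∞ c U)
    (hT : ∀ x ∈ U, ∀ y, h x (covDeriv Γ V x y) y = 2 * c x * h x y y)
    (hB : ∀ x ∈ U, covDeriv Γ W x (V x) - covDeriv Γ V x (W x) = -(2 * c x) • W x) (hx : x ∈ U) :
    fderiv ℝ c x = 0 := by
  have hs := hh.symm x hx
  have hS := contDiffOn_covDeriv hh hΓ hW.smooth
  have hTs := contDiffOn_covDeriv hh hΓ hV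
  have hWd := differentiableAt_of_contDiffOn hh.isOpen hW.smooth hx
  have hVd := differentiableAt_of_contDiffOn hh.isOpen hV hx
  have hSd := differentiableAt_of_contDiffOn hh.isOpen hS hx
  have hTd := differentiableAt_of_contDiffOn hh.isOpen hTs hx
  have hcd := differentiableAt_of_contDiffOn hh.isOpen hc hx
  -- The covariant derivative of the bracket relation along u.
  have d1 : ∀ u, covDerivEnd Γ (covDeriv Γ W) x u (V x) + covDeriv Γ W x (covDeriv Γ V x u)
      - covDerivEnd Γ (covDeriv Γ V) x u (W x) - covDeriv Γ V x (covDeriv Γ W x u) =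
      -(2 * fderiv ℝ c x u) • W x - (2 * c x) • covDeriv Γ W x u := by
    intro u
    have e1 := ((hasDerivAt_line hSd u).clm_apply (hasDerivAt_line hVd u)).fun_sub
      ((hasDerivAt_line hTd u).clm_apply (hasDerivAt_line hWd u))
    have e2 := (((hasDerivAt_line hcd u).const_mul 2).fun_neg).fun_smul (hasDerivAt_line hWd u)
    have e3 := hasDerivAt_line_unique hh.isOpen hx hB e1 e2
    simp only [zero_smul, add_zero] at e3
    have e4 := congrArg (fun z => (2 : ℝ) • Γ x u z) (hB x hx)
    simp only [map_sub, map_smul] at e4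
    simp only [covDerivEnd]
    have f1 : covDeriv Γ V x u = fderiv ℝ V x u + (2 : ℝ) • Γ x u (V x) := rfl
    have f2 : covDeriv Γ W x u = fderiv ℝ W x u + (2 : ℝ) • Γ x u (W x) := rfl
    rw [f1, f2, map_add, map_smul, map_add, map_smul]
    linear_combination (norm := module) e3 + e4
  -- Pair with u. Commuting the derivatives of V produces the curvature term that the Killing
  -- identity for W also contains, so both cancel. The terms with two first derivatives vanish
  -- because h(Su,u) = 0.
  have hdc : ∀ u, fderiv ℝ c x (W x) * h x u u = fderiv ℝ c x u * h x (W x) u := by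
    intro u
    have e0 := congrArg (fun z => h x z u) (d1 u)
    simp only [map_add, map_sub, map_smul, add_apply, sub_apply, smul_apply, smul_eq_mul,
      covDerivEnd_killing hh hΓ hW.smooth hK hx, map_neg, neg_apply] at e0
    have t1 := covDerivEnd_conformal hh hΓ hV hc hT hx (W x) u u
    have t2 := congrArg (fun z => h x z u) (covDerivEnd_covDeriv_sub hh hΓ hx hV u (W x))
    simp only [map_sub, sub_apply] at t2
    have t3 := congrArg (fun z => h x z u) (curv_swap Γ x u (W x) (V x))
    simp only [map_neg, neg_apply] at t3
    have t4 : h x (covDeriv Γ W x u) u = 0 := by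
      have := hK x hx u u
      rw [hs u] at this
      linarith
    have t5 := hK x hx (covDeriv Γ V x u) u
    have t6 : h x (covDeriv Γ V x u) (covDeriv Γ W x u) +
        h x (covDeriv Γ V x (covDeriv Γ W x u)) u = 0 := by
      have e1 := hT x hx (u + covDeriv Γ W x u)
      have e2 := hT x hx u
      have e3 := hT x hx (covDeriv Γ W x u)
      simp only [map_add, add_apply] at e1
      rw [hs u (covDeriv Γ W x u), t4] at e1
      linarith
    rw [t4] at e0
    linarith
  have hW0 : W x ≠ 0 := by
    intro h0
    have := hW.unit x hx
    simp [h0] at this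
  obtain ⟨z, hz⟩ := exists_linearIndependent_pair hn hW0
  -- A nonzero u orthogonal to W exists because n ≥ 2, and for it the right side of `hdc` vanishes.
  have h1 : fderiv ℝ c x (W x) = 0 := by
    set u := z - h x (W x) z • W x with hu
    have hu0 : u ≠ 0 := by
      intro h0
      rw [LinearIndependent.pair_iff' hW0] at hz
      exact hz _ (sub_eq_zero.1 h0).symm
    have e1 := hdc u
    have e2 : h x (W x) u = 0 := by
      simp [hu, hW.unit x hx]
    rw [e2, mul_zero] at e1
    exact (mul_eq_zero.1 e1).resolve_right (hh.pos x hx u hu0).ne'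
  have h2 : ∀ u, h x (W x) u ≠ 0 → fderiv ℝ c x u = 0 := by
    intro u hu
    have := hdc u
    rw [h1, zero_mul] at this
    exact (mul_eq_zero.1 this.symm).resolve_right hu
  ext u
  by_cases hu : h x (W x) u = 0
  · have := h2 (u + W x) (by simp [hu, hW.unit x hx])
    simpa [h1] using this
  · simpa using h2 u hu

end ConformalFieldsOfKropina

/-! ### Metrics, forms and fields in charts. -/

section Pullback

/-- W is the image of f under the inverse of the metric, and inversion is smooth. This gives
smoothness of the dual field, which is defined pointwise. -/
theorem IsMetric.contDiffOn_of_lower {E : Type*} [NormedAddCommGroup E] [NormedSpace ℝ E]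
    [FiniteDimensional ℝ E] {U : Set E} {h : E → E →L[ℝ] E →L[ℝ] ℝ} (hh : IsMetric U h)
    {f : E → E →L[ℝ] ℝ} (hf : ContDiffOn ℝ ∞ f U) {W : E → E} (hW : ∀ x ∈ U, h x (W x) = f x) :
    ContDiffOn ℝ ∞ W U := by
  have key : ContDiffOn ℝ ∞ (fun x => ContinuousLinearMap.inverse (h x) (f x)) U := by
    intro x hx
    obtain ⟨e, he⟩ := hh.exists_equiv hx
    have h1 : ContDiffAt ℝ ∞ ContinuousLinearMap.inverse (h x) := he ▸ contDiffAt_map_inverse e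
    exact (h1.comp_contDiffWithinAt x (hh.smooth x hx)).clm_apply (hf x hx)
  refine key.congr fun x hx => ?_
  obtain ⟨e, he⟩ := hh.exists_equiv hx
  rw [← hW x hx, ← he, ContinuousLinearMap.inverse_equiv]
  exact (e.symm_apply_apply (W x)).symm

variable {n : ℕ} {M : Type*} [TopologicalSpace M] [ChartedSpace (Model n) M]

/-- The derivative of the inverse of a chart. -/
def symmDeriv (e : OpenPartialHomeomorph M (Model n)) (u : Model n) :
    Model n →L[ℝ] TSpace n (e.symm u) :=
  mfderiv 𝓘(ℝ, Model n) 𝓘(ℝ, Model n) e.symm u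

/-- The components of a vector field in a chart. -/
def chartField (e : OpenPartialHomeomorph M (Model n)) (V : ∀ x : M, TSpace n x) (u : Model n) :
    Model n :=
  coordVec e (e.symm u) (V (e.symm u))

/-- The components of a 1-form in a chart. -/
def chartForm (e : OpenPartialHomeomorph M (Model n)) (β : ∀ x : M, TSpace n x →L[ℝ] ℝ)
    (u : Model n) : Model n →L[ℝ] ℝ :=
  (β (e.symm u)).comp (symmDeriv e u)

variable [IsManifold 𝓘(ℝ, Model n) ∞ M]

/-- The components of a Riemannian metric in a chart. -/
def chartMetric (e : OpenPartialHomeomorph M (Model n)) (a : RMetric n M) (u : Model n) :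
    Model n →L[ℝ] Model n →L[ℝ] ℝ :=
  let B : Model n →L[ℝ] Model n →L[ℝ] ℝ := a.inner (e.symm u)
  let D : Model n →L[ℝ] Model n := symmDeriv e u
  B.bilinearComp D D

theorem chartMetric_apply (e : OpenPartialHomeomorph M (Model n)) (a : RMetric n M)
    (u v w : Model n) :
    chartMetric e a u v w = a.inner (e.symm u) (symmDeriv e u v) (symmDeriv e u w) := rfl

variable {e : OpenPartialHomeomorph M (Model n)} (he : e ∈ smoothCharts n M)

include he

omit [IsManifold 𝓘(ℝ, Model n) ∞ M] in
theorem mem_maximalAtlas_one : e ∈ IsManifold.maximalAtlas 𝓘(ℝ, Model n) 1 M :=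
  IsManifold.maximalAtlas_subset_of_le (by norm_num) he

omit [IsManifold 𝓘(ℝ, Model n) ∞ M] in
theorem smoothCharts_mdifferentiable :
    e.MDifferentiable 𝓘(ℝ, Model n) 𝓘(ℝ, Model n) :=
  ⟨fun _ hx => (mdifferentiableAt_of_mem_maximalAtlas (mem_maximalAtlas_one he) hx).mdifferentiableWithinAt,
   fun _ hx => (mdifferentiableAt_symm_of_mem_maximalAtlas (mem_maximalAtlas_one he)
    hx).mdifferentiableWithinAt⟩

omit [IsManifold 𝓘(ℝ, Model n) ∞ M] in
theorem coordVec_symmDeriv {u : Model n} (hu : u ∈ e.target) (y : Model n) :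
    coordVec e (e.symm u) (symmDeriv e u y) = y := by
  have := (smoothCharts_mdifferentiable he).comp_symm_deriv hu
  exact congrArg (fun L => L y) this

omit [IsManifold 𝓘(ℝ, Model n) ∞ M] in
theorem symmDeriv_coordVec {u : Model n} (hu : u ∈ e.target) (v : TSpace n (e.symm u)) :
    symmDeriv e u (coordVec e (e.symm u) v) = v := by
  have h0 := (smoothCharts_mdifferentiable he).symm_comp_deriv (e.map_target hu)
  have h1 := congrArg (fun L => L v) h0
  rw [e.right_inv hu] at h1
  exact h1

omit [IsManifold 𝓘(ℝ, Model n) ∞ M] in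
theorem symmDeriv_injective {u : Model n} (hu : u ∈ e.target) :
    Function.Injective (symmDeriv e u) :=
  fun v w hvw => by rw [← coordVec_symmDeriv he hu v, hvw, coordVec_symmDeriv he hu]

/-- The tangent map of the inverse chart applied to a constant field. Pairing such sections with
forms and metrics gives smooth components. -/
theorem contMDiffOn_symmDeriv (y : Model n) :
    ContMDiffOn 𝓘(ℝ, Model n) (𝓘(ℝ, Model n).prod 𝓘(ℝ, Model n)) ∞
      (fun u => TotalSpace.mk' (Model n) (E := fun x : M => TangentSpace 𝓘(ℝ, Model n) x)
        (e.symm u) (symmDeriv e u y)) e.target := by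
  have h1 := (contMDiffOn_symm_of_mem_maximalAtlas he).contMDiffOn_tangentMapWithin (m := ∞)
    (by simp) e.open_target.uniqueMDiffOn
  have h2 : ContMDiff 𝓘(ℝ, Model n) (𝓘(ℝ, Model n).prod 𝓘(ℝ, Model n)) ∞
      (fun u => (⟨u, y⟩ : TangentBundle 𝓘(ℝ, Model n) (Model n))) :=
    contMDiff_vectorSpace_iff_contDiff.2 contDiff_const
  refine (h1.comp h2.contMDiffOn (fun u hu => hu)).congr fun u hu => ?_
  exact (tangentMapWithin_eq_tangentMap (p := ⟨u, y⟩) (e.open_target.uniqueMDiffWithinAt hu)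
    (mdifferentiableAt_symm_of_mem_maximalAtlas (mem_maximalAtlas_one he) hu)).symm

theorem contDiffOn_chartForm {β : ∀ x : M, TSpace n x →L[ℝ] ℝ} (hβ : IsSmoothForm β) :
    ContDiffOn ℝ ∞ (chartForm e β) e.target := by
  refine contDiffOn_clm_apply.2 fun y => contMDiffOn_iff_contDiffOn.1 ?_
  have h1 := hβ.comp_contMDiffOn (contMDiffOn_symm_of_mem_maximalAtlas he)
  have h2 := ContMDiffOn.clm_bundle_apply (F₁ := Model n) (F₂ := ℝ)
    (E₁ := fun x : M => TangentSpace 𝓘(ℝ, Model n) x)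
    (E₂ := Bundle.Trivial M ℝ) (b := e.symm) (ϕ := fun u => β (e.symm u))
    (v := fun u => symmDeriv e u y) h1 (contMDiffOn_symmDeriv he y)
  intro u hu
  exact (Bundle.contMDiffWithinAt_totalSpace.1 (h2 u hu)).2

theorem contDiffOn_chartMetric (a : RMetric n M) :
    ContDiffOn ℝ ∞ (chartMetric e a) e.target := by
  refine contDiffOn_clm_apply.2 fun y => contDiffOn_clm_apply.2 fun z =>
    contMDiffOn_iff_contDiffOn.1 ?_
  have h1 := a.contMDiff.comp_contMDiffOn (contMDiffOn_symm_of_mem_maximalAtlas he)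
  have h2 := ContMDiffOn.clm_bundle_apply₂ (F₁ := Model n) (F₂ := Model n) (F₃ := ℝ)
    (E₁ := fun x : M => TangentSpace 𝓘(ℝ, Model n) x)
    (E₂ := fun x : M => TangentSpace 𝓘(ℝ, Model n) x)
    (E₃ := Bundle.Trivial M ℝ) (b := e.symm) (ψ := fun u => a.inner (e.symm u))
    (v := fun u => symmDeriv e u y) (w := fun u => symmDeriv e u z) h1
    (contMDiffOn_symmDeriv he y) (contMDiffOn_symmDeriv he z)
  intro u hu
  exact (Bundle.contMDiffWithinAt_totalSpace.1 (h2 u hu)).2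

theorem contDiffOn_chartField {V : ∀ x : M, TSpace n x} (hV : IsSmoothField V) :
    ContDiffOn ℝ ∞ (chartField e V) e.target := by
  have h1 := (contMDiffOn_of_mem_maximalAtlas he).contMDiffOn_tangentMapWithin (m := ∞)
    (by simp) e.open_source.uniqueMDiffOn
  have h2 := hV.comp_contMDiffOn (contMDiffOn_symm_of_mem_maximalAtlas he)
  have h3 := h1.comp h2 (fun u hu => e.map_target hu)
  refine contMDiffOn_vectorSpace_iff_contDiffOn.1 (h3.congr fun u hu => ?_)
  have h4 := tangentMapWithin_eq_tangentMap (p := ⟨e.symm u, V (e.symm u)⟩)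
    (e.open_source.uniqueMDiffWithinAt (e.map_target hu))
    (mdifferentiableAt_of_mem_maximalAtlas (mem_maximalAtlas_one he) (e.map_target hu))
  refine Eq.trans ?_ h4.symm
  exact congrArg (fun z : Model n =>
    (⟨z, chartField e V u⟩ : TangentBundle 𝓘(ℝ, Model n) (Model n))) (e.right_inv hu).symm

end Pullback

/-! ### The normalized metric and form in a chart. -/

section NormalizedChart

variable {n : ℕ} {M : Type*} [TopologicalSpace M] [ChartedSpace (Model n) M]
  [IsManifold 𝓘(ℝ, Model n) ∞ M]

/-- The components of the normalized metric `α / b` in a chart. -/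
def normChartMetric (e : OpenPartialHomeomorph M (Model n)) (a : RMetric n M)
    (β : ∀ x : M, TSpace n x →L[ℝ] ℝ) (u : Model n) : Model n →L[ℝ] Model n →L[ℝ] ℝ :=
  (normSq a β (e.symm u))⁻¹ • chartMetric e a u

theorem normChartMetric_apply (e : OpenPartialHomeomorph M (Model n)) (a : RMetric n M)
    (β : ∀ x : M, TSpace n x →L[ℝ] ℝ) (u v w : Model n) : normChartMetric e a β u v w =
      (normSq a β (e.symm u))⁻¹ * a.inner (e.symm u) (symmDeriv e u v) (symmDeriv e u w) := rfl

/-- The components in a chart of the unit vector field dual to the normalized 1-form. -/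
abbrev dualField (e : OpenPartialHomeomorph M (Model n)) (a : RMetric n M)
    (β : ∀ x : M, TSpace n x →L[ℝ] ℝ) : Model n → Model n :=
  chartField e (sharp a β)

variable {a : RMetric n M} {β : ∀ x : M, TSpace n x →L[ℝ] ℝ}

theorem normSq_pos (hβ0 : ∀ x, β x ≠ 0) (x : M) : 0 < normSq a β x := by
  rw [normSq, ← inner_sharp a]
  refine a.pos x _ fun h => hβ0 x ?_
  ext v
  rw [← inner_sharp a, h]
  simp

variable {e : OpenPartialHomeomorph M (Model n)} (he : e ∈ smoothCharts n M)

include he in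
theorem isMetric_chartMetric : IsMetric e.target (chartMetric e a) where
  isOpen := e.open_target
  smooth := contDiffOn_chartMetric he a
  symm u _ v w := by rw [chartMetric_apply, chartMetric_apply, a.symm]
  pos u hu v hv := by
    rw [chartMetric_apply]
    refine a.pos _ _ fun h => hv (symmDeriv_injective he hu ?_)
    rw [h, map_zero]

include he in
theorem chartMetric_dualField {u : Model n} (hu : u ∈ e.target) (y : Model n) :
    chartMetric e a u (dualField e a β u) y = chartForm e β u y := by
  rw [chartMetric_apply, dualField, chartField, symmDeriv_coordVec he hu, inner_sharp]
  rfl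

variable (hβ : IsSmoothForm β) (hβ0 : ∀ x, β x ≠ 0)

include he hβ in
theorem contDiffOn_dualField : ContDiffOn ℝ ∞ (dualField e a β) e.target :=
  (isMetric_chartMetric he (a := a)).contDiffOn_of_lower (contDiffOn_chartForm he hβ)
    fun _ hu => ContinuousLinearMap.ext (chartMetric_dualField he hu)

include he hβ in
theorem contDiffOn_normSq : ContDiffOn ℝ ∞ (fun u => normSq a β (e.symm u)) e.target := by
  refine ((contDiffOn_chartForm he hβ).clm_apply (contDiffOn_dualField he hβ (a := a))).congr
    fun u hu => ?_
  change _ = β (e.symm u) (symmDeriv e u (coordVec e (e.symm u) (sharp a β (e.symm u))))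
  rw [symmDeriv_coordVec he hu, normSq]

include he hβ hβ0 in
theorem isMetric_normChartMetric : IsMetric e.target (normChartMetric e a β) where
  isOpen := e.open_target
  smooth := ((contDiffOn_normSq he hβ).inv fun _ _ => (normSq_pos hβ0 _).ne').smul
    (contDiffOn_chartMetric he a)
  symm u hu v w := congrArg _ ((isMetric_chartMetric he).symm u hu v w)
  pos u hu v hv := mul_pos (inv_pos.2 (normSq_pos hβ0 _))
    ((isMetric_chartMetric he).pos u hu v hv)

include he in
theorem normChartMetric_dualField {u : Model n} (hu : u ∈ e.target) (y : Model n) :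
    normChartMetric e a β u (dualField e a β u) y = inChart e (normForm a β) u y := by
  change (normSq a β (e.symm u))⁻¹ * chartMetric e a u _ y = _
  rw [chartMetric_dualField he hu, inv_mul_eq_div]
  rfl

include he hβ hβ0 in
theorem isUnitField_dualField :
    IsUnitField e.target (normChartMetric e a β) (dualField e a β) where
  smooth := contDiffOn_dualField he hβ
  unit u hu := by
    rw [normChartMetric_dualField he hu]
    change β (e.symm u) (symmDeriv e u (coordVec e (e.symm u) (sharp a β (e.symm u)))) / _ = 1
    rw [symmDeriv_coordVec he hu]
    exact div_self (normSq_pos hβ0 _).ne'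

include he hβ0 in
-- Dividing both α² and β by b² leaves their quotient unchanged, so F is the Kropina metric of a
-- unit form.
theorem inChart_kropina {u : Model n} (hu : u ∈ e.target) (y : Model n) :
    inChart e (kropina a β) u y = normChartMetric e a β u y y /
      normChartMetric e a β u (dualField e a β u) y := by
  rw [normChartMetric_dualField he hu, normChartMetric_apply, inv_mul_eq_div]
  exact (div_div_div_cancel_right₀ (normSq_pos hβ0 _).ne' _ _).symm

include he hβ hβ0 in
theorem energy_normMetric {u : Model n} (hu : u ∈ e.target) (y : Model n) :
    energy (inChart e (normMetric a β)) u y = normChartMetric e a β u y y := by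
  have h0 : 0 ≤ normChartMetric e a β u y y := by
    rcases eq_or_ne y 0 with rfl | hy
    · simp
    · exact ((isMetric_normChartMetric he hβ hβ0).pos u hu y hy).le
  rw [normChartMetric_apply, inv_mul_eq_div] at *
  exact Real.sq_sqrt h0

include he hβ0 in
theorem mem_kropinaDomain_iff {u : Model n} (hu : u ∈ e.target) (y : Model n) :
    (symmDeriv e u y ∈ kropinaDomain β (e.symm u)) ↔
      0 < normChartMetric e a β u (dualField e a β u) y := by
  rw [normChartMetric_dualField he hu]
  exact (div_pos_iff_of_pos_right (normSq_pos hβ0 _)).symm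

theorem linearIndependent_pair_of_injective {E F : Type*} [AddCommGroup E] [Module ℝ E]
    [AddCommGroup F] [Module ℝ F] {L : E →ₗ[ℝ] F} (hL : Function.Injective L) {y w : E}
    (h : LinearIndependent ℝ ![y, w]) : LinearIndependent ℝ ![L y, L w] := by
  rw [LinearIndependent.pair_iff] at *
  intro s t hst
  exact h s t (hL (by simpa using hst))

include he in
theorem weakEinstein_inChart (hE : IsWeakEinstein (kropinaDomain β) (kropina a β))
    (hβ0 : ∀ x, β x ≠ 0) {u : Model n} (hu : u ∈ e.target) :
    ∃ (θ : Model n →L[ℝ] ℝ) (σ : ℝ), ∀ y,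
      0 < normChartMetric e a β u (dualField e a β u) y →
      ricci (inChart e (kropina a β)) u y = (n - 1) * (3 * θ y / inChart e (kropina a β) u y + σ) *
        inChart e (kropina a β) u y ^ 2 := by
  obtain ⟨θ, σ, H⟩ := hE
  refine ⟨chartForm e θ u, σ (e.symm u), fun y hy => ?_⟩
  have := H e he (e.symm u) (e.map_target hu) (symmDeriv e u y)
    ((mem_kropinaDomain_iff he hβ0 hu y).2 hy)
  rw [e.right_inv hu, coordVec_symmDeriv he hu] at this
  exact this

omit [IsManifold 𝓘(ℝ, Model n) ∞ M] in
include he in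
theorem flagCurvature_inChart {D : ∀ x : M, Set (TSpace n x)} {F : ∀ x : M, TSpace n x → ℝ}
    {κ : ℝ} (hE : HasConstFlagCurvature D F κ) {u : Model n} (hu : u ∈ e.target) (y w : Model n)
    (hy : symmDeriv e u y ∈ D (e.symm u)) (hw : LinearIndependent ℝ ![y, w]) :
    flagCurvature (inChart e F) u y w = κ := by
  have := hE e he (e.symm u) (e.map_target hu) (symmDeriv e u y) hy (symmDeriv e u w)
    (linearIndependent_pair_of_injective (L := (symmDeriv e u).toLinearMap)
      (symmDeriv_injective he hu) hw)
  rwa [e.right_inv hu, coordVec_symmDeriv he hu, coordVec_symmDeriv he hu] at this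

variable {Γ : Model n → Model n →L[ℝ] Model n →L[ℝ] Model n}

include he hβ hβ0 in
-- Differentiating h(W,y) in x along y gives h(Sy,y) + 2h(W,Γ(y,y)), and the spray term of r₀₀
-- removes the second summand.
theorem symmCovDeriv_inChart (hΓ : IsChristoffel e.target (normChartMetric e a β) Γ) {u : Model n}
    (hu : u ∈ e.target) (y : Model n) :
    symmCovDeriv (inChart e (normMetric a β)) (inChart e (normForm a β)) u y =
      normChartMetric e a β u (covDeriv Γ (dualField e a β) u y) y := by
  have hh := isMetric_normChartMetric he hβ hβ0 (a := a)
  have hW := isUnitField_dualField he hβ hβ0 (a := a)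
  have hB : ∀ η, ∀ z ∈ e.target, inChart e (normForm a β) z η =
      normChartMetric e a β z (dualField e a β z) η :=
    fun η z hz => (normChartMetric_dualField he hz η).symm
  have hs : ∀ k, spray (inChart e (normMetric a β)) k u y = Γ u y y k :=
    spray_riemannian hh (fun z hz η => energy_normMetric he hβ hβ0 hz η) hΓ hu y
  have e1 : fderiv ℝ (fun z => inChart e (normForm a β) z y) u y =
      normChartMetric e a β u (covDeriv Γ (dualField e a β) u y) y +
        2 * normChartMetric e a β u (dualField e a β u) (Γ u y y) := by
    have hd : DifferentiableAt ℝ (fun z => inChart e (normForm a β) z y) u := by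
      refine differentiableAt_of_contDiffOn e.open_target ?_ hu
      exact ((hh.smooth.clm_apply hW.smooth).clm_apply contDiffOn_const).congr (hB y)
    exact hasDerivAt_line_unique e.open_target hu (hB y) (hasDerivAt_line hd y)
      (hasDerivAt_form_fst hh hW hΓ hu y y)
  have e2 : fderiv ℝ (fun z => inChart e (normForm a β) u z) y =
      normChartMetric e a β u (dualField e a β u) := by
    have : (fun z => inChart e (normForm a β) u z) =
      normChartMetric e a β u (dualField e a β u) := funext fun z => hB z u hu
    rw [this, ContinuousLinearMap.fderiv]
  rw [symmCovDeriv, sum_mul_dX, e1]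
  simp only [hs]
  have : (∑ k, Γ u y y k * dY k (inChart e (normForm a β)) u y) =
      normChartMetric e a β u (dualField e a β u) (Γ u y y) := by
    rw [sum_mul_dY]
    exact congrArg (fun L => L (Γ u y y)) e2
  rw [this]
  ring

end NormalizedChart

open Metric

/-! ### Charts in which the metric has the model form. -/

section ModelChart

theorem exists_restrict_target {E F : Type*} [TopologicalSpace E] [TopologicalSpace F]
    (g : OpenPartialHomeomorph E F) {s : Set F} (hs : IsOpen s) (hsub : s ⊆ g.target) :
    ∃ g' : OpenPartialHomeomorph E F, (g' : E → F) = g ∧ (g'.symm : F → E) = g.symm ∧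
      g'.source ⊆ g.source ∧ g'.target = s := by
  refine ⟨(g.symm.restrOpen s hs).symm, rfl, rfl, ?_, ?_⟩
  · intro x hx
    have := ((g.symm.restrOpen s hs).symm).map_source hx
    have h2 : g x ∈ g.target := this.1
    have h3 := ((g.symm.restrOpen s hs).symm).left_inv hx
    have h4 : g.symm (g x) = x := h3
    rw [← h4]
    exact g.map_target h2
  · simpa using hsub

/-- The inverse function theorem, shrunk until the image is a ball around the origin; the later
uniqueness arguments run along rays of that ball. -/
theorem exists_smooth_local_inverse {n : ℕ} {X : Model n → Model n} {p : Model n} {ε : ℝ}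
    (hε : 0 < ε) (hX : ContDiffOn ℝ ∞ X (ball p ε)) (hXp : X p = 0)
    (hinj : ∀ x ∈ ball p ε, ∀ v, fderiv ℝ X x v = 0 → v = 0) :
    ∃ (g : OpenPartialHomeomorph (Model n) (Model n)) (r : ℝ), 0 < r ∧ p ∈ g.source ∧
      g.source ⊆ ball p ε ∧ (g : Model n → Model n) = X ∧ g.target = ball 0 r ∧
      ContDiffOn ℝ ∞ g g.source ∧ ContDiffOn ℝ ∞ g.symm g.target ∧
      ∀ u ∈ g.target, ∀ v, fderiv ℝ X (g.symm u) (fderiv ℝ g.symm u v) = v := by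
  have hequiv : ∀ x ∈ ball p ε, ∃ L : Model n ≃L[ℝ] Model n, HasFDerivAt X (L : Model n →L[ℝ] Model n) x := by
    intro x hx
    have hi : Function.Injective (fderiv ℝ X x).toLinearMap :=
      (injective_iff_map_eq_zero _).2 fun v hv => hinj x hx v hv
    refine ⟨(LinearEquiv.ofInjectiveEndo _ hi).toContinuousLinearEquiv, ?_⟩
    exact (differentiableAt_of_contDiffOn isOpen_ball hX hx).hasFDerivAt.congr_fderiv
      (ContinuousLinearMap.ext fun v => by simp)
  have hcd : ∀ x ∈ ball p ε, ContDiffAt ℝ ∞ X x :=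
    fun x hx => hX.contDiffAt (isOpen_ball.mem_nhds hx)
  obtain ⟨L, hL⟩ := hequiv p (mem_ball_self hε)
  obtain ⟨g₀, hg₀, hp₀⟩ : ∃ g₀ : OpenPartialHomeomorph (Model n) (Model n),
      (g₀ : Model n → Model n) = X ∧ p ∈ g₀.source :=
    ⟨(hcd p (mem_ball_self hε)).toOpenPartialHomeomorph X hL (by simp),
      ContDiffAt.toOpenPartialHomeomorph_coe _ _ _,
      (hcd p (mem_ball_self hε)).mem_toOpenPartialHomeomorph_source hL (by simp)⟩
  subst hg₀
  let g₁ := g₀.restrOpen (ball p ε) isOpen_ball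
  have hp₁ : p ∈ g₁.source := ⟨hp₀, mem_ball_self hε⟩
  have h0 : (0 : Model n) ∈ g₁.target := by
    rw [← hXp]
    exact g₁.map_source hp₁
  obtain ⟨r, hr, hrs⟩ := Metric.isOpen_iff.1 g₁.open_target 0 h0
  obtain ⟨g, hg, hgs, hsub, htar⟩ := exists_restrict_target g₁ isOpen_ball hrs
  have hg₁ : (g : Model n → Model n) = g₀ := hg
  have hball : ∀ u ∈ g.target, g.symm u ∈ ball p ε := fun u hu => (hsub (g.map_target hu)).2
  have hsymm : ∀ u ∈ g.target, ContDiffAt ℝ ∞ g.symm u := by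
    intro u hu
    obtain ⟨L, hL⟩ := hequiv _ (hball u hu)
    rw [← hg₁] at hL
    exact g.contDiffAt_symm hu hL (hg₁ ▸ hcd _ (hball u hu))
  refine ⟨g, r, hr, ?_, fun x hx => (hsub hx).2, hg₁, htar,
    fun x hx => hg₁ ▸ (hcd x (hsub hx).2).contDiffWithinAt, fun u hu => (hsymm u hu).contDiffWithinAt,
    fun u hu v => ?_⟩
  · have : (0 : Model n) ∈ g.target := htar ▸ mem_ball_self hr
    have h2 := g.map_target this
    have h3 : g.symm 0 = p := by
      have := g₁.left_inv hp₁
      rw [← this]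
      rw [hgs]
      exact congrArg g₁.symm hXp.symm
    rwa [h3] at h2
  · have h1 := (((hcd _ (hball u hu)).differentiableAt (by simp)).hasFDerivAt.comp u
      ((hsymm u hu).differentiableAt (by simp)).hasFDerivAt)
    have h2 : (g₀ ∘ g.symm) =ᶠ[𝓝 u] id := by
      filter_upwards [g.open_target.mem_nhds hu] with z hz using hg₁ ▸ g.right_inv hz
    have h3 := (h1.congr_of_eventuallyEq h2.symm).unique (hasFDerivAt_id u)
    simpa using congrArg (fun T => T v) h3

variable {n : ℕ} {M : Type*} [TopologicalSpace M] [ChartedSpace (Model n) M]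
  [IsManifold 𝓘(ℝ, Model n) ∞ M] {a : RMetric n M} {β : ∀ x : M, TSpace n x →L[ℝ] ℝ}
  {e : OpenPartialHomeomorph M (Model n)} (he : e ∈ smoothCharts n M)
  {g : OpenPartialHomeomorph (Model n) (Model n)}

include he

theorem trans_mem_smoothCharts (hg : ContDiffOn ℝ ∞ g g.source)
    (hg' : ContDiffOn ℝ ∞ g.symm g.target) : e.trans g ∈ smoothCharts n M := by
  refine OpenPartialHomeomorph.mem_maximalAtlas_of_contMDiffOn (I := 𝓘(ℝ, Model n)) (n := ∞)
    (e.trans g) ?_ ?_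
  · exact hg.contMDiffOn.comp ((contMDiffOn_of_mem_maximalAtlas he).mono fun x hx => hx.1)
      fun x hx => hx.2
  · exact (contMDiffOn_symm_of_mem_maximalAtlas he).comp (hg'.contMDiffOn.mono fun x hx => hx.1)
      fun x hx => hx.2

omit [IsManifold 𝓘(ℝ, Model n) ∞ M] in
theorem symmDeriv_trans (hg' : ContDiffOn ℝ ∞ g.symm g.target) {u : Model n}
    (hu : u ∈ (e.trans g).target) (v : Model n) :
    symmDeriv (e.trans g) u v = symmDeriv e (g.symm u) (fderiv ℝ g.symm u v) := by
  have h1 : MDifferentiableAt 𝓘(ℝ, Model n) 𝓘(ℝ, Model n) e.symm (g.symm u) :=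
    mdifferentiableAt_symm_of_mem_maximalAtlas (mem_maximalAtlas_one he) hu.2
  have h2 : DifferentiableAt ℝ g.symm u := differentiableAt_of_contDiffOn g.open_target hg' hu.1
  have h3 := mfderiv_comp u h1 h2.mdifferentiableAt
  have h4 := congrArg (fun L => L v) h3
  rw [mfderiv_eq_fderiv] at h4
  exact h4

theorem normChartMetric_trans (hg' : ContDiffOn ℝ ∞ g.symm g.target) {u : Model n}
    (hu : u ∈ (e.trans g).target) (v w : Model n) :
    normChartMetric (e.trans g) a β u v w =
      normChartMetric e a β (g.symm u) (fderiv ℝ g.symm u v) (fderiv ℝ g.symm u w) := by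
  rw [normChartMetric_apply, normChartMetric_apply, symmDeriv_trans he hg' hu, symmDeriv_trans he hg' hu]
  rfl

theorem exists_model_chart (hβ : IsSmoothForm β) (hβ0 : ∀ x, β x ≠ 0)
    {Γ : Model n → Model n →L[ℝ] Model n →L[ℝ] Model n} {μ : ℝ}
    (hΓ : IsChristoffel e.target (normChartMetric e a β) Γ)
    (hc : ∀ x ∈ e.target, ∀ u v z, curv Γ x u v z =
      μ • (normChartMetric e a β x v z • u - normChartMetric e a β x u z • v))
    {p : M} (hp : p ∈ e.source) :
    ∃ e' ∈ smoothCharts n M, p ∈ e'.source ∧ e' p = 0 ∧ ∃ r, 0 < r ∧ e'.target = ball 0 r ∧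
      ∀ u ∈ e'.target, 0 < 1 + μ * ‖u‖ ^ 2 ∧ ∀ v w,
        normChartMetric e' a β u v w = 4 * inner ℝ v w / (1 + μ * ‖u‖ ^ 2) ^ 2 := by
  have hh := isMetric_normChartMetric he hβ hβ0 (a := a)
  obtain ⟨ε, hε, hsub, X, hX, hXp, hXm⟩ :=
    exists_model_coordinates hh hΓ (e.map_source hp) hc
  obtain ⟨g, r, hr, hpg, hgs, hgX, hgt, hg, hg', hD⟩ :=
    exists_smooth_local_inverse hε hX hXp (by
      intro x hx v hv
      by_contra hne
      have h1 := hh.pos x (hsub hx) v hne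
      rw [(hXm x hx).2, hv] at h1
      simp at h1)
  have ht : (e.trans g).target = ball 0 r := by
    rw [e.trans_target, hgt]
    refine inter_eq_left.2 fun u hu => hsub (hgs (g.map_target ?_))
    rwa [hgt]
  refine ⟨e.trans g, trans_mem_smoothCharts he hg hg', ⟨hp, hpg⟩, ?_, r, hr, ht, fun u hu => ?_⟩
  · change g (e p) = 0
    rw [hgX, hXp]
  · have hb : g.symm u ∈ ball (e p) ε := hgs (g.map_target hu.1)
    have hXu : X (g.symm u) = u := by rw [← hgX, g.right_inv hu.1]
    obtain ⟨h1, h2⟩ := hXm _ hb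
    rw [hXu] at h1
    refine ⟨h1, fun v w => ?_⟩
    rw [normChartMetric_trans he hg' hu, h2, hXu, hD u hu.1, hD u hu.1]

end ModelChart

/-! ### Conformal fields of the model metric. -/

section ModelMetric

variable {n : ℕ} {U : Set (Model n)} {h : Model n → Model n →L[ℝ] Model n →L[ℝ] ℝ}
  {Γ : Model n → Model n →L[ℝ] Model n →L[ℝ] Model n} {μ r : ℝ} {V W : Model n → Model n}
  (hh : IsMetric U h) (hΓ : IsChristoffel U h Γ)
  (hm : ∀ u ∈ U, 0 < 1 + μ * ‖u‖ ^ 2 ∧ ∀ v w, h u v w = 4 * inner ℝ v w / (1 + μ * ‖u‖ ^ 2) ^ 2)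

theorem inner_add_left_div {A B C N c : ℝ} (hN : 0 < N)
    (H : 4 * A / N ^ 2 + 1 / 2 * (-(8 * B) * (2 * C) / N ^ 3) = 2 * c * (4 * B / N ^ 2)) :
    A = (2 * c + 2 * C / N) * B := by
  have hN' := hN.ne'
  field_simp at H ⊢
  linarith

include hh hΓ hm in
-- A field conformal for the model metric is conformal for the Euclidean one. The derivative along V
-- of the factor 4/(1 + μ|x|²)² accounts for the additional term in `modelFactor`.
theorem inner_fderiv_of_model_conformal {x : Model n} (hx : x ∈ U) {c : ℝ}
    (hT : ∀ y, h x (covDeriv Γ V x y) y = 2 * c * h x y y) (y : Model n) :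
    inner ℝ (fderiv ℝ V x y) y = modelFactor μ c V x * ‖y‖ ^ 2 := by
  obtain ⟨hN, hmx⟩ := hm x hx
  have e1 : fderiv ℝ h x (V x) y y = -(8 * ‖y‖ ^ 2) * (2 * (μ * inner ℝ x (V x))) /
      (1 + μ * ‖x‖ ^ 2) ^ 3 := by
    have d1 := hasDerivAt_norm_fst (hh.differentiableAt hx) (V x) y
    have d2 := ((hasDerivAt_line_id x (V x)).norm_sq.const_mul μ).const_add 1
    have d3 := (hasDerivAt_const_smooth (4 * inner ℝ y y)).fun_div (d2.fun_pow 2)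
      (by simpa using (pow_pos hN 2).ne')
    refine hasDerivAt_line_unique hh.isOpen hx (fun z hz => (hm z hz).2 y y) d1 (d3.congr_deriv ?_)
    have hN' := hN.ne'
    simp only [zero_smul, add_zero, real_inner_self_eq_norm_sq]
    field_simp
    ring
  have e2 := hΓ.compat x hx (V x) y y
  have e3 := hh.symm x hx y (Γ x (V x) y)
  have e4 := hT y
  rw [covDeriv_apply, map_add, map_smul, add_apply, smul_apply, hΓ.symm x hx y,
    hmx (fderiv ℝ V x y), hmx y y] at e4
  rw [real_inner_self_eq_norm_sq] at e4
  rw [modelFactor]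
  have := inner_add_left_div (A := inner ℝ (fderiv ℝ V x y) y) (B := ‖y‖ ^ 2)
    (C := μ * inner ℝ x (V x)) (c := c) hN (by
      rw [← e1, e2]
      simp only [smul_eq_mul] at e4
      linarith)
  rw [this]
  ring

include hh hΓ hm in
-- A Killing field is the case k = 0 of the homothetic classification, and its unit length is then
-- the hypothesis of `unit_modelField_relations`.
theorem unit_killing_eq_modelField (hU : U = ball 0 r) (hr : 0 < r) (hW : IsUnitField U h W)
    (hK : ∀ x ∈ U, ∀ y, h x (covDeriv Γ W x y) y = 0) :
    IsSkew (fderiv ℝ W 0) ∧ (∀ x ∈ U, W x = modelField μ (W 0) (fderiv ℝ W 0) x) ∧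
      ‖W 0‖ = 1 / 2 ∧ fderiv ℝ W 0 (W 0) = 0 ∧
      ∀ u, fderiv ℝ W 0 (fderiv ℝ W 0 u) = -(μ • (u - (4 * inner ℝ (W 0) u) • W 0)) := by
  subst hU
  have H : ∀ x ∈ ball (0 : Model n) r, ∀ y, inner ℝ (fderiv ℝ W x y) y =
      modelFactor μ 0 W x * ‖y‖ ^ 2 := fun x hx y =>
    inner_fderiv_of_model_conformal hh hΓ hm hx (fun y => by rw [hK x hx]; ring) y
  have hQ := skew_fderiv_homothetic_zero H hr
  have hz : fderiv ℝ W 0 - (2 * (0 : ℝ)) • ContinuousLinearMap.id ℝ (Model n) = fderiv ℝ W 0 := by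
    rw [mul_zero]
    exact ContinuousLinearMap.ext fun v => by simp
  have hWm : ∀ x ∈ ball (0 : Model n) r, W x = modelField μ (W 0) (fderiv ℝ W 0) x := by
    intro x hx
    have := homothetic_eq_modelField hW.smooth (fun x hx => (hm x hx).1) H (mul_zero μ) hx
    rwa [hz, mul_zero, zero_smul, zero_add] at this
  have hQ' : IsSkew (fderiv ℝ W 0) := by
    rw [← hz]
    exact hQ
  refine ⟨hQ', hWm, unit_modelField_relations hr hQ' fun x hx => ?_⟩
  have h1 := hW.unit x hx
  obtain ⟨hN, h2⟩ := hm x hx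
  rw [h2, real_inner_self_eq_norm_sq, div_eq_one_iff_eq (pow_pos hN 2).ne'] at h1
  rw [← hWm x hx, h1]

include hh hΓ hm in
theorem conformal_eq_modelField (hn : 2 ≤ n) (hU : U = ball 0 r) (hr : 0 < r)
    (hW : IsUnitField U h W) (hK : ∀ x ∈ U, ∀ y, h x (covDeriv Γ W x y) y = 0)
    (hV : ContDiffOn ℝ ∞ V U) {k : ℝ}
    (hT : ∀ x ∈ U, ∀ y, h x (covDeriv Γ V x y) y = 2 * k * h x y y)
    (hB : ∀ x ∈ U, covDeriv Γ W x (V x) - covDeriv Γ V x (W x) = -(2 * k) • W x) :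
    μ * k = 0 ∧ ∃ Q, IsSkew Q ∧ Q (W 0) = fderiv ℝ W 0 (V 0) ∧
      (∀ u, fderiv ℝ W 0 (Q u) - Q (fderiv ℝ W 0 u) =
        (4 * μ) • ((inner ℝ (V 0) u) • W 0 - (inner ℝ (W 0) u) • V 0)) ∧
      ∀ x ∈ U, V x = (2 * k) • x + modelField μ (V 0) Q x := by
  obtain ⟨-, hWm, hδ, hPδ, hPP⟩ := unit_killing_eq_modelField hh hΓ hm hU hr hW hK
  subst hU
  have HW : ∀ x ∈ ball (0 : Model n) r, ∀ y, inner ℝ (fderiv ℝ W x y) y =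
      modelFactor μ 0 W x * ‖y‖ ^ 2 := fun x hx y =>
    inner_fderiv_of_model_conformal hh hΓ hm hx (fun y => by rw [hK x hx]; ring) y
  have HV : ∀ x ∈ ball (0 : Model n) r, ∀ y, inner ℝ (fderiv ℝ V x y) y =
      modelFactor μ k V x * ‖y‖ ^ 2 := fun x hx y =>
    inner_fderiv_of_model_conformal hh hΓ hm hx (hT x hx) y
  have hb : ∀ x ∈ ball (0 : Model n) r, fderiv ℝ W x (V x) - fderiv ℝ V x (W x) =
      -(2 * k) • W x := fun x hx => by
    rw [← hB x hx, covDeriv_apply, covDeriv_apply, hΓ.symm x hx (W x)]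
    abel
  have hN := fun x hx => (hm x hx).1
  have hQ := skew_fderiv_homothetic_zero HV hr
  obtain ⟨h1, h2, h3⟩ := homothetic_modelField_relations hn hr hN hW.smooth hV HW HV hb hδ hPδ hPP
    rfl
  exact ⟨h1, _, hQ, h2, h3, fun x hx => homothetic_eq_modelField hV hN HV h1 hx⟩

end ModelMetric

/-! ### First variation of the flow condition. -/

section Variation

/-- The derivative of a flow satisfies the linearized equation at time zero. -/
theorem hasDerivAt_fderiv_flow {E : Type*} [NormedAddCommGroup E] [NormedSpace ℝ E]
    {Ψ : ℝ × E → E} {V : E → E} {x : E} (hΨ : ContDiffAt ℝ ∞ Ψ (0, x))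
    (hV : ∀ᶠ z in 𝓝 x, HasDerivAt (fun t => Ψ (t, z)) (V z) 0)
    (hVd : DifferentiableAt ℝ V x) (y : E) :
    HasDerivAt (fun t => fderiv ℝ (fun z => Ψ (t, z)) x y) (fderiv ℝ V x y) 0 := by
  have hd : ∀ᶠ q in 𝓝 ((0 : ℝ), x), DifferentiableAt ℝ Ψ q :=
    ((hΨ.of_le (m := 1) (by simp)).eventually (by simp)).mono fun q hq => hq.differentiableAt (by simp)
  have hD : DifferentiableAt ℝ (fderiv ℝ Ψ) (0, x) :=
    (hΨ.fderiv_right (m := ∞) (by simp)).differentiableAt (by simp)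
  -- The claim is the exchange of the t-derivative with the x-derivative, that is, symmetry of the
  -- second derivative of the joint flow map.
  have hsymm := (hΨ.isSymmSndFDerivAt (by simp; exact WithTop.coe_le_coe.2 le_top)).eq
    ((1 : ℝ), (0 : E)) (0, y)
  have ht : HasDerivAt (fun t : ℝ => (t, x)) ((1 : ℝ), (0 : E)) 0 :=
    (hasDerivAt_id (0 : ℝ)).prodMk (hasDerivAt_const (0 : ℝ) x)
  have hs : HasDerivAt (fun s : ℝ => ((0 : ℝ), x + s • y)) ((0 : ℝ), y) 0 :=
    (hasDerivAt_const (0 : ℝ) (0 : ℝ)).prodMk (hasDerivAt_line_id x y)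
  have hs0 : ((0 : ℝ), x + (0 : ℝ) • y) = (0, x) := by simp
  have d1 : HasDerivAt (fun t : ℝ => fderiv ℝ Ψ (t, x) (0, y))
      (fderiv ℝ (fderiv ℝ Ψ) (0, x) (1, 0) (0, y)) 0 := by
    have := (hD.hasFDerivAt.comp_hasDerivAt (0 : ℝ) ht).clm_apply
      (hasDerivAt_const (0 : ℝ) ((0 : ℝ), y))
    simpa using this
  have d2 : HasDerivAt (fun s : ℝ => fderiv ℝ Ψ (0, x + s • y) (1, 0))
      (fderiv ℝ (fderiv ℝ Ψ) (0, x) (0, y) (1, 0)) 0 := by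
    have hD' : HasFDerivAt (fderiv ℝ Ψ) (fderiv ℝ (fderiv ℝ Ψ) (0, x)) (0, x + (0 : ℝ) • y) := by
      rw [hs0]
      exact hD.hasFDerivAt
    have := (hD'.comp_hasDerivAt (0 : ℝ) hs).clm_apply
      (hasDerivAt_const (0 : ℝ) ((1 : ℝ), (0 : E)))
    simpa using this
  have d3 : HasDerivAt (fun s : ℝ => fderiv ℝ Ψ (0, x + s • y) (1, 0)) (fderiv ℝ V x y) 0 := by
    refine (hasDerivAt_line hVd y).congr_of_eventuallyEq ?_
    have hc : Filter.Tendsto (fun s : ℝ => x + s • y) (𝓝 0) (𝓝 x) := by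
      have : ContinuousAt (fun s : ℝ => x + s • y) 0 := by fun_prop
      simpa [ContinuousAt] using this
    have hc' : Filter.Tendsto (fun s : ℝ => ((0 : ℝ), x + s • y)) (𝓝 0) (𝓝 (0, x)) :=
      tendsto_const_nhds.prodMk_nhds hc
    filter_upwards [hc.eventually hV, hc'.eventually hd] with s h1 h2
    have h3 := h2.hasFDerivAt.comp_hasDerivAt (0 : ℝ)
      ((hasDerivAt_id (0 : ℝ)).prodMk (hasDerivAt_const (0 : ℝ) (x + s • y)))
    exact h3.unique h1
  rw [← d2.unique d3, ← hsymm]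
  refine d1.congr_of_eventuallyEq ?_
  have hc : Filter.Tendsto (fun t : ℝ => (t, x)) (𝓝 0) (𝓝 (0, x)) :=
    Filter.tendsto_id.prodMk_nhds tendsto_const_nhds
  filter_upwards [hc.eventually hd] with t h1
  have h2 : HasFDerivAt (fun z => (t, z)) (ContinuousLinearMap.inr ℝ ℝ E) x :=
    hasFDerivAt_prodMk_right t x
  have h3 := (h1.hasFDerivAt.comp x h2).fderiv
  exact congrArg (fun T => T y) h3

variable {n : ℕ} {U : Set (Model n)} {h : Model n → Model n →L[ℝ] Model n →L[ℝ] ℝ}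
  {Γ : Model n → Model n →L[ℝ] Model n →L[ℝ] Model n} {W V : Model n → Model n} {x : Model n}
  (hh : IsMetric U h) (hW : IsUnitField U h W) (hΓ : IsChristoffel U h Γ)

include hh hW hΓ in
/-- The infinitesimal form of the conformality of a Kropina metric. -/
theorem kropina_first_variation (hx : x ∈ U) {γ Y : ℝ → Model n} {y : Model n} (hγ0 : γ 0 = x)
    (hγ : HasDerivAt γ (V x) 0) (hY0 : Y 0 = y) (hY : HasDerivAt Y (fderiv ℝ V x y) 0)
    {s : ℝ → ℝ} {c : ℝ} (hs : HasDerivAt s c 0) (hy : 0 < h x (W x) y)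
    (H : ∀ᶠ t in 𝓝 (0 : ℝ), 0 < h (γ t) (W (γ t)) (Y t) ∧
      h (γ t) (Y t) (Y t) / h (γ t) (W (γ t)) (Y t) =
        Real.exp (2 * s t) * (h x y y / h x (W x) y)) :
    2 * h x (covDeriv Γ V x y) y * h x (W x) y - h x y y * (h x (covDeriv Γ W x (V x)) y +
      h x (W x) (covDeriv Γ V x y)) = 2 * c * h x y y * h x (W x) y := by
  have hhx : HasFDerivAt h (fderiv ℝ h x) (γ 0) := hγ0 ▸ (hh.differentiableAt hx).hasFDerivAt
  have hWx : HasFDerivAt W (fderiv ℝ W x) (γ 0) :=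
    hγ0 ▸ (differentiableAt_of_contDiffOn hh.isOpen hW.smooth hx).hasFDerivAt
  have dh := hhx.comp_hasDerivAt (0 : ℝ) hγ
  have dW := hWx.comp_hasDerivAt (0 : ℝ) hγ
  have dA := (dh.clm_apply hY).clm_apply hY
  have dB := (dh.clm_apply dW).clm_apply hY
  have dE := (((hs.const_mul 2).exp).mul_const (h x y y / h x (W x) y)).fun_mul dB
  have hpos : 0 < h x y y := by
    refine hh.pos x hx y fun h0 => ?_
    simp [h0] at hy
  -- That the exponent vanishes at time zero is not assumed; it follows from the condition at t = 0,
  -- because F(y) is nonzero.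
  have hs0 : Real.exp (2 * s 0) = 1 := by
    have := H.self_of_nhds.2
    rw [hγ0, hY0] at this
    have h1 := div_pos hpos hy
    exact mul_right_cancel₀ h1.ne' (by rw [← this, one_mul])
  have hEq : (fun t => h (γ t) (Y t) (Y t)) =ᶠ[𝓝 0] fun t =>
      Real.exp (2 * s t) * (h x y y / h x (W x) y) * h (γ t) (W (γ t)) (Y t) := by
    filter_upwards [H] with t ht
    rw [← ht.2, div_mul_cancel₀ _ ht.1.ne']
  have key := dA.unique (dE.congr_of_eventuallyEq hEq)
  have k1 := hΓ.compat x hx (V x) y y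
  have k2 := hΓ.compat x hx (V x) (W x) y
  have s1 := hh.symm x hx y (fderiv ℝ V x y)
  have s2 := hh.symm x hx y (Γ x (V x) y)
  simp only [Function.comp_apply, hγ0, hY0, add_apply, hs0, one_mul, k1, k2] at key
  simp only [covDeriv_apply, map_add, map_smul, add_apply, smul_apply, smul_eq_mul,
    hΓ.symm x hx y (V x)]
  have hy' := hy.ne'
  rw [s1, s2] at key
  field_simp at key
  linarith

end Variation

/-! ### Local flows in charts. -/

section ConformalField

variable {n : ℕ} {M : Type*} [TopologicalSpace M] [ChartedSpace (Model n) M]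

theorem inChart_coordVec {e : OpenPartialHomeomorph M (Model n)} (he : e ∈ smoothCharts n M)
    (F : ∀ x : M, TSpace n x → ℝ) {x : M} (hx : x ∈ e.source) (v : TSpace n x) :
    inChart e F (e x) (coordVec e x v) = F x v := by
  obtain ⟨u, hu, rfl⟩ : ∃ u ∈ e.target, e.symm u = x := ⟨e x, e.map_source hx, e.left_inv hx⟩
  rw [e.right_inv hu]
  exact congrArg (F (e.symm u)) (symmDeriv_coordVec he hu v)

theorem chartField_apply {e : OpenPartialHomeomorph M (Model n)} (V : ∀ x : M, TSpace n x) {x : M}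
    (hx : x ∈ e.source) : chartField e V (e x) = coordVec e x (V x) :=
  congrArg (fun z => (coordVec e z (V z) : Model n)) (e.left_inv hx)

/-- A local flow in a chart. -/
def chartFlow (e : OpenPartialHomeomorph M (Model n)) (φ : ℝ → M → M) (q : ℝ × Model n) :
    Model n :=
  e (φ q.1 (e.symm q.2))

variable {e : OpenPartialHomeomorph M (Model n)} (he : e ∈ smoothCharts n M) {φ : ℝ → M → M}
  {ε : ℝ} {O : Set M} (hε : 0 < ε) (hO : IsOpen O)
  (hφ : ContMDiffOn (𝓘(ℝ, ℝ).prod 𝓘(ℝ, Model n)) 𝓘(ℝ, Model n) ∞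
      (fun q : ℝ × M => φ q.1 q.2) (Ioo (-ε) ε ×ˢ O))
  (h0 : ∀ x ∈ O, φ 0 x = x)

include hO hφ in
theorem contMDiffAt_flow {x : M} (hx : x ∈ O) {t : ℝ} (ht : t ∈ Ioo (-ε) ε) :
    ContMDiffAt (𝓘(ℝ, ℝ).prod 𝓘(ℝ, Model n)) 𝓘(ℝ, Model n) ∞ (fun q : ℝ × M => φ q.1 q.2) (t, x) :=
  hφ.contMDiffAt ((isOpen_Ioo.prod hO).mem_nhds ⟨ht, hx⟩)

include he hε hO hφ h0 in
theorem contDiffAt_chartFlow {u : Model n} (hu : u ∈ e.target) (huO : e.symm u ∈ O) :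
    ContDiffAt ℝ ∞ (chartFlow e φ) (0, u) := by
  have h1 := contMDiffAt_flow hO hφ huO (t := 0) ⟨by linarith, hε⟩
  have h2 : ContMDiffAt 𝓘(ℝ, Model n) 𝓘(ℝ, Model n) ∞ e.symm u :=
    contMDiffAt_symm_of_mem_maximalAtlas he hu
  have h3 : ContMDiffAt 𝓘(ℝ, Model n) 𝓘(ℝ, Model n) ∞ e (φ 0 (e.symm u)) := by
    rw [h0 _ huO]
    exact contMDiffAt_of_mem_maximalAtlas he (e.map_target hu)
  have h4 : ContMDiffAt (𝓘(ℝ, ℝ).prod 𝓘(ℝ, Model n)) (𝓘(ℝ, ℝ).prod 𝓘(ℝ, Model n)) ∞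
      (fun q : ℝ × Model n => (q.1, e.symm q.2)) ((0 : ℝ), u) :=
    contMDiffAt_fst.prodMk (ContMDiffAt.comp ((0 : ℝ), u) h2 contMDiffAt_snd)
  have h5 : ContMDiffAt (𝓘(ℝ, ℝ).prod 𝓘(ℝ, Model n)) 𝓘(ℝ, Model n) ∞
      (fun q : ℝ × Model n => φ q.1 (e.symm q.2)) ((0 : ℝ), u) :=
    ContMDiffAt.comp (x := ((0 : ℝ), u)) (g := fun q : ℝ × M => φ q.1 q.2) (f := fun q : ℝ × Model n => (q.1, e.symm q.2)) h1 h4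
  have h6 : ContMDiffAt (𝓘(ℝ, ℝ).prod 𝓘(ℝ, Model n)) 𝓘(ℝ, Model n) ∞ (chartFlow e φ)
      ((0 : ℝ), u) := ContMDiffAt.comp ((0 : ℝ), u) h3 h5
  rw [← modelWithCornersSelf_prod, chartedSpaceSelf_prod] at h6
  exact h6.contDiffAt

include hε hO hφ h0 in
theorem eventually_flow_mem {x : M} (hx : x ∈ O) (hxe : x ∈ e.source) :
    ∀ᶠ t in 𝓝 (0 : ℝ), φ t x ∈ e.source := by
  have h1 : ContinuousAt (fun q : ℝ × M => φ q.1 q.2) ((0 : ℝ), x) :=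
    (contMDiffAt_flow hO hφ hx (t := 0) ⟨by linarith, hε⟩).continuousAt
  have h2 : Filter.Tendsto (fun t : ℝ => (t, x)) (𝓝 0) (𝓝 ((0 : ℝ), x)) :=
    Filter.tendsto_id.prodMk_nhds tendsto_const_nhds
  have h3 := h1.tendsto.comp h2
  refine h3.eventually (e.open_source.mem_nhds ?_)
  change φ 0 x ∈ e.source
  rwa [h0 x hx]

include he hO hφ in
theorem coordVec_mfderiv_flow {t : ℝ} (ht : t ∈ Ioo (-ε) ε) {u : Model n} (hu : u ∈ e.target)
    (huO : e.symm u ∈ O) (hφe : φ t (e.symm u) ∈ e.source) (y : Model n) :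
    coordVec e (φ t (e.symm u))
      (mfderiv 𝓘(ℝ, Model n) 𝓘(ℝ, Model n) (φ t) (e.symm u) (symmDeriv e u y)) =
      fderiv ℝ (fun z => chartFlow e φ (t, z)) u y := by
  have d1 : MDifferentiableAt 𝓘(ℝ, Model n) 𝓘(ℝ, Model n) e.symm u :=
    mdifferentiableAt_symm_of_mem_maximalAtlas (mem_maximalAtlas_one he) hu
  have d2 : MDifferentiableAt 𝓘(ℝ, Model n) 𝓘(ℝ, Model n) (φ t) (e.symm u) := by
    have h1 := contMDiffAt_flow hO hφ huO ht
    have h2 : ContMDiffAt 𝓘(ℝ, Model n) (𝓘(ℝ, ℝ).prod 𝓘(ℝ, Model n)) ∞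
      (fun x : M => (t, x)) (e.symm u) := contMDiffAt_const.prodMk contMDiffAt_id
    exact (ContMDiffAt.comp (e.symm u) h1 h2).mdifferentiableAt (by simp)
  have d3 : MDifferentiableAt 𝓘(ℝ, Model n) 𝓘(ℝ, Model n) e (φ t (e.symm u)) :=
    mdifferentiableAt_of_mem_maximalAtlas (mem_maximalAtlas_one he) hφe
  have e1 := (d3.hasMFDerivAt.comp u (d2.hasMFDerivAt.comp u d1.hasMFDerivAt)).mfderiv
  have e2 := congrArg (fun L => L y) e1
  rw [mfderiv_eq_fderiv] at e2
  exact e2.symm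

include he hε h0 in
theorem hasDerivAt_chartFlow {V : ∀ x : M, TSpace n x} {u : Model n} (hu : u ∈ e.target)
    (huO : e.symm u ∈ O)
    (hV : IsMIntegralCurveOn (I := 𝓘(ℝ, Model n)) (fun t => φ t (e.symm u)) V (Ioo (-ε) ε)) :
    HasDerivAt (fun t => chartFlow e φ (t, u)) (chartField e V u) 0 := by
  have h1 := (hV 0 ⟨by linarith, hε⟩).hasMFDerivAt (Ioo_mem_nhds (by linarith) hε)
  have d3 : MDifferentiableAt 𝓘(ℝ, Model n) 𝓘(ℝ, Model n) e (φ 0 (e.symm u)) := by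
    rw [h0 _ huO]
    exact mdifferentiableAt_of_mem_maximalAtlas (mem_maximalAtlas_one he) (e.map_target hu)
  obtain ⟨L, hL, hL1⟩ : ∃ L : ℝ →L[ℝ] Model n,
      HasFDerivAt (fun t => chartFlow e φ (t, u)) L 0 ∧
        L 1 = coordVec e (φ 0 (e.symm u)) ((1 : ℝ) • V (φ 0 (e.symm u))) :=
    ⟨_, (HasMFDerivAt.comp (0 : ℝ) d3.hasMFDerivAt h1).hasFDerivAt, rfl⟩
  rw [one_smul] at hL1
  have h3 : coordVec e (φ 0 (e.symm u)) (V (φ 0 (e.symm u))) = chartField e V u :=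
    congrArg (fun z => (coordVec e z (V z) : Model n)) (h0 _ huO)
  rw [← h3, ← hL1]
  exact hL.hasDerivAt

end ConformalField

/-! ### Conformal fields are homothetic when the unit form is Killing. -/

section Homothety

variable {n : ℕ} {M : Type*} [TopologicalSpace M] [ChartedSpace (Model n) M]
  [IsManifold 𝓘(ℝ, Model n) ∞ M] {a : RMetric n M} {β : ∀ x : M, TSpace n x →L[ℝ] ℝ}
  (hβ : IsSmoothForm β) (hβ0 : ∀ x, β x ≠ 0)

include hβ hβ0

/-- The flow condition is written in the chart and differentiated at t = 0 by
`kropina_first_variation`; its algebraic consequences are those of `kropina_conformal_algebra`, with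
s = SV and T = ∇V. -/
theorem conformal_variation_inChart {e : OpenPartialHomeomorph M (Model n)}
    (he : e ∈ smoothCharts n M) {Γ : Model n → Model n →L[ℝ] Model n →L[ℝ] Model n}
    (hΓ : IsChristoffel e.target (normChartMetric e a β) Γ) {V : ∀ x : M, TSpace n x} {c : M → ℝ}
    (hV : IsSmoothField V) (hc : IsConformalField (kropinaDomain β) (kropina a β) V c)
    {u : Model n} (hu : u ∈ e.target) :
    (∀ y, normChartMetric e a β u (covDeriv Γ (chartField e V) u y) y =
      2 * c (e.symm u) * normChartMetric e a β u y y) ∧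
    covDeriv Γ (dualField e a β) u (chartField e V u) -
      covDeriv Γ (chartField e V) u (dualField e a β u) =
        -(2 * c (e.symm u)) • dualField e a β u := by
  have hh := isMetric_normChartMetric he hβ hβ0 (a := a)
  have hW := isUnitField_dualField he hβ hβ0 (a := a)
  have hVs := contDiffOn_chartField he hV
  refine kropina_conformal_algebra (hh.symm u hu) (hh.pos u hu) (hW.unit u hu)
    (metric_covDeriv_unit hh hΓ hW.smooth hW.unit hu _) fun y hy => ?_
  obtain ⟨ε, O, φ, σ, hε, hO, hpO, hφ, h0, hflow, hF, hσ⟩ := hc (e.symm u)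
  have hO' : ∀ᶠ z in 𝓝 u, z ∈ e.target ∧ e.symm z ∈ O :=
    Filter.Eventually.and (e.open_target.mem_nhds hu)
      ((e.continuousAt_symm hu).eventually (hO.mem_nhds hpO))
  have hd := hasDerivAt_fderiv_flow (contDiffAt_chartFlow he hε hO hφ h0 hu hpO)
    (hO'.mono fun z hz => hasDerivAt_chartFlow he hε h0 hz.1 hz.2 (hflow _ hz.2))
    (differentiableAt_of_contDiffOn e.open_target hVs hu) y
  have hid : (fun z => chartFlow e φ (0, z)) =ᶠ[𝓝 u] id := hO'.mono fun z hz => by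
    change e (φ 0 (e.symm z)) = z
    rw [h0 _ hz.2, e.right_inv hz.1]
  refine kropina_first_variation hh hW hΓ hu (γ := fun t => chartFlow e φ (t, u))
    hid.self_of_nhds (hasDerivAt_chartFlow he hε h0 hu hpO (hflow _ hpO)) ?_ hd (hσ _ hpO) hy ?_
  · rw [hid.fderiv_eq, fderiv_id]
    rfl
  · filter_upwards [eventually_flow_mem hε hO hφ h0 hpO (e.map_target hu),
      Ioo_mem_nhds (show -ε < (0 : ℝ) by linarith) hε] with t hte ht
    obtain ⟨h1, h2⟩ := hF t ht _ hpO (symmDeriv e u y) ((mem_kropinaDomain_iff he hβ0 hu y).2 hy)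
    have e1 := coordVec_mfderiv_flow he hO hφ ht hu hpO hte y
    have e2 := inChart_coordVec he (kropina a β) hte
      (mfderiv 𝓘(ℝ, Model n) 𝓘(ℝ, Model n) (φ t) (e.symm u) (symmDeriv e u y))
    have e3 := inChart_coordVec he (normForm a β) hte
      (mfderiv 𝓘(ℝ, Model n) 𝓘(ℝ, Model n) (φ t) (e.symm u) (symmDeriv e u y))
    have hm : chartFlow e φ (t, u) ∈ e.target := e.map_source hte
    rw [e1] at e2 e3
    refine ⟨?_, ?_⟩
    · rw [normChartMetric_dualField he hm]
      exact e3.symm ▸ div_pos h1 (normSq_pos hβ0 _)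
    · rw [← inChart_kropina he hβ0 hm, ← inChart_kropina he hβ0 hu]
      exact e2.trans h2

/-- The factor has zero derivative in every chart, so it is locally constant, and the manifold is
connected. -/
theorem conformalFactor_const_of_killing [ConnectedSpace M] (hn : 2 ≤ n)
    (hK : ∀ e ∈ smoothCharts n M, ∀ Γ, IsChristoffel e.target (normChartMetric e a β) Γ →
      ∀ u ∈ e.target, ∀ y,
        normChartMetric e a β u (covDeriv Γ (dualField e a β) u y) y = 0)
    {V : ∀ x : M, TSpace n x} {c : M → ℝ}
    (hV : IsSmoothField V) (hc : IsConformalField (kropinaDomain β) (kropina a β) V c) :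
    ∃ k, ∀ x, c x = k := by
  have hloc : IsLocallyConstant c := by
    refine (IsLocallyConstant.iff_eventually_eq c).2 fun p => ?_
    have he : chartAt (Model n) p ∈ smoothCharts n M := IsManifold.chart_mem_maximalAtlas p
    have hpe : p ∈ (chartAt (Model n) p).source := mem_chart_source (Model n) p
    generalize chartAt (Model n) p = e at he hpe
    have hh := isMetric_normChartMetric he hβ hβ0 (a := a)
    have hW := isUnitField_dualField he hβ hβ0 (a := a)
    have hVs := contDiffOn_chartField he hV
    obtain ⟨Γ, hΓ⟩ := hh.exists_christoffel
    have hT := fun u (hu : u ∈ e.target) => (conformal_variation_inChart hβ hβ0 he hΓ hV hc hu).1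
    have hB := fun u (hu : u ∈ e.target) => (conformal_variation_inChart hβ hβ0 he hΓ hV hc hu).2
    -- No regularity of c is assumed. It is smooth because evaluating the conformal equation on W
    -- gives c = h(∇_W V, W)/2.
    have hcs : ContDiffOn ℝ ∞ (fun u => c (e.symm u)) e.target := by
      have h1 := (((hh.smooth.clm_apply ((contDiffOn_covDeriv hh hΓ hVs).clm_apply
        hW.smooth)).clm_apply hW.smooth)).mul (contDiffOn_const (c := (1 / 2 : ℝ)))
      refine h1.congr fun u hu => ?_
      have := hT u hu (dualField e a β u)
      rw [hW.unit u hu] at this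
      simp only [this]
      ring
    have hd : ∀ u ∈ e.target, fderiv ℝ (fun u => c (e.symm u)) u = 0 := fun u hu =>
      fderiv_conformalFactor_eq_zero hh hW hΓ hn
        (fun x hx v w => by
          have k := hK e he Γ hΓ x hx
          have k1 := k (v + w)
          have k2 := k v
          have k3 := k w
          have k4 := hh.symm x hx v (covDeriv Γ (dualField e a β) x w)
          simp only [map_add, add_apply] at k1
          linarith) hVs hcs hT hB hu
    obtain ⟨r, hr, hsub⟩ := Metric.isOpen_iff.1 e.open_target (e p) (e.map_source hpe)
    have hev : ∀ᶠ q in 𝓝 p, q ∈ e.source ∧ e q ∈ ball (e p) r :=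
        Filter.Eventually.and (e.open_source.mem_nhds hpe)
        ((e.continuousAt hpe).eventually (isOpen_ball.mem_nhds (mem_ball_self hr)))
    filter_upwards [hev] with q hq
    have := isOpen_ball.is_const_of_fderiv_eq_zero (𝕜 := ℝ) (convex_ball (e p) r).isPreconnected
      ((hcs.mono hsub).differentiableOn (by simp)) (fun u hu => hd u (hsub hu)) hq.2
      (mem_ball_self hr)
    rwa [e.left_inv hq.1, e.left_inv hpe] at this
  obtain ⟨p⟩ := (inferInstance : Nonempty M)
  exact ⟨c p, fun x => hloc.apply_eq_of_preconnectedSpace x p⟩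

end Homothety

/-! ### Consequences of the curvature hypotheses on the manifold. -/

section Curvature

variable {n : ℕ} {M : Type*} [TopologicalSpace M] [ChartedSpace (Model n) M]
  [IsManifold 𝓘(ℝ, Model n) ∞ M] {a : RMetric n M} {β : ∀ x : M, TSpace n x →L[ℝ] ℝ}
  (hβ : IsSmoothForm β) (hβ0 : ∀ x, β x ≠ 0)
  {e : OpenPartialHomeomorph M (Model n)} (he : e ∈ smoothCharts n M)
  {Γ : Model n → Model n →L[ℝ] Model n →L[ℝ] Model n}

include hβ hβ0

include he in
theorem killing_inChart_of_weakEinstein (hn : 2 ≤ n)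
    (hE : IsWeakEinstein (kropinaDomain β) (kropina a β))
    (hΓ : IsChristoffel e.target (normChartMetric e a β) Γ) {u : Model n} (hu : u ∈ e.target)
    (y : Model n) : normChartMetric e a β u (covDeriv Γ (dualField e a β) u y) y = 0 := by
  obtain ⟨θ, σ, H⟩ := weakEinstein_inChart he hE hβ0 hu
  exact killing_of_weakEinstein (isMetric_normChartMetric he hβ hβ0)
    (isUnitField_dualField he hβ hβ0) hΓ hn (fun q hq => inChart_kropina he hβ0 hq.1 q.2) hu θ σ H y

omit hβ in
include he in
theorem energy_inChart_kropina {q : Model n × Model n}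
    (hq : q ∈ coneBundle e.target (normChartMetric e a β) (dualField e a β)) :
    energy (inChart e (kropina a β)) q.1 q.2 = (normChartMetric e a β q.1 q.2 q.2) ^ 2 /
      (normChartMetric e a β q.1 (dualField e a β q.1) q.2) ^ 2 := by
  rw [energy, inChart_kropina he hβ0 hq.1, div_pow]

/-- The trace of the flag curvature condition gives Ric = (n-1)κ g_y(y,y), and g_y(y,y) = F². So θ =
0 and σ = κ serve. -/
theorem weakEinstein_of_constFlagCurvature (hn : 2 ≤ n) {κ : ℝ}
    (hF : HasConstFlagCurvature (kropinaDomain β) (kropina a β) κ) :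
    IsWeakEinstein (kropinaDomain β) (kropina a β) := by
  refine ⟨0, fun _ => κ, fun e he x hx v hv => ?_⟩
  obtain ⟨u, hu, rfl⟩ : ∃ u ∈ e.target, e.symm u = x := ⟨e x, e.map_source hx, e.left_inv hx⟩
  obtain ⟨y, rfl⟩ : ∃ y, symmDeriv e u y = v := ⟨_, symmDeriv_coordVec he hu v⟩
  rw [coordVec_symmDeriv he hu, e.right_inv hu]
  have hh := isMetric_normChartMetric he hβ hβ0 (a := a)
  have hW := isUnitField_dualField he hβ hβ0 (a := a)
  have hy := (mem_kropinaDomain_iff (a := a) he hβ0 hu y).1 hv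
  have hen := fun q => energy_inChart_kropina hβ0 he (a := a) (q := q)
  have hq : (u, y) ∈ coneBundle e.target (normChartMetric e a β) (dualField e a β) := ⟨hu, hy⟩
  have hg := fundForm_kropina hh hW hen hq
  have hy0 : y ≠ 0 := fun h0 => by simp [h0] at hy
  rw [ricci_of_const_flag (fun v w => ?_) (fun w hw => fundForm_kropina_pos hh hW hen hq hw) hn hy0
    (fun w hw => flagCurvature_inChart he hF hu y w hv hw), hg]
  · have h1 := inChart_kropina (a := a) he hβ0 hu y
    have h2 : inChart e (kropina a β) u y = kropina a β (e.symm u) (symmDeriv e u y) := rfl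
    rw [← h2, h1]
    have hy' := hy.ne'
    simp only [kropinaTensor, Pi.zero_apply, zero_apply]
    field_simp
    ring
  · rw [hg, hg, hh.symm u hu v w]
    simp only [kropinaTensor]
    ring

include he in
theorem curv_inChart_of_constFlagCurvature (hn : 2 ≤ n) {κ : ℝ}
    (hF : HasConstFlagCurvature (kropinaDomain β) (kropina a β) κ)
    (hΓ : IsChristoffel e.target (normChartMetric e a β) Γ) {x : Model n} (hx : x ∈ e.target)
    (u v z : Model n) : curv Γ x u v z =
      (4 * κ) • (normChartMetric e a β x v z • u - normChartMetric e a β x u z • v) := by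
  have hh := isMetric_normChartMetric he hβ hβ0 (a := a)
  have hE := weakEinstein_of_constFlagCurvature hβ hβ0 hn hF
  refine curv_of_const_flag hh (isUnitField_dualField he hβ hβ0) hΓ (fun x hx v w => ?_)
    (fun q hq => energy_inChart_kropina hβ0 he hq) hn hx (fun y w hy hw =>
      flagCurvature_inChart he hF hx y w ((mem_kropinaDomain_iff he hβ0 hx y).2 hy) hw) u v z
  have k := killing_inChart_of_weakEinstein hβ hβ0 he hn hE hΓ hx
  have k1 := k (v + w)
  have k2 := k v
  have k3 := k w
  have k4 := hh.symm x hx v (covDeriv Γ (dualField e a β) x w)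
  simp only [map_add, add_apply] at k1
  linarith

theorem constFlagCurvature_normMetric (hn : 2 ≤ n) {κ : ℝ}
    (hF : HasConstFlagCurvature (kropinaDomain β) (kropina a β) κ) :
    HasConstFlagCurvature slit (normMetric a β) (4 * κ) := by
  intro e he x hx v hv w hw
  obtain ⟨u, hu, rfl⟩ : ∃ u ∈ e.target, e.symm u = x := ⟨e x, e.map_source hx, e.left_inv hx⟩
  have hinj : Function.Injective (coordVec e (e.symm u)) := fun v w hvw => by
    rw [← symmDeriv_coordVec he hu v, hvw, symmDeriv_coordVec he hu]
  have hh := isMetric_normChartMetric he hβ hβ0 (a := a)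
  obtain ⟨Γ, hΓ⟩ := hh.exists_christoffel
  rw [e.right_inv hu]
  refine flagCurvature_riemannian hh hΓ (fun x hx y => energy_normMetric he hβ hβ0 hx y) hu
    (curv_inChart_of_constFlagCurvature hβ hβ0 he hn hF hΓ hu) (fun h0 => hv (hinj ?_))
    (linearIndependent_pair_of_injective (L := (mfderiv 𝓘(ℝ, Model n) 𝓘(ℝ, Model n) e
      (e.symm u)).toLinearMap) hinj hw)
  rw [h0]
  exact (map_zero (mfderiv 𝓘(ℝ, Model n) 𝓘(ℝ, Model n) e (e.symm u))).symm

theorem isKillingForm_of_weakEinstein (hn : 2 ≤ n)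
    (hE : IsWeakEinstein (kropinaDomain β) (kropina a β)) :
    IsKillingForm (normMetric a β) (normForm a β) := by
  intro e he x hx v
  obtain ⟨Γ, hΓ⟩ := (isMetric_normChartMetric he hβ hβ0 (a := a)).exists_christoffel
  rw [symmCovDeriv_inChart he hβ hβ0 hΓ (e.map_source hx)]
  exact killing_inChart_of_weakEinstein hβ hβ0 he hn hE hΓ (e.map_source hx) _

end Curvature

/-! ### Assembly of the local normal form. -/

section ModelCoordinates

variable {n : ℕ} {M : Type*} [TopologicalSpace M] [ChartedSpace (Model n) M]
  [IsManifold 𝓘(ℝ, Model n) ∞ M] [ConnectedSpace M] {a : RMetric n M}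
  {β : ∀ x : M, TSpace n x →L[ℝ] ℝ}

theorem exists_model_coordinates_of_constFlagCurvature (hn : 2 ≤ n) (hβ : IsSmoothForm β)
    (hβ0 : ∀ x, β x ≠ 0) {κ : ℝ}
    (hF : HasConstFlagCurvature (kropinaDomain β) (kropina a β) κ) (p : M) :
    ∃ e ∈ smoothCharts n M, p ∈ e.source ∧ e p = 0 ∧
      ∃ (δ : Model n) (P : Model n →L[ℝ] Model n),
        IsSkew P ∧ ‖δ‖ = 1 / 2 ∧ P δ = 0 ∧
        (∀ u, P (P u) = -((4 * κ) • (u - (4 * inner ℝ δ u) • δ))) ∧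
        (∀ u ∈ e.target, 0 < 1 + 4 * κ * ‖u‖ ^ 2 ∧ ∀ y : Model n,
          inChart e (normMetric a β) u y = 2 * ‖y‖ / (1 + 4 * κ * ‖u‖ ^ 2) ∧
          inChart e (normForm a β) u y =
            4 * inner ℝ (modelField (4 * κ) δ P u) y / (1 + 4 * κ * ‖u‖ ^ 2) ^ 2) ∧
        ∀ (V : ∀ x : M, TSpace n x) (c : M → ℝ), IsSmoothField V →
          IsConformalField (kropinaDomain β) (kropina a β) V c →
          ∃ (k : ℝ) (γ : Model n) (Q : Model n →L[ℝ] Model n),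
            (∀ x, c x = k) ∧ 4 * κ * k = 0 ∧ IsSkew Q ∧ Q δ = P γ ∧
            (∀ u, P (Q u) - Q (P u) =
              (4 * (4 * κ)) • ((inner ℝ γ u) • δ - (inner ℝ δ u) • γ)) ∧
            ∀ x ∈ e.source, coordVec e x (V x) =
              (2 * k) • e x + modelField (4 * κ) γ Q (e x) := by
  have hE := weakEinstein_of_constFlagCurvature hβ hβ0 hn hF
  obtain ⟨e, he, hpe, hep, r, hr, het, hm⟩ : ∃ e ∈ smoothCharts n M, p ∈ e.source ∧ e p = 0 ∧
      ∃ r, 0 < r ∧ e.target = ball 0 r ∧ ∀ u ∈ e.target, 0 < 1 + 4 * κ * ‖u‖ ^ 2 ∧ ∀ v w,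
        normChartMetric e a β u v w = 4 * inner ℝ v w / (1 + 4 * κ * ‖u‖ ^ 2) ^ 2 := by
    have he : chartAt (Model n) p ∈ smoothCharts n M := IsManifold.chart_mem_maximalAtlas p
    obtain ⟨Γ, hΓ⟩ := (isMetric_normChartMetric he hβ hβ0 (a := a)).exists_christoffel
    exact exists_model_chart he hβ hβ0 hΓ
      (fun x hx => curv_inChart_of_constFlagCurvature hβ hβ0 he hn hF hΓ hx)
      (mem_chart_source (Model n) p)
  have hh := isMetric_normChartMetric he hβ hβ0 (a := a)
  have hW := isUnitField_dualField he hβ hβ0 (a := a)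
  obtain ⟨Γ, hΓ⟩ := hh.exists_christoffel
  have hK := fun x (hx : x ∈ e.target) =>
    killing_inChart_of_weakEinstein hβ hβ0 he hn hE hΓ hx
  obtain ⟨hP, hWm, hδ, hPδ, hPP⟩ := unit_killing_eq_modelField hh hΓ hm het hr hW hK
  refine ⟨e, he, hpe, hep, dualField e a β 0, fderiv ℝ (dualField e a β) 0, hP, hδ, hPδ, hPP,
    fun u hu => ⟨(hm u hu).1, fun y => ⟨?_, ?_⟩⟩, fun V c hV hc => ?_⟩
  · have h1 := energy_normMetric he hβ hβ0 (a := a) hu y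
    obtain ⟨hN, h2⟩ := hm u hu
    rw [h2, real_inner_self_eq_norm_sq, energy] at h1
    refine (sq_eq_sq₀ (Real.sqrt_nonneg _) (by positivity)).1 (h1.trans ?_)
    rw [div_pow]
    ring
  · rw [← normChartMetric_dualField he hu, (hm u hu).2, hWm u hu]
  · obtain ⟨k, hk⟩ := conformalFactor_const_of_killing hβ hβ0 hn (fun e he Γ hΓ u hu y =>
      killing_inChart_of_weakEinstein hβ hβ0 he hn hE hΓ hu y) hV hc
    have hvar := fun u (hu : u ∈ e.target) =>
      conformal_variation_inChart hβ hβ0 he hΓ hV hc hu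
    simp only [hk] at hvar
    obtain ⟨hμk, Q, hQ, h1, h2, h3⟩ := conformal_eq_modelField hh hΓ hm hn het hr hW hK
      (contDiffOn_chartField he hV) (fun u hu => (hvar u hu).1) (fun u hu => (hvar u hu).2)
    refine ⟨k, chartField e V 0, Q, hk, hμk, hQ, h1, h2, fun x hx => ?_⟩
    rw [← chartField_apply V hx]
    exact h3 _ (e.map_source hx)

end ModelCoordinates

end KropinaGeometry

end

open KropinaGeometry in
theorem theorem5p4 {n : ℕ} (hn : 2 ≤ n)
    {M : Type*} [TopologicalSpace M] [ChartedSpace (Model n) M]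
    [IsManifold 𝓘(ℝ, Model n) ∞ M] [ConnectedSpace M]
    (a : RMetric n M) (β : ∀ x : M, TSpace n x →L[ℝ] ℝ)
    (hβ : IsSmoothForm β) (hβ0 : ∀ x, β x ≠ 0) :
    (IsWeakEinstein (kropinaDomain β) (kropina a β) →
      ∀ (V : ∀ x : M, TSpace n x) (c : M → ℝ), IsSmoothField V →
        IsConformalField (kropinaDomain β) (kropina a β) V c → ∃ k : ℝ, ∀ x, c x = k) ∧
    (∀ κ : ℝ, HasConstFlagCurvature (kropinaDomain β) (kropina a β) κ →
      ∃ μ : ℝ,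
        HasConstFlagCurvature slit (normMetric a β) μ ∧
        IsKillingForm (normMetric a β) (normForm a β) ∧
        ∀ p : M, ∃ e ∈ smoothCharts n M, p ∈ e.source ∧ e p = 0 ∧
          ∃ (δ : Model n) (P : Model n →L[ℝ] Model n),
            IsSkew P ∧ ‖δ‖ = 1 / 2 ∧ P δ = 0 ∧
            (∀ u, P (P u) = -(μ • (u - (4 * inner ℝ δ u) • δ))) ∧
            (∀ u ∈ e.target, 0 < 1 + μ * ‖u‖ ^ 2 ∧ ∀ y : Model n,
              inChart e (normMetric a β) u y = 2 * ‖y‖ / (1 + μ * ‖u‖ ^ 2) ∧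
              inChart e (normForm a β) u y =
                4 * inner ℝ (modelField μ δ P u) y / (1 + μ * ‖u‖ ^ 2) ^ 2) ∧
            ∀ (V : ∀ x : M, TSpace n x) (c : M → ℝ), IsSmoothField V →
              IsConformalField (kropinaDomain β) (kropina a β) V c →
              ∃ (k : ℝ) (γ : Model n) (Q : Model n →L[ℝ] Model n),
                (∀ x, c x = k) ∧ μ * k = 0 ∧ IsSkew Q ∧ Q δ = P γ ∧
                (∀ u, P (Q u) - Q (P u) =
                  (4 * μ) • ((inner ℝ γ u) • δ - (inner ℝ δ u) • γ)) ∧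
                ∀ x ∈ e.source, coordVec e x (V x) =
                  (2 * k) • e x + modelField μ γ Q (e x)) := by
  refine ⟨fun hE V c hV hc => conformalFactor_const_of_killing hβ hβ0 hn
    (fun e he Γ hΓ u hu y => killing_inChart_of_weakEinstein hβ hβ0 he hn hE hΓ hu y) hV hc,
    -- The factor 4 reflects the radius 1/2 of the indicatrix, measured in the normalized metric.
    fun κ hF => ⟨4 * κ, constFlagCurvature_normMetric hβ hβ0 hn hF,
      isKillingForm_of_weakEinstein hβ hβ0 hn (weakEinstein_of_constFlagCurvature hβ hβ0 hn hF),
      exists_model_coordinates_of_constFlagCurvature hn hβ hβ0 hF⟩⟩
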